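/- Let $P=P_r\cup P_b$ be a bichromatic set of distinct points in the plane, where $P_r$ consists of $n\ge 1$ red points and $P_b$ of $m\ge 1$ blue points, and assume that no three points of $P$ are collinear. A (closed, nondegenerate, arbitrarily oriented) rectangle $U\subset\mathbb{R}^2$ is called red (respectively blue) if its interior contains no blue (respectively no red) point of $P$; opposite-coloured points may lie on its boundary. The size of a red (blue) rectangle is the number of red (blue) points in its interior or on its boundary. A largest monochromatic rectangle (LMR) is a red or blue rectangle whose size is maximum among all red and all blue rectangles. An algorithm is in-place if its input is given in an array, it uses only $O(1)$ extra workspace besides the array, and when it halts the array contains exactly the input elements, possibly in a different order. Here the array contains the $n+m$ points of $P$, each with its colour, in arbitrary order. The workspace consists of a constant number of registers, each of which holds either a copy of an input element or an integer of $O(\log(n+m))$ bits. In one step the program can perform a constant number of arithmetic operations on integer registers, read or write one array cell (written elements are taken from registers), compare two integers, test the colour of a stored element, or compare two numbers obtained by a constant number of exact arithmetic operations from integers and coordinates of stored points. Real numbers are not stored otherwise. Theorem. There is a single in-place algorithm that, for every such $P$ and every such array, halts and outputs an LMR of $P$ together with its colour (the rectangle being described by a vertex and the two side vectors at it), in $$O\bigl(m(m+n)(m\sqrt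 n+m\log m+n\log n)\bigr)$$ time using $O(1)$ extra workspace. -/

import Mathlib

/-! ### The geometric problem -/

/-- The Euclidean plane. -/
abbrev Plane := EuclideanSpace ℝ (Fin 2)

/-- The two colours of a bichromatic point set. -/
inductive Color
  | red
  | blue

/-- The opposite colour. -/
def Color.other : Color → Color
  | .red => .blue
  | .blue => .red

/-- No three distinct points of `S` are collinear. -/
def NoThreeCollinear (S : Set Plane) : Prop :=
  ∀ p ∈ S, ∀ q ∈ S, ∀ r ∈ S, p ≠ q → p ≠ r → q ≠ r → ¬ Collinear ℝ {p, q, r}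

/-- The closed parallelogram with vertices `c`, `c + v`, `c + w`, `c + v + w`. -/
def spanned (c v w : Plane) : Set Plane :=
  {x | ∃ s ∈ Set.Icc (0 : ℝ) 1, ∃ t ∈ Set.Icc (0 : ℝ) 1, x = c + s • v + t • w}

/-- `U` is a (closed, nondegenerate, arbitrarily oriented) rectangle. -/
def IsRectangle (U : Set Plane) : Prop :=
  ∃ c v w : Plane, v ≠ 0 ∧ w ≠ 0 ∧ inner ℝ v w = 0 ∧ U = spanned c v w

/-- `U` is a rectangle of colour `col` for the bichromatic set `P`: it has no point of the other
colour in its interior (such points are allowed on its boundary). -/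
def IsColoredRectangle (P : Color → Finset Plane) (col : Color) (U : Set Plane) : Prop :=
  IsRectangle U ∧ ∀ p ∈ P col.other, p ∉ interior U

/-- The size of a rectangle of colour `col`: the number of points of that colour inside `U` or on
its boundary. -/
noncomputable def rectangleSize (P : Color → Finset Plane) (col : Color) (U : Set Plane) : ℕ :=
  ({p : Plane | p ∈ P col ∧ p ∈ U} : Set Plane).ncard

/-- `U` is a largest monochromatic rectangle of `P`, and `col` is its colour: the size of `U` is
maximum among all red and all blue rectangles. -/
def IsLMR (P : Color → Finset Plane) (col : Color) (U : Set Plane) : Prop :=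
  IsColoredRectangle P col U ∧
    ∀ (col' : Color) (U' : Set Plane), IsColoredRectangle P col' U' →
      rectangleSize P col' U' ≤ rectangleSize P col U

/-! ### In-place algorithms

The input is an array of coloured points. A program owns `k` integer registers and `k` element
registers, where `k` belongs to the program and does not depend on the input. An integer register
holds a machine word, that is, a number that does not exceed a given bound `W`; an element register
holds a copy of an array element. Real numbers are computed exactly by expressions in the
coordinates of the points in the element registers; such a number can be compared or put out,
but it is never stored, so that no information can be hidden in the digits of a real number. -/

/-- An array element: a point together with its colour. -/
abbrev Elem := Color × Plane

/-- A machine state, for an array of `N` elements and `k` registers of each kind. The field `out` is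
write-only; it holds the last rectangle that was put out, as a colour, a vertex, and the vectors
from that vertex to the two adjacent vertices. -/
structure State (N k : ℕ) where
  arr : Fin N → Elem
  word : Fin k → ℕ
  elem : Fin k → Elem
  out : Option (Color × Plane × Plane × Plane)

/-- The state in which a program is started on the array `a`. -/
def State.init {N : ℕ} (k : ℕ) (a : Fin N → Elem) : State N k where
  arr := a
  word := fun _ => 0
  elem := fun _ => (Color.red, 0)
  out := none

/-- Integer expressions. `len` is the length of the array. -/
inductive WordExpr (k : ℕ)
  | const (c : ℕ)
  | len
  | reg (i : Fin k)
  | add (e f : WordExpr k)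
  | sub (e f : WordExpr k)
  | mul (e f : WordExpr k)
  | div (e f : WordExpr k)

/-- Value of an integer expression (truncated subtraction, division rounded down). -/
def WordExpr.eval {N k : ℕ} (s : State N k) : WordExpr k → ℕ
  | .const c => c
  | .len => N
  | .reg i => s.word i
  | .add e f => e.eval s + f.eval s
  | .sub e f => e.eval s - f.eval s
  | .mul e f => e.eval s * f.eval s
  | .div e f => e.eval s / f.eval s

/-- Real expressions: arithmetic on integers and on the coordinates of the points in the element
registers. -/
inductive RealExpr (k : ℕ)
  | ofWord (e : WordExpr k)
  | coord (r : Fin k) (j : Fin 2)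
  | add (e f : RealExpr k)
  | sub (e f : RealExpr k)
  | mul (e f : RealExpr k)
  | div (e f : RealExpr k)

/-- Value of a real expression. -/
noncomputable def RealExpr.eval {N k : ℕ} (s : State N k) : RealExpr k → ℝ
  | .ofWord e => (e.eval s : ℝ)
  | .coord r j => (s.elem r).2 j
  | .add e f => e.eval s + f.eval s
  | .sub e f => e.eval s - f.eval s
  | .mul e f => e.eval s * f.eval s
  | .div e f => e.eval s / f.eval s

/-- Tests. -/
inductive Test (k : ℕ)
  | wordLE (e f : WordExpr k)
  | realLE (e f : RealExpr k)
  | isRed (r : Fin k)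
  | not (b : Test k)
  | and (b c : Test k)

/-- The test succeeds in the state `s`. -/
def Test.Holds {N k : ℕ} (s : State N k) : Test k → Prop
  | .wordLE e f => e.eval s ≤ f.eval s
  | .realLE e f => e.eval s ≤ f.eval s
  | .isRed r => (s.elem r).1 = Color.red
  | .not b => ¬ b.Holds s
  | .and b c => b.Holds s ∧ c.Holds s

/-- A point given by two real expressions. -/
abbrev PointExpr (k : ℕ) := RealExpr k × RealExpr k

/-- Value of a point expression. -/
noncomputable def PointExpr.eval {N k : ℕ} (s : State N k) (e : PointExpr k) : Plane :=
  !₂[RealExpr.eval s e.1, RealExpr.eval s e.2]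

/-- Programs with `k` registers of each kind. -/
inductive Program (k : ℕ)
  | skip
  /-- put the value of an integer expression into an integer register -/
  | assign (i : Fin k) (e : WordExpr k)
  /-- copy an element register into another one -/
  | copy (r r' : Fin k)
  /-- read the array element at a computed position into an element register -/
  | load (r : Fin k) (e : WordExpr k)
  /-- write the content of an element register to a computed position of the array -/
  | store (e : WordExpr k) (r : Fin k)
  /-- put out a colour, a vertex and two side vectors -/
  | output (col : Color) (c v w : PointExpr k)
  | seq (p q : Program k)
  | branch (b : Test k) (p q : Program k)
  | loop (b : Test k) (p : Program k)

/-- `Exec W p s t s'`: started in the state `s`, the program `p` halts in the state `s'` after `t`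
steps. Every elementary instruction and every evaluation of a test is one step. A program is stuck
(there is no derivation) if it accesses a position outside the array or if the number to be put
into an integer register exceeds the word bound `W`. -/
inductive Exec {N k : ℕ} (W : ℕ) : Program k → State N k → ℕ → State N k → Prop
  | skip (s : State N k) : Exec W .skip s 1 s
  | assign (s : State N k) (i : Fin k) (e : WordExpr k) (h : e.eval s ≤ W) :
      Exec W (.assign i e) s 1 { s with word := Function.update s.word i (e.eval s) }
  | copy (s : State N k) (r r' : Fin k) :
      Exec W (.copy r r') s 1 { s with elem := Function.update s.elem r (s.elem r') }
  | load (s : State N k) (r : Fin k) (e : WordExpr k) (h : e.eval s < N) :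
      Exec W (.load r e) s 1 { s with elem := Function.update s.elem r (s.arr ⟨e.eval s, h⟩) }
  | store (s : State N k) (e : WordExpr k) (r : Fin k) (h : e.eval s < N) :
      Exec W (.store e r) s 1 { s with arr := Function.update s.arr ⟨e.eval s, h⟩ (s.elem r) }
  | output (s : State N k) (col : Color) (c v w : PointExpr k) :
      Exec W (.output col c v w) s 1 { s with out := some (col, c.eval s, v.eval s, w.eval s) }
  | seq {p q : Program k} {s s₁ s₂ : State N k} {t₁ t₂ : ℕ}
      (h₁ : Exec W p s t₁ s₁) (h₂ : Exec W q s₁ t₂ s₂) : Exec W (.seq p q) s (t₁ + t₂) s₂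
  | branch_true {b : Test k} {p q : Program k} {s s' : State N k} {t : ℕ}
      (hb : b.Holds s) (h : Exec W p s t s') : Exec W (.branch b p q) s (t + 1) s'
  | branch_false {b : Test k} {p q : Program k} {s s' : State N k} {t : ℕ}
      (hb : ¬ b.Holds s) (h : Exec W q s t s') : Exec W (.branch b p q) s (t + 1) s'
  | loop_false {b : Test k} {p : Program k} {s : State N k}
      (hb : ¬ b.Holds s) : Exec W (.loop b p) s 1 s
  | loop_true {b : Test k} {p : Program k} {s s₁ s₂ : State N k} {t₁ t₂ : ℕ}
      (hb : b.Holds s) (h₁ : Exec W p s t₁ s₁) (h₂ : Exec W (.loop b p) s₁ t₂ s₂) :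
      Exec W (.loop b p) s (t₁ + t₂ + 1) s₂

/-- The array `a` lists every point of the bichromatic set `P`, with its colour, exactly once. -/
def IsListing {N : ℕ} (a : Fin N → Elem) (P : Color → Finset Plane) : Prop :=
  Function.Injective a ∧ ∀ (col : Color) (p : Plane), (∃ i, a i = (col, p)) ↔ p ∈ P col

/-! The geometric core is a reduction to boxes resting on a bichromatic pair. Let `S` be the
nonempty set of points of its own colour in a coloured rectangle. Only the bounding box of `S` in
the direction of the rectangle matters, and its interior contains no point of the other colour. Turn
the direction. For each point `q` of the other colour, `clearance` is the largest of the four signed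
distances by which `q` lies beyond a side of the bounding box. It is continuous in the direction,
and it is nonnegative exactly when `q` is outside the open box. By the intermediate value theorem on
the connected set of nonzero directions there is a direction that is still admissible and in which
some `o` of the other colour lies on the line of a side; this side carries some `s` in `S`
(`exists_tangent_direction`, `exists_isConfig_of_direction`). Hence it suffices to find, for every
ordered pair `s`, `o` of different colours and every choice of the two axis signs, the largest box
with base on the line `so`.

For one such frame a line is swept upwards from the base. The points of the other colour already
passed are obstacles; on each side of `s` only the nearest one counts. A passed point of the colour
of `s` stays alive as long as it is not beyond the nearest obstacle of its side. Limits only shrink,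
so each side needs a max-heap ordered by the distance from `s`: a new obstacle pops the points
beyond it, and every point is pushed and popped at most once. When the sweep is at height `h`, the
box up to `h` between the two limits is a legal rectangle that contains `s` and both heaps
(`achieves_box`). Conversely, when the topmost point of a configuration is handled, all its other
points are `s` or in the heaps (`SweepComplete.step`). No three points being collinear, the base
line carries only `s` and `o`.

Everything is kept in place. The array is heapsorted so that the points on the left of `s` come
first, each side in sweep order; each heap occupies the front of the part its side has passed.
Limits are stored as points, together with a bit that says whether to add one. After a pair is done,
the array is sorted lexicographically again. This order is unique for distinct points, so a single
counter enumerates the pairs by their array positions (`runs_mainLoop`).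

There are `2mn` ordered bichromatic pairs, four frames for each, and `O(N log N)` time for a frame,
where `N = n + m`; the other pairs cost `O(N²)` altogether. The total `O(mn(m+n) log(m+n))` is
within the claim because `n log(m+n)` is at most a constant times `m√n + m log m + n log n`
(`time_bound`). -/

namespace LMR

/-! ### A program logic with running times -/

section Logic

variable {N k W : ℕ}

/-- Started in `s`, the program `p` halts, and `Q` holds of the number of steps and the final
state. -/
def Runs (W : ℕ) (p : Program k) (s : State N k) (Q : ℕ → State N k → Prop) : Prop :=
  ∃ t s', Exec W p s t s' ∧ Q t s'

theorem Runs.mono {p : Program k} {s : State N k} {Q Q' : ℕ → State N k → Prop}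
    (h : Runs W p s Q) (hQ : ∀ t s', Q t s' → Q' t s') : Runs W p s Q' := by
  obtain ⟨t, s', he, hq⟩ := h
  exact ⟨t, s', he, hQ t s' hq⟩

theorem runs_skip {s : State N k} {Q : ℕ → State N k → Prop} (h : Q 1 s) :
    Runs W .skip s Q := ⟨1, s, .skip s, h⟩

theorem runs_assign {s : State N k} {i : Fin k} {e : WordExpr k} {Q : ℕ → State N k → Prop}
    (hW : e.eval s ≤ W) (h : Q 1 { s with word := Function.update s.word i (e.eval s) }) :
    Runs W (.assign i e) s Q := ⟨_, _, .assign s i e hW, h⟩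

theorem runs_copy {s : State N k} {r r' : Fin k} {Q : ℕ → State N k → Prop}
    (h : Q 1 { s with elem := Function.update s.elem r (s.elem r') }) :
    Runs W (.copy r r') s Q := ⟨_, _, .copy s r r', h⟩

theorem runs_load {s : State N k} {r : Fin k} {e : WordExpr k} {Q : ℕ → State N k → Prop}
    (hN : e.eval s < N)
    (h : Q 1 { s with elem := Function.update s.elem r (s.arr ⟨e.eval s, hN⟩) }) :
    Runs W (.load r e) s Q := ⟨_, _, .load s r e hN, h⟩

theorem runs_store {s : State N k} {r : Fin k} {e : WordExpr k} {Q : ℕ → State N k → Prop}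
    (hN : e.eval s < N)
    (h : Q 1 { s with arr := Function.update s.arr ⟨e.eval s, hN⟩ (s.elem r) }) :
    Runs W (.store e r) s Q := ⟨_, _, .store s e r hN, h⟩

theorem runs_output {s : State N k} {col : Color} {c v w : PointExpr k}
    {Q : ℕ → State N k → Prop}
    (h : Q 1 { s with out := some (col, c.eval s, v.eval s, w.eval s) }) :
    Runs W (.output col c v w) s Q := ⟨_, _, .output s col c v w, h⟩

theorem runs_seq {p q : Program k} {s : State N k} {Q : ℕ → State N k → Prop}
    (h : Runs W p s fun t s' => Runs W q s' fun t' s'' => Q (t + t') s'') :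
    Runs W (.seq p q) s Q := by
  obtain ⟨t, s', he, t', s'', he', hq⟩ := h
  exact ⟨_, _, .seq he he', hq⟩

theorem runs_branch {b : Test k} {p q : Program k} {s : State N k} {Q : ℕ → State N k → Prop}
    (h₁ : b.Holds s → Runs W p s fun t s' => Q (t + 1) s')
    (h₂ : ¬ b.Holds s → Runs W q s fun t s' => Q (t + 1) s') :
    Runs W (.branch b p q) s Q := by
  by_cases hb : b.Holds s
  · obtain ⟨t, s', he, hq⟩ := h₁ hb
    exact ⟨_, _, .branch_true hb he, hq⟩
  · obtain ⟨t, s', he, hq⟩ := h₂ hb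
    exact ⟨_, _, .branch_false hb he, hq⟩

/-- The loop rule, with invariant `I` and potential `Φ` that pays for the iterations. -/
theorem runs_loop {b : Test k} {p : Program k} (I : State N k → Prop) (Φ : State N k → ℕ)
    (h : ∀ s, I s → b.Holds s → Runs W p s fun t s' => I s' ∧ t + 1 + Φ s' ≤ Φ s)
    {s : State N k} (hs : I s) :
    Runs W (.loop b p) s fun t s' => I s' ∧ ¬ b.Holds s' ∧ t + Φ s' ≤ Φ s + 1 := by
  induction hn : Φ s using Nat.strong_induction_on generalizing s with
  | _ n ih =>
    by_cases hb : b.Holds s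
    · obtain ⟨t, s', he, hI, ht⟩ := h s hs hb
      obtain ⟨t', s'', he', hI', hb', ht'⟩ := ih (Φ s') (by omega) hI rfl
      exact ⟨_, _, .loop_true hb he he', hI', hb', by omega⟩
    · exact ⟨_, _, .loop_false hb, hs, hb, by omega⟩

/-- The array of a state as a function of all natural numbers. -/
def cell (s : State N k) (i : ℕ) : Elem := if h : i < N then s.arr ⟨i, h⟩ else (Color.red, 0)

theorem cell_of_lt (s : State N k) {i : ℕ} (h : i < N) : cell s i = s.arr ⟨i, h⟩ := by
  simp [cell, h]

theorem cell_congr {s s' : State N k} (h : s'.arr = s.arr) : cell s' = cell s := by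
  funext i; simp [cell, h]

/-- The array after an exchange of two elements. -/
theorem cell_exchange {s s' : State N k} {i j : ℕ} (hi : i < N) (hj : j < N)
    (h : s'.arr = Function.update (Function.update s.arr ⟨i, hi⟩ (cell s j)) ⟨j, hj⟩ (cell s i)) :
    cell s' = cell s ∘ Equiv.swap i j := by
  funext l
  simp only [Function.comp]
  by_cases hl : l < N
  · rw [cell_of_lt s' hl, h]
    by_cases h1 : l = j
    · subst h1; simp
    · rw [Function.update_of_ne (by simpa using h1)]
      by_cases h2 : l = i
      · subst h2; simp
      · rw [Function.update_of_ne (by simpa using h2), Equiv.swap_apply_of_ne_of_ne h2 h1,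
          cell_of_lt s hl]
  · rw [Equiv.swap_apply_of_ne_of_ne (by omega) (by omega)]
    simp [cell, hl]

end Logic

/-! ### Rearrangements -/

section Rearrangement

variable {α : Type*} {a b lo hi : ℕ} {f g h : ℕ → α}

/-- `g` arises from `f` by a permutation of the positions in `[a, b)`. -/
def PermOn (a b : ℕ) (f g : ℕ → α) : Prop :=
  ∃ π : Equiv.Perm ℕ, (∀ i, i < a ∨ b ≤ i → π i = i) ∧ g = f ∘ π

theorem PermOn.refl (a b : ℕ) (f : ℕ → α) : PermOn a b f f := ⟨1, by simp, by simp⟩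

theorem PermOn.swap (f : ℕ → α) {i j : ℕ} (hi : a ≤ i ∧ i < b) (hj : a ≤ j ∧ j < b) :
    PermOn a b f (f ∘ Equiv.swap i j) :=
  ⟨Equiv.swap i j, fun l hl => Equiv.swap_apply_of_ne_of_ne (by omega) (by omega), rfl⟩

theorem PermOn.trans (h₁ : PermOn a b f g) (h₂ : PermOn a b g h) : PermOn a b f h := by
  obtain ⟨π, hπ, rfl⟩ := h₁
  obtain ⟨ρ, hρ, rfl⟩ := h₂
  refine ⟨ρ.trans π, fun i hi => ?_, rfl⟩
  simp [hρ i hi, hπ i hi]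

theorem PermOn.mono (h₁ : PermOn a b f g) (ha : lo ≤ a) (hb : b ≤ hi) : PermOn lo hi f g := by
  obtain ⟨π, hπ, rfl⟩ := h₁
  exact ⟨π, fun i hi => hπ i (by omega), rfl⟩

theorem PermOn.eq_outside (h₁ : PermOn a b f g) {i : ℕ} (hi : i < a ∨ b ≤ i) : g i = f i := by
  obtain ⟨π, hπ, rfl⟩ := h₁
  simp [hπ i hi]

theorem PermOn.symm (h₁ : PermOn a b f g) : PermOn a b g f := by
  obtain ⟨π, hπ, rfl⟩ := h₁
  refine ⟨π.symm, fun i hi => ?_, by funext i; simp⟩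
  rw [Equiv.symm_apply_eq, hπ i hi]

/-- Every value in a rearranged block comes from the block. -/
theorem PermOn.exists_eq (h₁ : PermOn a b f g) {i : ℕ} (hi : a ≤ i ∧ i < b) :
    ∃ j, (a ≤ j ∧ j < b) ∧ g i = f j := by
  obtain ⟨π, hπ, rfl⟩ := h₁
  refine ⟨π i, ?_, rfl⟩
  by_contra hc
  have := hπ (π i) (by omega)
  rw [π.injective.eq_iff] at this
  omega

/-- A permutation of the positions that fixes everything from `b` on cannot move a position below `n
≥ b` to one at or above `n`. -/
theorem PermOn.injOn (h₁ : PermOn a b f g) {n : ℕ} (hb : b ≤ n)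
    (hf : Set.InjOn f (Set.Iio n)) : Set.InjOn g (Set.Iio n) := by
  obtain ⟨π, hπ, rfl⟩ := h₁
  have key : ∀ i < n, π i < n := fun i hi => by
    by_contra hc
    have := hπ (π i) (by omega)
    rw [π.injective.eq_iff] at this
    omega
  intro i hi j hj hij
  exact π.injective (hf (key i hi) (key j hj) hij)

end Rearrangement

/-! ### Binary heaps -/

section Heap

variable {κ : Type*} [LinearOrder κ] {f : ℕ → κ} {n pos c : ℕ}

/-- The first `n` values of `f` form a binary heap with the maximum in the root. -/
def IsHeap (f : ℕ → κ) (n : ℕ) : Prop := ∀ i, 0 < i → i < n → f i ≤ f ((i - 1) / 2)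

theorem IsHeap.le_root (h : IsHeap f n) {i : ℕ} (hi : i < n) : f i ≤ f 0 := by
  induction i using Nat.strong_induction_on with
  | _ i ih =>
    rcases Nat.eq_zero_or_pos i with rfl | h0
    · exact le_rfl
    · exact (h i h0 hi).trans (ih _ (by omega) (by omega))

/-- A heap in which only the value at `pos` may be too large. -/
def HeapUp (f : ℕ → κ) (n pos : ℕ) : Prop :=
  (∀ i, 0 < i → i < n → i ≠ pos → f i ≤ f ((i - 1) / 2)) ∧
    (0 < pos → ∀ i, 0 < i → i < n → (i - 1) / 2 = pos → f i ≤ f ((pos - 1) / 2))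

/-- A heap in which only the value at `pos` may be too small. -/
def HeapDown (f : ℕ → κ) (n pos : ℕ) : Prop :=
  (∀ i, 0 < i → i < n → (i - 1) / 2 ≠ pos → f i ≤ f ((i - 1) / 2)) ∧
    (0 < pos → ∀ i, 0 < i → i < n → (i - 1) / 2 = pos → f i ≤ f ((pos - 1) / 2))

theorem HeapUp.isHeap (h : HeapUp f n pos) (hs : ¬ f ((pos - 1) / 2) < f pos) : IsHeap f n := by
  intro i h0 hi
  by_cases hp : i = pos
  · subst hp; exact not_lt.mp hs
  · exact h.1 i h0 hi hp

/-- The children of `pos` get the old parent value above them, which bounds them by the second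
clause of `HeapUp`; the sibling is below the old parent value and hence below the new one. The
second clause at the new position comes from the order between the old parent and its own parent. -/
theorem HeapUp.step (h : HeapUp f n pos) (hn : pos < n) (hs : f ((pos - 1) / 2) < f pos) :
    HeapUp (f ∘ Equiv.swap pos ((pos - 1) / 2)) n ((pos - 1) / 2) := by
  have h0 : 0 < pos := by
    rcases Nat.eq_zero_or_pos pos with rfl | h0
    · simp at hs
    · exact h0
  obtain ⟨h1, h2⟩ := h
  replace h2 := h2 h0
  have hne : pos ≠ (pos - 1) / 2 := by omega
  have e1 : ∀ i, i ≠ pos → i ≠ (pos - 1) / 2 → Equiv.swap pos ((pos - 1) / 2) i = i :=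
    fun i => Equiv.swap_apply_of_ne_of_ne
  have e2 := Equiv.swap_apply_left pos ((pos - 1) / 2)
  have e3 := Equiv.swap_apply_right pos ((pos - 1) / 2)
  refine ⟨fun i hi0 hin hip => ?_, fun hp0 i hi0 hin hip => ?_⟩ <;> simp only [Function.comp]
  · by_cases hi : i = pos
    · subst hi; rw [e2, e3]; exact hs.le
    · rw [e1 i hi hip]
      by_cases hq : (i - 1) / 2 = pos
      · rw [hq, e2]; exact h2 i hi0 hin hq
      · by_cases hr : (i - 1) / 2 = (pos - 1) / 2
        · rw [hr, e3]; have := h1 i hi0 hin hi; rw [hr] at this; exact this.trans hs.le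
        · rw [e1 _ hq hr]; exact h1 i hi0 hin hi
  · rw [e1 (((pos - 1) / 2 - 1) / 2) (by omega) (by omega)]
    have hpar := h1 ((pos - 1) / 2) hp0 (by omega) (by omega)
    by_cases hi : i = pos
    · subst hi; rw [e2]; exact hpar
    · rw [e1 i hi (by omega)]
      have := h1 i hi0 hin hi
      rw [hip] at this
      exact this.trans hpar

theorem HeapDown.isHeap (h : HeapDown f n pos) (h₁ : 2 * pos + 1 < n → f (2 * pos + 1) ≤ f pos)
    (h₂ : 2 * pos + 2 < n → f (2 * pos + 2) ≤ f pos) : IsHeap f n := by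
  intro i h0 hi
  by_cases hp : (i - 1) / 2 = pos
  · rcases (by omega : i = 2 * pos + 1 ∨ i = 2 * pos + 2) with rfl | rfl
    · rw [hp]; exact h₁ hi
    · rw [hp]; exact h₂ hi
  · exact h.1 i h0 hi hp

/-- The value that moves up from `c` dominates both children of `pos`, and by the second clause of
`HeapDown` it does not exceed the parent of `pos`; so only `c` can still violate the order. -/
theorem HeapDown.step (h : HeapDown f n pos) (hc : c = 2 * pos + 1 ∨ c = 2 * pos + 2)
    (hcn : c < n) (hs : f pos < f c) (h₁ : 2 * pos + 1 < n → f (2 * pos + 1) ≤ f c)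
    (h₂ : 2 * pos + 2 < n → f (2 * pos + 2) ≤ f c) : HeapDown (f ∘ Equiv.swap pos c) n c := by
  have e1 : ∀ i, i ≠ pos → i ≠ c → Equiv.swap pos c i = i :=
    fun i => Equiv.swap_apply_of_ne_of_ne
  have e2 := Equiv.swap_apply_left pos c
  have e3 := Equiv.swap_apply_right pos c
  have hcp : (c - 1) / 2 = pos := by omega
  obtain ⟨g1, g2⟩ := h
  refine ⟨fun i hi0 hin hip => ?_, fun hp0 i hi0 hin hip => ?_⟩ <;> simp only [Function.comp]
  · by_cases hi : i = c
    · subst hi; rw [e3, hcp, e2]; exact hs.le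
    · by_cases hq : (i - 1) / 2 = pos
      · rw [hq, e2, e1 i (by omega) hi]
        rcases (by omega : i = 2 * pos + 1 ∨ i = 2 * pos + 2) with rfl | rfl
        · exact h₁ hin
        · exact h₂ hin
      · rw [e1 _ hq hip]
        by_cases hr : i = pos
        · subst hr; rw [e2]
          exact g2 hi0 c (by omega) hcn hcp
        · rw [e1 i hr hi]; exact g1 i hi0 hin hq
  · rw [hcp, e2, e1 i (by omega) (by omega)]
    have := g1 i hi0 hin (by omega)
    rwa [hip] at this

theorem IsHeap.heapUp (h : IsHeap f n) : HeapUp f (n + 1) n :=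
  ⟨fun i h0 hi hn => h i h0 (by omega), fun _ i h0 hi hin => by omega⟩

theorem IsHeap.heapDown {g : ℕ → κ} (h : IsHeap f n) (hg : ∀ i, 0 < i → i < n - 1 → g i = f i) :
    HeapDown g (n - 1) 0 := by
  refine ⟨fun i h0 hi hn => ?_, fun h0 => absurd h0 (lt_irrefl 0)⟩
  rw [hg i h0 hi, hg ((i - 1) / 2) (by omega) (by omega)]
  exact h i h0 (by omega)

end Heap

/-! ### Heaps in the array -/

section HeapPrograms

variable {N W : ℕ}

/-- Registers outside `ws` and `es`, and the output, are the same in both states. -/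
structure Keeps (ws es : List (Fin 16)) (s s' : State N 16) : Prop where
  word : ∀ i, i ∉ ws → s'.word i = s.word i
  elem : ∀ r, r ∉ es → s'.elem r = s.elem r
  out : s'.out = s.out

variable {ws es ws' es' : List (Fin 16)} {s s' s'' : State N 16}

theorem Keeps.refl (ws es : List (Fin 16)) (s : State N 16) : Keeps ws es s s :=
  ⟨fun _ _ => rfl, fun _ _ => rfl, rfl⟩

theorem Keeps.trans (h : Keeps ws es s s') (h' : Keeps ws es s' s'') : Keeps ws es s s'' :=
  ⟨fun i hi => (h'.word i hi).trans (h.word i hi), fun i hi => (h'.elem i hi).trans (h.elem i hi),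
    h'.out.trans h.out⟩

theorem Keeps.mono (h : Keeps ws es s s') (hw : ws ⊆ ws') (he : es ⊆ es') : Keeps ws' es' s s' :=
  ⟨fun i hi => h.word i fun hc => hi (hw hc), fun i hi => h.elem i fun hc => hi (he hc), h.out⟩

/-- Position `e` of the current heap, whose root is at the position given by register 9. -/
def heapPos (e : WordExpr 16) : WordExpr 16 := .add (.reg 9) e

def parentExpr : WordExpr 16 := .div (.sub (.reg 11) (.const 1)) (.const 2)

def childExpr (d : ℕ) : WordExpr 16 := .add (.mul (.const 2) (.reg 11)) (.const d)

/-- Comparison of two integer expressions. -/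
def wordLT (e f : WordExpr 16) : Test 16 := .not (.wordLE f e)

/-- Move the element at the position in register 11 up to its place in the heap. -/
def siftUp (lt : Fin 16 → Fin 16 → Test 16) : Program 16 :=
  .seq (.load 5 (heapPos (.reg 11))) <| .seq (.load 6 (heapPos parentExpr)) <|
  -- At the root the truncated subtraction makes the root its own parent, so the strict test fails
  -- and the loop stops without a separate check.
  .loop (lt 6 5) <|
    .seq (.store (heapPos (.reg 11)) 6) <| .seq (.store (heapPos parentExpr) 5) <|
    .seq (.assign 11 parentExpr) (.load 6 (heapPos parentExpr))

/-- Let registers 12 and 7 refer to the child `2 * pos + d` if it is larger. -/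
def tryChild (lt : Fin 16 → Fin 16 → Test 16) (d : ℕ) : Program 16 :=
  .branch (wordLT (childExpr d) (.reg 10))
    (.seq (.load 6 (heapPos (childExpr d)))
      (.branch (lt 7 6) (.seq (.assign 12 (childExpr d)) (.copy 7 6)) .skip))
    .skip

/-- Find the largest among the element at the position in register 11 and its children. -/
def selectLargest (lt : Fin 16 → Fin 16 → Test 16) : Program 16 :=
  .seq (.assign 12 (.reg 11)) <| .seq (.copy 7 5) <| .seq (tryChild lt 1) (tryChild lt 2)

/-- Move the element at the position in register 11 down to its place in the heap. -/
def siftDown (lt : Fin 16 → Fin 16 → Test 16) : Program 16 :=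
  .seq (.load 5 (heapPos (.reg 11))) <| .seq (selectLargest lt) <|
  -- A child has a larger position than its parent, so this inequality says exactly that a larger
  -- child was selected.
  .loop (.not (.wordLE (.reg 12) (.reg 11))) <|
    .seq (.store (heapPos (.reg 11)) 7) <| .seq (.store (heapPos (.reg 12)) 5) <|
    .seq (.assign 11 (.reg 12)) (selectLargest lt)

/-- Add the element behind the heap to the heap; register 10 holds the size of the heap. -/
def heapPush (lt : Fin 16 → Fin 16 → Test 16) : Program 16 :=
  .seq (.assign 11 (.reg 10)) <| .seq (siftUp lt) (.assign 10 (.add (.reg 10) (.const 1)))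

def exchange (e f : WordExpr 16) : Program 16 :=
  .seq (.load 5 e) <| .seq (.load 6 f) <| .seq (.store e 6) (.store f 5)

/-- Move the maximum of the heap behind the remaining heap. -/
def heapPop (lt : Fin 16 → Fin 16 → Test 16) : Program 16 :=
  .seq (.assign 10 (.sub (.reg 10) (.const 1))) <|
  .seq (exchange (.reg 9) (heapPos (.reg 10))) <|
  .seq (.assign 11 (.const 0)) (siftDown lt)

/-- Heapsort of the whole array. -/
def heapSort (lt : Fin 16 → Fin 16 → Test 16) : Program 16 :=
  .seq (.assign 9 (.const 0)) <| .seq (.assign 10 (.const 0)) <|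
  .seq (.loop (wordLT (.reg 10) .len) (heapPush lt))
    (.loop (wordLT (.const 0) (.reg 10)) (heapPop lt))

variable {κ : Type*} {lt : Fin 16 → Fin 16 → Test 16} {key : Elem → κ} {E F : Elem}

/-- The test `lt` compares registers by `key` whenever registers 0 and 1 hold `E` and `F`. -/
def Compares [LinearOrder κ] (N : ℕ) (lt : Fin 16 → Fin 16 → Test 16) (key : Elem → κ)
    (E F : Elem) : Prop :=
  ∀ s : State N 16, s.elem 0 = E → s.elem 1 = F →
    ∀ r r', (lt r r').Holds s ↔ key (s.elem r) < key (s.elem r')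

theorem cell_mk (s : State N 16) (w : Fin 16 → ℕ) (e : Fin 16 → Elem)
    (o : Option (Color × Plane × Plane × Plane)) :
    cell { arr := s.arr, word := w, elem := e, out := o } = cell s := rfl

/-- Integer expressions read only the integer registers, so stores and loads do not change computed
positions. -/
theorem WordExpr_eval_congr {u v : State N 16} (h : u.word = v.word) (e : WordExpr 16) :
    e.eval u = e.eval v := by
  induction e <;> simp_all [WordExpr.eval]

/-- Two stores that exchange the elements at the positions `i` and `j`. -/
theorem runs_stores {e f : WordExpr 16} {r r' : Fin 16} {p : Program 16}
    {Q : ℕ → State N 16 → Prop} {i j : ℕ} (he : e.eval s = i) (hf : f.eval s = j) (hi : i < N)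
    (hj : j < N) (hr : s.elem r = cell s j) (hr' : s.elem r' = cell s i)
    (h : ∀ s', s'.word = s.word → s'.elem = s.elem → s'.out = s.out →
      cell s' = cell s ∘ Equiv.swap i j → Runs W p s' fun t u => Q (t + 2) u) :
    Runs W (.seq (.store e r) (.seq (.store f r') p)) s Q := by
  subst he hf
  refine runs_seq (runs_store hi ?_)
  have hf' : f.eval { s with arr := Function.update s.arr ⟨e.eval s, hi⟩ (s.elem r) } =
      f.eval s := WordExpr_eval_congr (by rfl) f
  refine runs_seq (runs_store (by rw [hf']; exact hj) ?_)
  refine (h _ ?_ ?_ ?_ ?_).mono fun t u hq => ?_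
  rotate_left 4
  · rwa [show 1 + (1 + t) = t + 2 by omega]
  · rfl
  · rfl
  · rfl
  · apply cell_exchange hi hj
    rw [← hr, ← hr']
    simp only [hf']

theorem swap_shift (f : ℕ → Elem) (key : Elem → κ) (base i j : ℕ) :
    (fun l => key ((f ∘ Equiv.swap (base + i) (base + j)) (base + l))) =
      (fun l => key (f (base + l))) ∘ Equiv.swap i j := by
  funext l
  simp only [Function.comp, Equiv.swap_apply_def]
  by_cases h1 : l = i
  · subst h1; simp
  · by_cases h2 : l = j
    · subst h2; simp [h1]
    · simp [h1, h2]

/-- `log₂ (p + 1)` is the level of position `p` in the tree; this is the potential for moving up. -/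
theorem log_parent {p : ℕ} (hp : 0 < p) :
    Nat.log 2 ((p - 1) / 2 + 1) + 1 = Nat.log 2 (p + 1) := by
  have h : (p - 1) / 2 + 1 = (p + 1) / 2 := by omega
  rw [h, Nat.log_div_base]
  have := Nat.log_pos (b := 2) (n := p + 1) one_lt_two (by omega)
  omega

/-- `log₂ (n / (p + 1))` bounds the number of levels below `p`; this is the potential for moving
down. -/
theorem log_child {n p c : ℕ} (hc : 2 * p + 1 ≤ c) (hcn : c < n) :
    Nat.log 2 (n / (c + 1)) + 1 ≤ Nat.log 2 (n / (p + 1)) := by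
  have h1 : n / (c + 1) ≤ n / (p + 1) / 2 := by
    rw [Nat.div_div_eq_div_mul]
    exact Nat.div_le_div_left (by omega) (by omega)
  have h2 : 2 ≤ n / (p + 1) := by
    rw [Nat.le_div_iff_mul_le (by omega)]; omega
  have h3 := Nat.log_mono_right (b := 2) h1
  rw [Nat.log_div_base] at h3
  have := Nat.log_pos (b := 2) (n := n / (p + 1)) one_lt_two h2
  omega

variable [LinearOrder κ]

/-- The invariant is `HeapUp` at the current position. Each round costs two stores, an assignment, a
load and a test, which gives the factor 5 per level. -/
theorem runs_siftUp (hlt : Compares N lt key E F) {base n : ℕ} (h0 : s.elem 0 = E)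
    (h1 : s.elem 1 = F) (hb : s.word 9 = base) (hpn : s.word 11 < n) (hN : base + n ≤ N)
    (hW : N ≤ W) (hup : HeapUp (fun i => key (cell s (base + i))) n (s.word 11)) :
    Runs W (siftUp lt) s fun t s' => Keeps [11] [5, 6, 7] s s' ∧
      PermOn base (base + n) (cell s) (cell s') ∧
      IsHeap (fun i => key (cell s' (base + i))) n ∧ t ≤ 3 + 5 * Nat.log 2 (s.word 11 + 1) := by
  refine runs_seq (runs_load (by simp [heapPos, WordExpr.eval]; omega) ?_)
  refine runs_seq (runs_load (by simp [heapPos, parentExpr, WordExpr.eval]; omega) ?_)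
  refine (runs_loop
    (I := fun s' => Keeps [11] [5, 6, 7] s s' ∧ PermOn base (base + n) (cell s) (cell s') ∧
      s'.word 11 < n ∧ s'.elem 5 = cell s' (base + s'.word 11) ∧
      s'.elem 6 = cell s' (base + (s'.word 11 - 1) / 2) ∧
      HeapUp (fun i => key (cell s' (base + i))) n (s'.word 11))
    (Φ := fun s' => 5 * Nat.log 2 (s'.word 11 + 1)) ?_ ?_).mono ?_
  · rintro u ⟨hk, hp, hn, h5, h6, hh⟩ hT
    have e9 : u.word 9 = base := by rw [hk.word 9 (by decide), hb]
    rw [hlt u (by rw [hk.elem 0 (by decide), h0]) (by rw [hk.elem 1 (by decide), h1]), h5, h6] at hT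
    have hpos : 0 < u.word 11 := by
      rcases Nat.eq_zero_or_pos (u.word 11) with hz | hz
      · simp [hz] at hT
      · exact hz
    have hlog := log_parent hpos
    have hstep := hh.step hn hT
    refine runs_stores (i := base + u.word 11) (j := base + (u.word 11 - 1) / 2)
      (by simp [heapPos, WordExpr.eval, e9]) (by simp [heapPos, parentExpr, WordExpr.eval, e9])
      (by omega) (by omega) h6 h5 fun v vw ve vo vc => ?_
    refine runs_seq (runs_assign (by simp [parentExpr, WordExpr.eval, vw]; omega) ?_)
    refine runs_load (by simp [heapPos, parentExpr, WordExpr.eval, vw]; omega) ?_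
    have e9' : v.word 9 = base := by rw [vw, e9]
    have lN : base + ((u.word 11 - 1) / 2 - 1) / 2 < N := by omega
    refine ⟨⟨⟨fun i hi => ?_, fun r hr => ?_, vo.trans hk.out⟩, ?_, ?_, ?_, ?_, ?_⟩, ?_⟩
    · have hi' := hi
      simp at hi
      simp [hi, vw, hk.word i hi']
    · have hr' := hr
      simp at hr
      simp [hr, ve, hk.elem r hr']
    · refine hp.trans ?_
      rw [cell_mk v, vc]
      exact PermOn.swap _ (by omega) (by omega)
    · simp [parentExpr, WordExpr.eval, vw]; omega
    · rw [cell_mk v, vc]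
      simp [ve, h5, parentExpr, WordExpr.eval, vw]
    · simp [cell, heapPos, parentExpr, WordExpr.eval, e9, vw, lN]
    · rw [cell_mk v, vc, swap_shift]
      simpa [parentExpr, WordExpr.eval, vw] using hstep
    · simp [parentExpr, WordExpr.eval, vw]; omega
  · refine ⟨⟨fun i hi => rfl, fun r hr => ?_, rfl⟩, PermOn.refl _ _ _, hpn, ?_, ?_, hup⟩
    · simp at hr
      simp [hr]
    · simp [heapPos, WordExpr.eval, cell, hb, show base + s.word 11 < N by omega]
    · simp [heapPos, parentExpr, WordExpr.eval, cell, hb,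
        show base + (s.word 11 - 1) / 2 < N by omega]
  · rintro t u ⟨⟨hk, hp, hn, h5, h6, hh⟩, hT, ht⟩
    rw [hlt u (by rw [hk.elem 0 (by decide), h0]) (by rw [hk.elem 1 (by decide), h1]), h5, h6] at hT
    exact ⟨hk, hp, hh.isHeap hT, by simp at ht; omega⟩

theorem runs_tryChild (hlt : Compares N lt key E F) {base : ℕ} (d : ℕ) (h0 : s.elem 0 = E)
    (h1 : s.elem 1 = F) (hb : s.word 9 = base) (hN : base + s.word 10 ≤ N) (hW : N ≤ W) :
    Runs W (tryChild lt d) s fun t s' => Keeps [12] [6, 7] s s' ∧ s'.arr = s.arr ∧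
      ((s'.word 12 = s.word 12 ∧ s'.elem 7 = s.elem 7) ∨
        (2 * s.word 11 + d < s.word 10 ∧ s'.word 12 = 2 * s.word 11 + d ∧
          s'.elem 7 = cell s (base + (2 * s.word 11 + d)) ∧ key (s.elem 7) < key (s'.elem 7))) ∧
      (2 * s.word 11 + d < s.word 10 →
        key (cell s (base + (2 * s.word 11 + d))) ≤ key (s'.elem 7)) ∧ t ≤ 5 := by
  refine runs_branch (fun hT => ?_) (fun hT => runs_skip ?_)
  · simp only [wordLT, Test.Holds, childExpr, WordExpr.eval, not_le] at hT
    have hlN : base + (2 * s.word 11 + d) < N := by omega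
    refine runs_seq (runs_load (by simp [heapPos, childExpr, WordExpr.eval]; omega) ?_)
    have hc : cell s (base + (2 * s.word 11 + d)) = s.arr ⟨base + (2 * s.word 11 + d), hlN⟩ :=
      cell_of_lt s hlN
    refine runs_branch (fun hL => ?_) (fun hL => runs_skip ?_)
    · refine runs_seq (runs_assign (by simp [childExpr, WordExpr.eval]; omega) (runs_copy ?_))
      rw [hlt _ (by simp [h0]) (by simp [h1])] at hL
      simp [heapPos, childExpr, WordExpr.eval, hb] at hL
      refine ⟨⟨fun i hi => ?_, fun r hr => ?_, rfl⟩, rfl, Or.inr ⟨hT, ?_, ?_, ?_⟩, fun _ => ?_, ?_⟩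
      · simp at hi; simp [hi]
      · simp at hr; simp [hr]
      · simp [childExpr, WordExpr.eval]
      · simp [heapPos, childExpr, WordExpr.eval, hb, hc]
      · simpa [heapPos, childExpr, WordExpr.eval, hb] using hL
      · simp [heapPos, childExpr, WordExpr.eval, hb, hc]
      · simp
    · rw [hlt _ (by simp [h0]) (by simp [h1])] at hL
      simp [heapPos, childExpr, WordExpr.eval, hb] at hL
      refine ⟨⟨fun i hi => rfl, fun r hr => ?_, rfl⟩, rfl, Or.inl ⟨rfl, by simp⟩, fun _ => ?_, ?_⟩
      · simp at hr; simp [hr]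
      · simpa [hc] using hL
      · simp
  · simp only [wordLT, Test.Holds, childExpr, WordExpr.eval] at hT
    exact ⟨Keeps.refl _ _ _, rfl, Or.inl ⟨rfl, rfl⟩, fun h => absurd h (by omega), by simp⟩

theorem runs_selectLargest (hlt : Compares N lt key E F) {base : ℕ} (h0 : s.elem 0 = E)
    (h1 : s.elem 1 = F) (hb : s.word 9 = base) (hpn : s.word 11 < N)
    (hN : base + s.word 10 ≤ N) (hW : N ≤ W) (h5 : s.elem 5 = cell s (base + s.word 11)) :
    Runs W (selectLargest lt) s fun t s' => Keeps [12] [6, 7] s s' ∧ s'.arr = s.arr ∧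
      (s'.word 12 = s.word 11 ∨
        (s'.word 12 = 2 * s.word 11 + 1 ∨ s'.word 12 = 2 * s.word 11 + 2) ∧
          s'.word 12 < s.word 10 ∧ key (cell s (base + s.word 11)) < key (s'.elem 7)) ∧
      s'.elem 7 = cell s (base + s'.word 12) ∧
      (2 * s.word 11 + 1 < s.word 10 →
        key (cell s (base + (2 * s.word 11 + 1))) ≤ key (s'.elem 7)) ∧
      (2 * s.word 11 + 2 < s.word 10 →
        key (cell s (base + (2 * s.word 11 + 2))) ≤ key (s'.elem 7)) ∧ t ≤ 12 := by
  refine runs_seq (runs_assign (by simp [WordExpr.eval]; omega) ?_)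
  refine runs_seq (runs_copy ?_)
  set s1 : State N 16 := { s with
    word := Function.update s.word 12 ((WordExpr.reg 11).eval s),
    elem := Function.update s.elem 7 (s.elem 5) } with hs1
  have k1 : Keeps [12] [6, 7] s s1 := by
    refine ⟨fun i hi => ?_, fun r hr => ?_, rfl⟩
    · simp at hi; simp [hs1, hi]
    · simp at hr; simp [hs1, hr]
  have a1 : s1.arr = s.arr := rfl
  have w12 : s1.word 12 = s.word 11 := by simp [hs1, WordExpr.eval]
  have e7 : s1.elem 7 = cell s (base + s.word 11) := by simp [hs1, h5]
  clear_value s1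
  have hw : ∀ u : State N 16, Keeps [12] [6, 7] s u → u.elem 0 = E ∧ u.elem 1 = F ∧
      u.word 9 = base ∧ u.word 10 = s.word 10 ∧ u.word 11 = s.word 11 := fun u hu =>
    ⟨by rw [hu.elem 0 (by decide), h0], by rw [hu.elem 1 (by decide), h1],
      by rw [hu.word 9 (by decide), hb], hu.word 10 (by decide), hu.word 11 (by decide)⟩
  obtain ⟨b0, b1, b9, b10, b11⟩ := hw s1 k1
  refine runs_seq ((runs_tryChild hlt 1 b0 b1 b9 (by omega) hW).mono ?_)
  rintro t s2 ⟨k2', a2, hor, hle, ht⟩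
  have k2 := k1.trans k2'
  rw [a1] at a2
  obtain ⟨c0, c1, c9, c10, c11⟩ := hw s2 k2
  refine (runs_tryChild hlt 2 c0 c1 c9 (by omega) hW).mono ?_
  rintro t' s3 ⟨k3', a3, hor', hle', ht'⟩
  rw [a2] at a3
  rw [b10, b11, cell_congr a1, w12, e7] at hor
  rw [b10, b11, cell_congr a1] at hle
  rw [c10, c11, cell_congr a2] at hor' hle'
  refine ⟨k2.trans k3', a3, ?_, ?_, ?_, hle', by omega⟩
  · rcases hor with ⟨p1, p2⟩ | ⟨p1, p2, p3, p4⟩ <;>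
      rcases hor' with ⟨q1, q2⟩ | ⟨q1, q2, q3, q4⟩
    · left; rw [q1, p1]
    · right; rw [p2] at q4; exact ⟨Or.inr q2, by omega, q4⟩
    · right; rw [q1, q2]; exact ⟨Or.inl p2, by omega, p4⟩
    · right; exact ⟨Or.inr q2, by omega, p4.trans q4⟩
  · rcases hor with ⟨p1, p2⟩ | ⟨p1, p2, p3, p4⟩ <;>
      rcases hor' with ⟨q1, q2⟩ | ⟨q1, q2, q3, q4⟩
    · rw [q2, p2, q1, p1]
    · rw [q3, q2]
    · rw [q2, p3, q1, p2]
    · rw [q3, q2]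
  · intro h
    refine (hle h).trans ?_
    rcases hor' with ⟨q1, q2⟩ | ⟨q1, q2, q3, q4⟩
    · rw [q2]
    · exact q4.le

/-- The invariant is `HeapDown` at the current position. A round costs at most 12 steps for the
selection, two stores, an assignment and a test, which gives the factor 16 per level. -/
theorem runs_siftDown (hlt : Compares N lt key E F) {base : ℕ} (h0 : s.elem 0 = E)
    (h1 : s.elem 1 = F) (hb : s.word 9 = base) (hp0 : s.word 11 = 0) (hlN : base < N)
    (hN : base + s.word 10 ≤ N)
    (hW : N ≤ W) (hdn : HeapDown (fun i => key (cell s (base + i))) (s.word 10) 0) :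
    Runs W (siftDown lt) s fun t s' => Keeps [11, 12] [5, 6, 7] s s' ∧
      PermOn base (base + s.word 10) (cell s) (cell s') ∧
      IsHeap (fun i => key (cell s' (base + i))) (s.word 10) ∧
      t ≤ 14 + 16 * Nat.log 2 (s.word 10) := by
  refine runs_seq (runs_load (by simp [heapPos, WordExpr.eval]; omega) ?_)
  set s1 : State N 16 := { s with elem := Function.update s.elem 5 _ } with hs1
  have k1 : Keeps [11, 12] [5, 6, 7] s s1 := by
    refine ⟨fun i hi => rfl, fun r hr => ?_, rfl⟩
    simp at hr; simp [hs1, hr]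
  have a1 : s1.arr = s.arr := rfl
  have e5 : s1.elem 5 = cell s1 (base + s1.word 11) := by
    simp [hs1, heapPos, WordExpr.eval, cell, hb, hp0, hlN]
  have w11 : s1.word 11 = 0 := hp0
  clear_value s1
  have hw : ∀ u : State N 16, Keeps [11, 12] [5, 6, 7] s u → u.elem 0 = E ∧ u.elem 1 = F ∧
      u.word 9 = base ∧ u.word 10 = s.word 10 := fun u hu =>
    ⟨by rw [hu.elem 0 (by decide), h0], by rw [hu.elem 1 (by decide), h1],
      by rw [hu.word 9 (by decide), hb], hu.word 10 (by decide)⟩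
  -- The outcome of `selectLargest` for the array of `u`. Stating it for two states allows it to be
  -- proved against the old state and carried as an invariant of the new one.
  let J : State N 16 → State N 16 → Prop := fun u v =>
    (v.word 12 = u.word 11 ∨
        (v.word 12 = 2 * u.word 11 + 1 ∨ v.word 12 = 2 * u.word 11 + 2) ∧
          v.word 12 < s.word 10 ∧ key (cell u (base + u.word 11)) < key (v.elem 7)) ∧
      v.elem 7 = cell u (base + v.word 12) ∧
      (2 * u.word 11 + 1 < s.word 10 →
        key (cell u (base + (2 * u.word 11 + 1))) ≤ key (v.elem 7)) ∧
      (2 * u.word 11 + 2 < s.word 10 →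
        key (cell u (base + (2 * u.word 11 + 2))) ≤ key (v.elem 7))
  have hsel : ∀ u : State N 16, Keeps [11, 12] [5, 6, 7] s u → base + u.word 11 < N →
      u.elem 5 = cell u (base + u.word 11) → Runs W (selectLargest lt) u fun t v =>
        Keeps [11, 12] [5, 6, 7] s v ∧ v.arr = u.arr ∧ v.word 11 = u.word 11 ∧
          v.elem 5 = u.elem 5 ∧ J v v ∧ t ≤ 12 := by
    intro u ku hu11 hu5
    obtain ⟨c0, c1, c9, c10⟩ := hw u ku
    refine (runs_selectLargest hlt c0 c1 c9 (by omega) (by omega) hW hu5).mono ?_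
    rintro t v ⟨kv, av, j1, j2, j3, j4, ht⟩
    have v11 := kv.word 11 (by decide)
    refine ⟨ku.trans (kv.mono (by decide) (by decide)), av, v11, kv.elem 5 (by decide), ?_, ht⟩
    simp only [J]
    rw [v11, cell_congr av]
    rw [c10] at j1 j3 j4
    exact ⟨j1, j2, j3, j4⟩
  refine runs_seq ((hsel s1 k1 (by omega) e5).mono ?_)
  rintro t1 s2 ⟨k2, a2, w2, e2, j2, ht1⟩
  refine (runs_loop
    (I := fun u => Keeps [11, 12] [5, 6, 7] s u ∧
      PermOn base (base + s.word 10) (cell s) (cell u) ∧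
      base + u.word 11 < N ∧ u.elem 5 = cell u (base + u.word 11) ∧ J u u ∧
      HeapDown (fun i => key (cell u (base + i))) (s.word 10) (u.word 11))
    (Φ := fun u => 16 * Nat.log 2 (s.word 10 / (u.word 11 + 1))) ?_ ?_).mono ?_
  · rintro u ⟨ku, pu, hu11, hu5, ju, hh⟩ hT
    obtain ⟨c0, c1, c9, c10⟩ := hw u ku
    simp only [Test.Holds, WordExpr.eval, not_le] at hT
    obtain ⟨j1, j2, j3, j4⟩ := ju
    rcases j1 with j1 | ⟨j1, j1n, j1k⟩
    · omega
    have hlog := log_child (p := u.word 11) (c := u.word 12) (n := s.word 10) (by omega) j1n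
    rw [j2] at j1k j3 j4
    have hstep := hh.step j1 j1n j1k j3 j4
    refine runs_stores (i := base + u.word 11) (j := base + u.word 12)
      (by simp [heapPos, WordExpr.eval, c9]) (by simp [heapPos, WordExpr.eval, c9])
      (by omega) (by omega) j2 hu5 fun v' vw ve vo vc => ?_
    refine runs_seq (runs_assign (by simp [WordExpr.eval, vw]; omega) ?_)
    set v : State N 16 := { v' with word := Function.update v'.word 11 _ } with hv
    have cv : cell v = cell u ∘ Equiv.swap (base + u.word 11) (base + u.word 12) := by
      rw [← vc]; exact cell_congr rfl
    have kv : Keeps [11, 12] [5, 6, 7] s v := by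
      refine ⟨fun i hi => ?_, fun r hr => by rw [hv]; simp only; rw [ve, ku.elem r hr],
        vo.trans ku.out⟩
      have hi' := hi
      simp at hi; simp [hv, hi, vw, ku.word i hi']
    have v11 : v.word 11 = u.word 12 := by simp [hv, vw, WordExpr.eval]
    have v5 : v.elem 5 = u.elem 5 := by rw [← ve]
    clear_value v
    have hv5 : v.elem 5 = cell v (base + v.word 11) := by
      rw [v5, hu5, cv, v11]; simp
    refine (hsel v kv (by omega) hv5).mono ?_
    rintro t x ⟨kx, ax, x11, x5, jx, ht⟩
    have cx := cell_congr ax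
    refine ⟨⟨kx, ?_, by omega, ?_, jx, ?_⟩, ?_⟩
    · rw [cx, cv]
      exact pu.trans (PermOn.swap _ (by omega) (by omega))
    · rw [x5, hv5, cx, x11]
    · rw [cx, cv, x11, v11, swap_shift]; exact hstep
    · simp only [x11, v11]; omega
  · refine ⟨k2, ?_, by omega, ?_, j2, ?_⟩
    · rw [cell_congr a2, cell_congr a1]; exact PermOn.refl _ _ _
    · rw [e2, e5, cell_congr a2, w2]
    · rw [cell_congr a2, cell_congr a1, w2, w11]; exact hdn
  · rintro t u ⟨⟨ku, pu, hu11, hu5, ⟨j1, j2, j3, j4⟩, hh⟩, hT, ht⟩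
    simp only [Test.Holds, WordExpr.eval, not_not] at hT
    have j12 : u.word 12 = u.word 11 := by omega
    rw [j2, j12] at j3 j4
    refine ⟨ku, pu, hh.isHeap j3 j4, ?_⟩
    simp only [w2, w11, zero_add, Nat.div_one] at ht ⊢
    omega

theorem runs_exchange {i j : ℕ} {e f : WordExpr 16} (he : e.eval s = i) (hf : f.eval s = j)
    (hi : i < N) (hj : j < N) :
    Runs W (exchange e f) s fun t s' => t = 4 ∧ Keeps [] [5, 6] s s' ∧
      cell s' = cell s ∘ Equiv.swap i j := by
  have ef : ∀ (x : Fin 16 → Elem) (g : WordExpr 16),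
      g.eval { s with elem := x } = g.eval s := fun x g => WordExpr_eval_congr (by rfl) g
  refine runs_seq (runs_load (by rw [he]; exact hi) ?_)
  refine runs_seq (runs_load (by rw [ef, hf]; exact hj) ?_)
  have h1 : ∀ h, s.arr ⟨e.eval s, h⟩ = cell s i := fun h => by subst he; rw [cell_of_lt s hi]
  have h2 : ∀ x h, s.arr ⟨f.eval { s with elem := x }, h⟩ = cell s j := fun x h => by
    subst hf; rw [cell_of_lt s hj]; simp only [ef]
  simp only [h1, h2]
  set v : State N 16 := { s with elem := _ } with hv
  have v5 : v.elem 5 = cell v i := by simp [hv, cell_mk]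
  have v6 : v.elem 6 = cell v j := by simp [hv, cell_mk]
  have cv : cell v = cell s := rfl
  have kv : Keeps [] [5, 6] s v := ⟨fun i hi => rfl, fun r hr => by simp at hr; simp [hv, hr], rfl⟩
  have ev : e.eval v = i := by rw [← he]; exact WordExpr_eval_congr (by rfl) e
  have fv : f.eval v = j := by rw [← hf]; exact WordExpr_eval_congr (by rfl) f
  clear_value v
  subst ev fv
  refine runs_seq (runs_store hi (runs_store ?_ ?_))
  · rwa [WordExpr_eval_congr (v := v) (by rfl) f]
  · have ff : ∀ x, f.eval { v with arr := x } = f.eval v := fun x => WordExpr_eval_congr (by rfl) f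
    refine ⟨rfl, ⟨kv.word, kv.elem, kv.out⟩, ?_⟩
    rw [← cv]
    apply cell_exchange hi hj
    rw [← v5, ← v6]
    simp only [ff]

theorem runs_heapPush (hlt : Compares N lt key E F) {base n : ℕ} (h0 : s.elem 0 = E)
    (h1 : s.elem 1 = F) (hb : s.word 9 = base) (hn : s.word 10 = n) (hN : base + n < N)
    (hW : N ≤ W) (hh : IsHeap (fun i => key (cell s (base + i))) n) :
    Runs W (heapPush lt) s fun t s' => Keeps [10, 11] [5, 6, 7] s s' ∧ s'.word 10 = n + 1 ∧
      PermOn base (base + (n + 1)) (cell s) (cell s') ∧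
      IsHeap (fun i => key (cell s' (base + i))) (n + 1) ∧ t ≤ 10 * (Nat.log 2 N + 1) := by
  refine runs_seq (runs_assign (by simp [WordExpr.eval]; omega) ?_)
  set v : State N 16 := { s with word := _ } with hv
  have v11 : v.word 11 = n := by simp [hv, WordExpr.eval, hn]
  have cv : cell v = cell s := rfl
  have kv : Keeps [10, 11] [5, 6, 7] s v :=
    ⟨fun i hi => by simp at hi; simp [hv, hi], fun r hr => rfl, rfl⟩
  have v10 : v.word 10 = n := by simp [hv, hn]
  clear_value v
  refine runs_seq ((runs_siftUp hlt (n := n + 1) (base := base) (s := v)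
    (by rw [kv.elem 0 (by decide), h0]) (by rw [kv.elem 1 (by decide), h1])
    (by rw [kv.word 9 (by decide), hb]) (by omega) (by omega) hW
    (by rw [cv, v11]; exact hh.heapUp)).mono ?_)
  rintro t u ⟨ku, pu, hu, ht⟩
  have u10 : u.word 10 = n := by rw [ku.word 10 (by decide), v10]
  refine runs_assign (by simp [WordExpr.eval]; omega) ⟨?_, ?_, ?_, hu, ?_⟩
  · have k := kv.trans (ku.mono (by decide) (by decide))
    exact ⟨fun i hi => by rw [← k.word i hi]; simp at hi; simp [hi], k.elem, k.out⟩
  · simp [WordExpr.eval, u10]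
  · rw [← cv]; exact pu
  · have := Nat.log_mono_right (b := 2) (show n + 1 ≤ N by omega)
    rw [v11] at ht
    omega

theorem runs_heapPop (hlt : Compares N lt key E F) {base n : ℕ} (h0 : s.elem 0 = E)
    (h1 : s.elem 1 = F) (hb : s.word 9 = base) (hn : s.word 10 = n) (hn0 : 0 < n)
    (hN : base + n ≤ N) (hW : N ≤ W) (hh : IsHeap (fun i => key (cell s (base + i))) n) :
    Runs W (heapPop lt) s fun t s' => Keeps [10, 11, 12] [5, 6, 7] s s' ∧ s'.word 10 = n - 1 ∧
      PermOn base (base + n) (cell s) (cell s') ∧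
      IsHeap (fun i => key (cell s' (base + i))) (n - 1) ∧
      cell s' (base + (n - 1)) = cell s base ∧ t ≤ 20 * (Nat.log 2 N + 1) := by
  refine runs_seq (runs_assign (by simp [WordExpr.eval]; omega) ?_)
  set v : State N 16 := { s with word := _ } with hv
  have v10 : v.word 10 = n - 1 := by simp [hv, WordExpr.eval, hn]
  have cv : cell v = cell s := rfl
  have kv : Keeps [10, 11, 12] [5, 6, 7] s v :=
    ⟨fun i hi => by simp at hi; simp [hv, hi], fun r hr => rfl, rfl⟩
  have v9 : v.word 9 = base := by rw [kv.word 9 (by decide), hb]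
  clear_value v
  refine runs_seq ((runs_exchange (i := base) (j := base + (n - 1))
    (by simpa [WordExpr.eval] using v9)
    (by simp [heapPos, WordExpr.eval, v9, v10]) (by omega) (by omega)).mono ?_)
  rintro t u ⟨ht, ku', cu⟩
  have ku := kv.trans (ku'.mono (by decide) (by decide))
  have u10 : u.word 10 = n - 1 := by rw [ku'.word 10 (by decide), v10]
  rw [cv] at cu
  clear ku'
  refine runs_seq (runs_assign (by simp [WordExpr.eval]) ?_)
  set x : State N 16 := { u with word := _ } with hx
  have x11 : x.word 11 = 0 := by simp [hx, WordExpr.eval]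
  have cx : cell x = cell u := rfl
  have kx : Keeps [10, 11, 12] [5, 6, 7] s x :=
    ⟨fun i hi => by rw [← ku.word i hi]; simp at hi; simp [hx, hi], ku.elem, ku.out⟩
  have x10 : x.word 10 = n - 1 := by simp [hx, u10]
  clear_value x
  rw [cu] at cx
  refine (runs_siftDown hlt (s := x) (base := base)
    (by rw [kx.elem 0 (by decide), h0]) (by rw [kx.elem 1 (by decide), h1])
    (by rw [kx.word 9 (by decide), hb]) x11 (by omega) (by omega) hW ?_).mono ?_
  · rw [x10, cx]
    refine hh.heapDown fun i hi hi' => ?_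
    simp only [Function.comp]
    rw [Equiv.swap_apply_of_ne_of_ne (by omega) (by omega)]
  · rintro t' y ⟨ky, py, hy, ht'⟩
    rw [x10] at py hy ht'
    refine ⟨kx.trans (ky.mono (by decide) (by decide)), ?_, ?_, hy, ?_, ?_⟩
    · rw [ky.word 10 (by decide), x10]
    · refine PermOn.trans ?_ (py.mono le_rfl (by omega))
      rw [cx]
      exact PermOn.swap _ (by omega) (by omega)
    · rw [py.eq_outside (by omega), cx]; simp
    · have := Nat.log_mono_right (b := 2) (show n - 1 ≤ N by omega)
      omega

/-- The first loop pushes all elements; the second pops the maximum to the end of the shrinking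
heap. -/
theorem runs_heapSort (hlt : Compares N lt key E F) (h0 : s.elem 0 = E)
    (h1 : s.elem 1 = F) (hN : 0 < N) (hW : N ≤ W) :
    Runs W (heapSort lt) s fun t s' => Keeps [9, 10, 11, 12] [5, 6, 7] s s' ∧
      PermOn 0 N (cell s) (cell s') ∧
      (∀ i j, i < j → j < N → key (cell s' i) ≤ key (cell s' j)) ∧
      t ≤ 40 * (N * (Nat.log 2 N + 1)) := by
  set L := Nat.log 2 N + 1 with hL
  refine runs_seq (runs_assign (by simp [WordExpr.eval]) ?_)
  refine runs_seq (runs_assign (by simp [WordExpr.eval]) ?_)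
  set v : State N 16 := { s with word := _ } with hv
  have v9 : v.word 9 = 0 := by simp [hv, WordExpr.eval]
  have v10 : v.word 10 = 0 := by simp [hv, WordExpr.eval]
  have cv : cell v = cell s := rfl
  have kv : Keeps [9, 10, 11, 12] [5, 6, 7] s v :=
    ⟨fun i hi => by simp at hi; simp [hv, hi], fun r hr => rfl, rfl⟩
  clear_value v
  refine runs_seq ((runs_loop
    (I := fun u => Keeps [9, 10, 11, 12] [5, 6, 7] s u ∧ u.word 9 = 0 ∧ u.word 10 ≤ N ∧
      PermOn 0 N (cell s) (cell u) ∧ IsHeap (fun i => key (cell u i)) (u.word 10))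
    (Φ := fun u => (N - u.word 10) * (10 * L + 1)) ?_ ?_).mono ?_)
  · rintro u ⟨ku, u9, u10, pu, hu⟩ hT
    simp only [wordLT, Test.Holds, WordExpr.eval, not_le] at hT
    refine (runs_heapPush hlt (base := 0) (n := u.word 10) (by rw [ku.elem 0 (by decide), h0])
      (by rw [ku.elem 1 (by decide), h1]) u9 rfl (by omega) hW (by simpa using hu)).mono ?_
    rintro t x ⟨kx, x10, px, hx, ht⟩
    refine ⟨⟨ku.trans (kx.mono (by decide) (by decide)), by rw [kx.word 9 (by decide), u9],
      by omega, pu.trans (px.mono le_rfl (by omega)), ?_⟩, ?_⟩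
    · rw [x10]; simpa using hx
    · have e : N - u.word 10 = (N - (u.word 10 + 1)) + 1 := by omega
      rw [x10, e, add_mul]; omega
  · refine ⟨kv, v9, by omega, by rw [cv]; exact PermOn.refl _ _ _, ?_⟩
    rw [v10]; intro i h0 h1; omega
  · rintro t u ⟨⟨ku, u9, u10, pu, hu⟩, hT, ht⟩
    simp only [wordLT, Test.Holds, WordExpr.eval, not_not] at hT
    rw [v10] at ht
    refine (runs_loop
      (I := fun u => Keeps [9, 10, 11, 12] [5, 6, 7] s u ∧ u.word 9 = 0 ∧ u.word 10 ≤ N ∧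
        PermOn 0 N (cell s) (cell u) ∧ IsHeap (fun i => key (cell u i)) (u.word 10) ∧
        -- Each element behind the heap dominates everything before it, heap included; for an empty
        -- heap this is sortedness.
        ∀ i j, i < j → u.word 10 ≤ j → j < N → key (cell u i) ≤ key (cell u j))
      (Φ := fun u => u.word 10 * (20 * L + 1)) ?_
      ⟨ku, u9, u10, pu, hu, fun i j _ h h' => by omega⟩).mono ?_
    · rintro u ⟨ku, u9, u10, pu, hu, su⟩ hT
      simp only [wordLT, Test.Holds, WordExpr.eval, not_le] at hT
      refine (runs_heapPop hlt (base := 0) (n := u.word 10) (by rw [ku.elem 0 (by decide), h0])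
        (by rw [ku.elem 1 (by decide), h1]) u9 rfl hT (by omega) hW (by simpa using hu)).mono ?_
      rintro t x ⟨kx, x10, px, hx, xl, ht⟩
      simp only [zero_add] at px hx xl
      refine ⟨⟨ku.trans (kx.mono (by decide) (by decide)), by rw [kx.word 9 (by decide), u9],
        by omega, pu.trans (px.mono le_rfl (by omega)), by rw [x10]; exact hx, ?_⟩, ?_⟩
      · intro i j hij hj hjN
        have hi : ∃ i', (i < u.word 10 → i' < u.word 10) ∧ (u.word 10 ≤ i → i' = i) ∧
            cell x i = cell u i' := by
          by_cases hi : i < u.word 10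
          · obtain ⟨i', hi', e⟩ := px.exists_eq ⟨Nat.zero_le _, hi⟩
            exact ⟨i', fun _ => hi'.2, fun h => by omega, e⟩
          · exact ⟨i, fun h => absurd h hi, fun _ => rfl, px.eq_outside (by omega)⟩
        obtain ⟨i', hi1, hi2, e⟩ := hi
        rw [e]
        by_cases hj' : u.word 10 ≤ j
        · rw [px.eq_outside (i := j) (by omega)]
          refine su i' j ?_ hj' hjN
          by_cases hi : i < u.word 10
          · have := hi1 hi; omega
          · have := hi2 (by omega); omega
        · rw [show j = u.word 10 - 1 by omega, xl]
          exact hu.le_root (hi1 (by omega))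
      · have e : u.word 10 = (u.word 10 - 1) + 1 := by omega
        rw [x10]
        conv_rhs => rw [e, add_mul]
        omega
    · rintro t' x ⟨⟨kx, x9, x10, px, hx, sx⟩, hT, ht'⟩
      simp only [wordLT, Test.Holds, WordExpr.eval, not_not] at hT
      refine ⟨kx, px, fun i j hij hj => sx i j hij (by omega) hj, ?_⟩
      have a1 : u.word 10 * (20 * L + 1) ≤ N * (20 * L + 1) := Nat.mul_le_mul_right _ u10
      have a2 : (N - 0) * (10 * L + 1) = 10 * (N * L) + N := by rw [Nat.sub_zero]; ring
      have a3 : N * (20 * L + 1) = 20 * (N * L) + N := by ring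
      have a4 : N ≤ N * L := Nat.le_mul_of_pos_right _ (by omega)
      omega

end HeapPrograms

/-! ### Rectangles in coordinates -/

section Rectangles

theorem inner_eq (x y : Plane) : inner ℝ x y = x 0 * y 0 + x 1 * y 1 := by
  simp [PiLp.inner_apply, Fin.sum_univ_two, mul_comm]

theorem normSq_pos {v : Plane} (hv : v ≠ 0) : 0 < v 0 * v 0 + v 1 * v 1 := by
  rw [← inner_eq]; exact real_inner_self_pos.mpr hv

/-- In the plane the orthogonal complement of a nonzero vector is spanned by its quarter turn. This
replaces all reasoning about angles. -/
theorem exists_perpendicular {a b x y : ℝ} (hab : 0 < a * a + b * b) (h : a * x + b * y = 0) :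
    ∃ l : ℝ, x = -l * b ∧ y = l * a := by
  have hne : a ^ 2 + b ^ 2 ≠ 0 := by nlinarith
  refine ⟨(a * y - b * x) / (a ^ 2 + b ^ 2), ?_, ?_⟩
  · field_simp; linear_combination a * h
  · field_simp; linear_combination b * h

variable {c v w x : Plane}

theorem mem_spanned_iff (hv : v ≠ 0) (hw : w ≠ 0) (h : inner ℝ v w = 0) :
    x ∈ spanned c v w ↔ (0 ≤ inner ℝ (x - c) v ∧ inner ℝ (x - c) v ≤ inner ℝ v v) ∧
      0 ≤ inner ℝ (x - c) w ∧ inner ℝ (x - c) w ≤ inner ℝ w w := by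
  have hvp := normSq_pos hv
  have hwp := normSq_pos hw
  simp only [inner_eq] at h ⊢
  constructor
  · rintro ⟨s, ⟨hs0, hs1⟩, t, ⟨ht0, ht1⟩, rfl⟩
    simp only [PiLp.sub_apply, PiLp.add_apply, PiLp.smul_apply, smul_eq_mul]
    have e1 : (c 0 + s * v 0 + t * w 0 - c 0) * v 0 + (c 1 + s * v 1 + t * w 1 - c 1) * v 1 =
        s * (v 0 * v 0 + v 1 * v 1) := by linear_combination t * h
    have e2 : (c 0 + s * v 0 + t * w 0 - c 0) * w 0 + (c 1 + s * v 1 + t * w 1 - c 1) * w 1 =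
        t * (w 0 * w 0 + w 1 * w 1) := by linear_combination s * h
    rw [e1, e2]
    refine ⟨⟨by positivity, ?_⟩, by positivity, ?_⟩ <;> nlinarith
  · simp only [PiLp.sub_apply]
    rintro ⟨⟨h1, h2⟩, h3, h4⟩
    refine ⟨((x 0 - c 0) * v 0 + (x 1 - c 1) * v 1) / (v 0 * v 0 + v 1 * v 1),
      ⟨by positivity, (div_le_one hvp).mpr h2⟩,
      ((x 0 - c 0) * w 0 + (x 1 - c 1) * w 1) / (w 0 * w 0 + w 1 * w 1),
      ⟨by positivity, (div_le_one hwp).mpr h4⟩, ?_⟩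
    have hvn : v 0 ^ 2 + v 1 ^ 2 ≠ 0 := by nlinarith
    obtain ⟨μ, hμ0, hμ1⟩ := exists_perpendicular hvp h
    have hμ : μ ≠ 0 := by
      rintro rfl
      simp [hμ0, hμ1] at hwp
    rw [hμ0, hμ1] at hwp
    have e : -μ * v 1 * (-μ * v 1) + μ * v 0 * (μ * v 0) =
      μ ^ 2 * (v 0 * v 0 + v 1 * v 1) := by ring
    ext i
    fin_cases i
    · simp [hμ0, hμ1, -neg_mul, e]
      field_simp
      ring
    · simp [hμ0, hμ1, -neg_mul, e]
      field_simp
      ring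

/-- An interior point can be moved a little by positive and negative multiples of `v` and of `w`
without leaving the rectangle, which makes the four inequalities strict; conversely the strict
inequalities define an open subset. -/
theorem mem_interior_spanned_iff (hv : v ≠ 0) (hw : w ≠ 0) (h : inner ℝ v w = 0) :
    x ∈ interior (spanned c v w) ↔ (0 < inner ℝ (x - c) v ∧ inner ℝ (x - c) v < inner ℝ v v) ∧
      0 < inner ℝ (x - c) w ∧ inner ℝ (x - c) w < inner ℝ w w := by
  constructor
  · intro hx
    have hn : spanned c v w ∈ nhds x := mem_interior_iff_mem_nhds.mp hx
    have key : ∀ u : Plane, ∃ ε : ℝ, 0 < ε ∧ x + ε • u ∈ spanned c v w ∧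
        x - ε • u ∈ spanned c v w := by
      intro u
      have h1 : Filter.Tendsto (fun t : ℝ => x + t • u) (nhds 0) (nhds x) := by
        have : Continuous fun t : ℝ => x + t • u := by fun_prop
        simpa using this.tendsto 0
      obtain ⟨ε, hε, hb⟩ := Metric.eventually_nhds_iff.mp (h1.eventually hn)
      refine ⟨ε / 2, by positivity, hb ?_, ?_⟩
      · simp [abs_of_pos hε]
        linarith
      · have := hb (y := -(ε / 2)) (by
          simp only [dist_zero_right, Real.norm_eq_abs, abs_neg]
          rw [abs_of_pos (by positivity)]
          linarith)
        rwa [neg_smul, ← sub_eq_add_neg] at this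
    have hvv : 0 < inner ℝ v v := real_inner_self_pos.mpr hv
    have hww : 0 < inner ℝ w w := real_inner_self_pos.mpr hw
    obtain ⟨ε, hε, p1, p2⟩ := key v
    obtain ⟨δ, hδ, q1, q2⟩ := key w
    rw [mem_spanned_iff hv hw h] at p1 p2 q1 q2
    have ev : ∀ (r : ℝ) (u : Plane),
        inner ℝ (x + r • u - c) u = inner ℝ (x - c) u + r * inner ℝ u u := by
      intro r u
      rw [show x + r • u - c = (x - c) + r • u by abel, inner_add_left, real_inner_smul_left]
    have ev' : ∀ (r : ℝ) (u : Plane),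
        inner ℝ (x - r • u - c) u = inner ℝ (x - c) u - r * inner ℝ u u := by
      intro r u
      rw [show x - r • u - c = (x - c) - r • u by abel, inner_sub_left, real_inner_smul_left]
    have a1 := p1.1.2
    have a2 := p2.1.1
    have a3 := q1.2.2
    have a4 := q2.2.1
    rw [ev] at a1 a3
    rw [ev'] at a2 a4
    have := mul_pos hε hvv
    have := mul_pos hδ hww
    exact ⟨⟨by linarith, by linarith⟩, by linarith, by linarith⟩
  · intro hx
    have ho : IsOpen {y : Plane | (0 < inner ℝ (y - c) v ∧ inner ℝ (y - c) v < inner ℝ v v) ∧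
        0 < inner ℝ (y - c) w ∧ inner ℝ (y - c) w < inner ℝ w w} := by
      have c1 : Continuous fun y : Plane => inner ℝ (y - c) v := by fun_prop
      have c2 : Continuous fun y : Plane => inner ℝ (y - c) w := by fun_prop
      exact ((isOpen_lt continuous_const c1).inter (isOpen_lt c1 continuous_const)).inter
        ((isOpen_lt continuous_const c2).inter (isOpen_lt c2 continuous_const))
    refine mem_interior.mpr ⟨_, fun y hy => ?_, ho, hx⟩
    rw [mem_spanned_iff hv hw h]
    exact ⟨⟨hy.1.1.le, hy.1.2.le⟩, hy.2.1.le, hy.2.2.le⟩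

end Rectangles

/-! ### The frame of a pair of points -/

section Frame

/-- `x` or `-x`, according to a sign. -/
def signed (b : Bool) (x : ℝ) : ℝ := if b then x else -x

/-- The coordinate of `p` along the line through `s` and `o`, with origin `s`. -/
def along (b : Bool) (s o p : Plane) : ℝ :=
  signed b ((p 0 - s 0) * (o 0 - s 0) + (p 1 - s 1) * (o 1 - s 1))

/-- The coordinate of `p` perpendicular to the line through `s` and `o`. -/
def height (b : Bool) (s o p : Plane) : ℝ :=
  signed b ((o 0 - s 0) * (p 1 - s 1) - (o 1 - s 1) * (p 0 - s 0))

theorem along_not (b : Bool) (s o p : Plane) : along (!b) s o p = -along b s o p := by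
  cases b <;> simp [along, signed]

/-- Squared distance of `s` and `o`. -/
def sqDist (s o : Plane) : ℝ :=
  (o 0 - s 0) * (o 0 - s 0) + (o 1 - s 1) * (o 1 - s 1)

/-- The point with first coordinate `l` on the line through `s` and `o`. -/
noncomputable def cornerPt (τ : Bool) (s o : Plane) (l : ℝ) : Plane :=
  !₂[s 0 + l * signed τ (o 0 - s 0) / sqDist s o, s 1 + l * signed τ (o 1 - s 1) / sqDist s o]

/-- The coordinates `along` and `height` are the Euclidean ones scaled by the distance of `s` and
`o`. Dividing by the squared distance undoes the scaling and normalises the direction at once, so no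
square root is needed. -/
noncomputable def alongVec (τ : Bool) (s o : Plane) (d : ℝ) : Plane :=
  !₂[d * signed τ (o 0 - s 0) / sqDist s o, d * signed τ (o 1 - s 1) / sqDist s o]

noncomputable def heightVec (σ : Bool) (s o : Plane) (h : ℝ) : Plane :=
  !₂[h * signed σ (s 1 - o 1) / sqDist s o, h * signed σ (o 0 - s 0) / sqDist s o]

variable {τ σ : Bool} {s o p : Plane} {l r h : ℝ}

theorem sqDist_pos (hso : s ≠ o) : 0 < sqDist s o := by
  have := normSq_pos (v := o - s) (sub_ne_zero.mpr hso.symm)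
  simpa [sqDist] using this

theorem inner_alongVec (τ : Bool) (hso : s ≠ o) (d l : ℝ) :
    inner ℝ (p - cornerPt τ s o l) (alongVec τ s o d) =
      d / sqDist s o * (along τ s o p - l) := by
  have hd := (sqDist_pos hso).ne'
  rw [inner_eq]
  cases τ <;> simp [cornerPt, alongVec, along, signed] <;> field_simp <;> simp [sqDist] <;> ring

theorem inner_heightVec (τ σ : Bool) (hso : s ≠ o) (h l : ℝ) :
    inner ℝ (p - cornerPt τ s o l) (heightVec σ s o h) =
      h / sqDist s o * height σ s o p := by
  have hd := (sqDist_pos hso).ne'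
  rw [inner_eq]
  cases τ <;> cases σ <;> simp [cornerPt, heightVec, height, signed] <;> field_simp <;> ring

theorem inner_alongVec_self (τ : Bool) (hso : s ≠ o) (d : ℝ) :
    inner ℝ (alongVec τ s o d) (alongVec τ s o d) = d / sqDist s o * d := by
  have hd := (sqDist_pos hso).ne'
  rw [inner_eq]
  cases τ <;> simp [alongVec, signed] <;> field_simp <;> simp only [sqDist] <;> ring

theorem inner_heightVec_self (σ : Bool) (hso : s ≠ o) (h : ℝ) :
    inner ℝ (heightVec σ s o h) (heightVec σ s o h) = h / sqDist s o * h := by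
  have hd := (sqDist_pos hso).ne'
  rw [inner_eq]
  cases σ <;> simp [heightVec, signed] <;> field_simp <;> simp only [sqDist] <;> ring

theorem inner_alongVec_heightVec (τ σ : Bool) (s o : Plane) (d h : ℝ) :
    inner ℝ (alongVec τ s o d) (heightVec σ s o h) = 0 := by
  rw [inner_eq]
  cases τ <;> cases σ <;> simp [heightVec, alongVec, signed] <;> ring

theorem alongVec_ne_zero (hso : s ≠ o) {d : ℝ} (hd : 0 < d) : alongVec τ s o d ≠ 0 := by
  intro hc
  have := inner_alongVec_self τ hso d
  rw [hc, inner_zero_left] at this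
  have := sqDist_pos hso
  have : 0 < d / sqDist s o * d := by positivity
  linarith

theorem heightVec_ne_zero (hso : s ≠ o) (hh : 0 < h) : heightVec σ s o h ≠ 0 := by
  intro hc
  have := inner_heightVec_self σ hso h
  rw [hc, inner_zero_left] at this
  have := sqDist_pos hso
  have : 0 < h / sqDist s o * h := by positivity
  linarith

/-- The rectangle `[l, r] × [0, h]` in the frame of `s` and `o`. -/
def box (τ σ : Bool) (s o : Plane) (l r h : ℝ) : Set Plane :=
  spanned (cornerPt τ s o l) (alongVec τ s o (r - l)) (heightVec σ s o h)

/-- Both side vectors are positive multiples of the axes of the frame, so the inner product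
conditions of the rectangle rescale to bounds on the two coordinates. -/
theorem mem_box_iff (hso : s ≠ o) (hlr : l < r) (hh : 0 < h) :
    p ∈ box τ σ s o l r h ↔
      (l ≤ along τ s o p ∧ along τ s o p ≤ r) ∧ 0 ≤ height σ s o p ∧ height σ s o p ≤ h := by
  have hd := sqDist_pos hso
  have h1 : 0 < (r - l) / sqDist s o := div_pos (by linarith) hd
  have h2 : 0 < h / sqDist s o := by positivity
  rw [box, mem_spanned_iff (alongVec_ne_zero hso (by linarith)) (heightVec_ne_zero hso hh)
    (inner_alongVec_heightVec ..), inner_alongVec τ hso, inner_heightVec τ σ hso,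
    inner_alongVec_self τ hso, inner_heightVec_self σ hso, mul_le_mul_iff_right₀ h1,
    mul_le_mul_iff_right₀ h2, mul_nonneg_iff_of_pos_left h1, mul_nonneg_iff_of_pos_left h2,
    sub_nonneg, sub_le_sub_iff_right]

theorem mem_interior_box_iff (hso : s ≠ o) (hlr : l < r) (hh : 0 < h) :
    p ∈ interior (box τ σ s o l r h) ↔
      (l < along τ s o p ∧ along τ s o p < r) ∧ 0 < height σ s o p ∧ height σ s o p < h := by
  have hd := sqDist_pos hso
  have h1 : 0 < (r - l) / sqDist s o := div_pos (by linarith) hd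
  have h2 : 0 < h / sqDist s o := by positivity
  rw [box, mem_interior_spanned_iff (alongVec_ne_zero hso (by linarith)) (heightVec_ne_zero hso hh)
    (inner_alongVec_heightVec ..), inner_alongVec τ hso, inner_heightVec τ σ hso,
    inner_alongVec_self τ hso, inner_heightVec_self σ hso, mul_lt_mul_iff_right₀ h1,
    mul_lt_mul_iff_right₀ h2, mul_pos_iff_of_pos_left h1, mul_pos_iff_of_pos_left h2,
    sub_pos, sub_lt_sub_iff_right]

end Frame

/-! ### Expressions and tests for the frame of registers 0 and 1 -/

section Expressions

variable {N : ℕ} (u : State N 16)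

def orTest (a b : Test 16) : Test 16 := .not (.and (.not a) (.not b))

def realLT (e f : RealExpr 16) : Test 16 := .not (.realLE f e)

theorem holds_orTest (a b : Test 16) : (orTest a b).Holds u ↔ a.Holds u ∨ b.Holds u := by
  simp only [orTest, Test.Holds]; tauto

theorem holds_realLT (e f : RealExpr 16) : (realLT e f).Holds u ↔ e.eval u < f.eval u := by
  simp [realLT, Test.Holds]

theorem holds_wordLT (e f : WordExpr 16) : (wordLT e f).Holds u ↔ e.eval u < f.eval u := by
  simp [wordLT, Test.Holds]

def realConst (c : ℕ) : RealExpr 16 := .ofWord (.const c)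

theorem eval_realConst (c : ℕ) : (realConst c).eval u = c := rfl

def signedExpr (b : Bool) (e : RealExpr 16) : RealExpr 16 := if b then e else .sub (realConst 0) e

theorem eval_signedExpr (b : Bool) (e : RealExpr 16) :
    (signedExpr b e).eval u = signed b (e.eval u) := by
  cases b <;> simp [signedExpr, signed, RealExpr.eval, realConst, WordExpr.eval]

/-- A coordinate of the difference of two element registers. -/
def diffExpr (r r' : Fin 16) (j : Fin 2) : RealExpr 16 := .sub (.coord r j) (.coord r' j)

def alongExpr (b : Bool) (r : Fin 16) : RealExpr 16 :=
  signedExpr b (.add (.mul (diffExpr r 0 0) (diffExpr 1 0 0))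
    (.mul (diffExpr r 0 1) (diffExpr 1 0 1)))

def heightExpr (b : Bool) (r : Fin 16) : RealExpr 16 :=
  signedExpr b (.sub (.mul (diffExpr 1 0 0) (diffExpr r 0 1))
    (.mul (diffExpr 1 0 1) (diffExpr r 0 0)))

def sqDistExpr : RealExpr 16 :=
  .add (.mul (diffExpr 1 0 0) (diffExpr 1 0 0)) (.mul (diffExpr 1 0 1) (diffExpr 1 0 1))

theorem eval_alongExpr (b : Bool) (r : Fin 16) :
    (alongExpr b r).eval u = along b (u.elem 0).2 (u.elem 1).2 (u.elem r).2 := by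
  simp [alongExpr, eval_signedExpr, along, RealExpr.eval, diffExpr]

theorem eval_heightExpr (b : Bool) (r : Fin 16) :
    (heightExpr b r).eval u = height b (u.elem 0).2 (u.elem 1).2 (u.elem r).2 := by
  simp [heightExpr, eval_signedExpr, height, RealExpr.eval, diffExpr]

def cornerExpr (τ : Bool) (l : RealExpr 16) : PointExpr 16 :=
  (.add (.coord 0 0) (.div (.mul l (signedExpr τ (diffExpr 1 0 0))) sqDistExpr),
    .add (.coord 0 1) (.div (.mul l (signedExpr τ (diffExpr 1 0 1))) sqDistExpr))

def alongVecExpr (τ : Bool) (d : RealExpr 16) : PointExpr 16 :=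
  (.div (.mul d (signedExpr τ (diffExpr 1 0 0))) sqDistExpr,
    .div (.mul d (signedExpr τ (diffExpr 1 0 1))) sqDistExpr)

def heightVecExpr (σ : Bool) (h : RealExpr 16) : PointExpr 16 :=
  (.div (.mul h (signedExpr σ (diffExpr 0 1 1))) sqDistExpr,
    .div (.mul h (signedExpr σ (diffExpr 1 0 0))) sqDistExpr)

theorem eval_sqDistExpr : sqDistExpr.eval u = sqDist (u.elem 0).2 (u.elem 1).2 := by
  simp [sqDistExpr, sqDist, RealExpr.eval, diffExpr]

theorem eval_cornerExpr (τ : Bool) (l : RealExpr 16) :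
    (cornerExpr τ l).eval u = cornerPt τ (u.elem 0).2 (u.elem 1).2 (l.eval u) := by
  simp [cornerExpr, PointExpr.eval, cornerPt, RealExpr.eval, eval_signedExpr, diffExpr,
    eval_sqDistExpr]

theorem eval_alongVecExpr (τ : Bool) (d : RealExpr 16) :
    (alongVecExpr τ d).eval u = alongVec τ (u.elem 0).2 (u.elem 1).2 (d.eval u) := by
  simp [alongVecExpr, PointExpr.eval, alongVec, RealExpr.eval, eval_signedExpr, diffExpr,
    eval_sqDistExpr]

theorem eval_heightVecExpr (σ : Bool) (h : RealExpr 16) :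
    (heightVecExpr σ h).eval u = heightVec σ (u.elem 0).2 (u.elem 1).2 (h.eval u) := by
  simp [heightVecExpr, PointExpr.eval, heightVec, RealExpr.eval, eval_signedExpr, diffExpr,
    eval_sqDistExpr]

/-- Two element registers hold elements of the same colour. -/
def sameColor (r r' : Fin 16) : Test 16 :=
  orTest (.and (.isRed r) (.isRed r')) (.and (.not (.isRed r)) (.not (.isRed r')))

theorem holds_sameColor (r r' : Fin 16) :
    (sameColor r r').Holds u ↔ (u.elem r).1 = (u.elem r').1 := by
  rw [sameColor, holds_orTest]
  simp only [Test.Holds]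
  rcases (u.elem r).1 <;> rcases (u.elem r').1 <;> simp

/-! ### Orders on the elements -/

open Classical in
/-- Order of the sweep: by height, and elements of the colour of `s` first. -/
noncomputable def eventKey (σ : Bool) (s o e : Elem) : ℝ ×ₗ ℕ :=
  toLex (height σ s.2 o.2 e.2, if e.1 = s.1 then 0 else 1)

open Classical in
/-- Order that puts the points on the left of `s` before those on the right. -/
noncomputable def sideKey (τ σ : Bool) (s o e : Elem) : ℕ ×ₗ (ℝ ×ₗ ℕ) :=
  toLex (if along τ s.2 o.2 e.2 < 0 then 0 else 1, eventKey σ s o e)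

/-- The lexicographic comparison of `eventKey`; equality of heights is expressed by two
inequalities. -/
def eventLT (σ : Bool) (r r' : Fin 16) : Test 16 :=
  orTest (realLT (heightExpr σ r) (heightExpr σ r'))
    (.and (.realLE (heightExpr σ r) (heightExpr σ r'))
      (.and (.realLE (heightExpr σ r') (heightExpr σ r))
        (.and (sameColor r 0) (.not (sameColor r' 0)))))

def sideLT (τ σ : Bool) (r r' : Fin 16) : Test 16 :=
  orTest (.and (realLT (alongExpr τ r) (realConst 0))
      (.not (realLT (alongExpr τ r') (realConst 0))))
    (.and (orTest (.and (realLT (alongExpr τ r) (realConst 0))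
      (realLT (alongExpr τ r') (realConst 0)))
      (.and (.not (realLT (alongExpr τ r) (realConst 0)))
        (.not (realLT (alongExpr τ r') (realConst 0))))) (eventLT σ r r'))

def alongLT (b : Bool) (r r' : Fin 16) : Test 16 := realLT (alongExpr b r) (alongExpr b r')

/-- Lexicographic order of the coordinates. -/
def lexKey (e : Elem) : ℝ ×ₗ ℝ := toLex (e.2 0, e.2 1)

def lexLT (r r' : Fin 16) : Test 16 :=
  orTest (realLT (.coord r 0) (.coord r' 0))
    (.and (.realLE (.coord r 0) (.coord r' 0))
      (.and (.realLE (.coord r' 0) (.coord r 0)) (realLT (.coord r 1) (.coord r' 1))))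

variable (s o : Elem)

theorem holds_eventLT (σ : Bool) (h0 : u.elem 0 = s) (h1 : u.elem 1 = o) (r r' : Fin 16) :
    (eventLT σ r r').Holds u ↔ eventKey σ s o (u.elem r) < eventKey σ s o (u.elem r') := by
  rw [eventLT, holds_orTest, holds_realLT]
  simp only [Test.Holds, holds_sameColor, eval_heightExpr, h0, h1, eventKey,
    Prod.Lex.toLex_lt_toLex, le_antisymm_iff]
  by_cases a : (u.elem r).1 = s.1 <;> by_cases b : (u.elem r').1 = s.1 <;> simp [a, b]

theorem compares_sideLT (τ σ : Bool) : Compares N (sideLT τ σ) (sideKey τ σ s o) s o := by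
  intro u h0 h1 r r'
  rw [sideLT, holds_orTest]
  simp only [Test.Holds, holds_orTest, holds_realLT, holds_eventLT u s o σ h0 h1, eval_alongExpr,
    h0, h1, eval_realConst, sideKey, Prod.Lex.toLex_lt_toLex, Nat.cast_zero]
  by_cases a : along τ s.2 o.2 (u.elem r).2 < 0 <;>
    by_cases b : along τ s.2 o.2 (u.elem r').2 < 0 <;> simp [a, b]

theorem compares_alongLT (b : Bool) :
    Compares N (alongLT b) (fun e => along b s.2 o.2 e.2) s o := by
  intro u h0 h1 r r'
  rw [alongLT, holds_realLT, eval_alongExpr, eval_alongExpr, h0, h1]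

theorem compares_lexLT : Compares N lexLT lexKey s o := by
  intro u h0 h1 r r'
  rw [lexLT, holds_orTest]
  simp only [Test.Holds, holds_realLT, lexKey, Prod.Lex.toLex_lt_toLex, RealExpr.eval,
    le_antisymm_iff, and_assoc]

theorem lexKey_snd {e e' : Elem} (h : lexKey e = lexKey e') : e.2 = e'.2 := by
  have := congrArg ofLex h
  simp only [lexKey, ofLex_toLex, Prod.mk.injEq] at this
  ext i
  fin_cases i
  · exact this.1
  · exact this.2

end Expressions

/-! ### One side of the sweep -/

section Blocks

variable {α : Type*} {f g : ℕ → α} {a b : ℕ}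

/-- The values of `f` on `[a, b)`. -/
def block (f : ℕ → α) (a b : ℕ) : Set α := {e | ∃ i, (a ≤ i ∧ i < b) ∧ f i = e}

theorem PermOn.block_eq (h : PermOn a b f g) : block g a b = block f a b := by
  ext e
  constructor
  · rintro ⟨i, hi, rfl⟩
    obtain ⟨j, hj, e⟩ := h.exists_eq hi
    exact ⟨j, hj, e.symm⟩
  · rintro ⟨i, hi, rfl⟩
    obtain ⟨j, hj, e⟩ := h.symm.exists_eq hi
    exact ⟨j, hj, e.symm⟩

theorem block_succ (f : ℕ → α) (h : a ≤ b) : block f a (b + 1) = insert (f b) (block f a b) := by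
  ext e
  constructor
  · rintro ⟨i, hi, rfl⟩
    rcases Nat.lt_succ_iff_lt_or_eq.mp hi.2 with h1 | rfl
    · exact Or.inr ⟨i, ⟨hi.1, h1⟩, rfl⟩
    · exact Or.inl rfl
  · rintro (rfl | ⟨i, hi, rfl⟩)
    · exact ⟨b, by omega, rfl⟩
    · exact ⟨i, by omega, rfl⟩

theorem block_congr (h : ∀ i, a ≤ i → i < b → g i = f i) : block g a b = block f a b := by
  ext e
  constructor <;> rintro ⟨i, hi, rfl⟩
  · exact ⟨i, hi, (h i hi.1 hi.2).symm⟩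
  · exact ⟨i, hi, h i hi.1 hi.2⟩

theorem block_self (f : ℕ → α) (a : ℕ) : block f a a = ∅ := by
  ext e
  simp only [block, Set.mem_ofPred_eq, Set.mem_empty_iff_false, iff_false]
  rintro ⟨i, hi, -⟩
  omega

end Blocks

/-! ### Alive points and obstacles on one side of the sweep -/

section SideInvariant

variable (b σ : Bool) (s o : Elem)

/-- The processed points of the other colour above the base line. -/
def obstacles (R : Set Elem) : Set Elem :=
  {e | e ∈ R ∧ e.1 ≠ s.1 ∧ 0 < height σ s.2 o.2 e.2}

/-- The processed points of the colour of `s` above the base line that are not farther from `s`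
than any processed obstacle. -/
def alive (R : Set Elem) : Set Elem :=
  {e | e ∈ R ∧ e.1 = s.1 ∧ 0 < height σ s.2 o.2 e.2 ∧
    ∀ q ∈ obstacles σ s o R, along b s.2 o.2 e.2 ≤ along b s.2 o.2 q.2}

/-- The state of one side of the sweep: `R` is the set of processed points among the points of
`A`, `H` is the content of the heap, and `lim` is the distance of the nearest obstacle. -/
structure SideInv (A R H : Set Elem) (lim : ℝ) : Prop where
  heap : H = alive b σ s o R
  sub : R ⊆ A
  lim_le : ∀ q ∈ obstacles σ s o R, lim ≤ along b s.2 o.2 q.2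
  le_lim : ∀ e ∈ A, (∀ q ∈ obstacles σ s o R, along b s.2 o.2 e.2 ≤ along b s.2 o.2 q.2) →
    along b s.2 o.2 e.2 ≤ lim

variable {b σ s o} {A R H : Set Elem} {lim : ℝ} {e : Elem}

theorem obstacles_insert_of_not (h : ¬ (e.1 ≠ s.1 ∧ 0 < height σ s.2 o.2 e.2)) :
    obstacles σ s o (insert e R) = obstacles σ s o R := by
  ext q
  simp only [obstacles, Set.mem_ofPred_eq, Set.mem_insert_iff]
  constructor
  · rintro ⟨rfl | h1, h2⟩
    · exact absurd h2 h
    · exact ⟨h1, h2⟩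
  · rintro ⟨h1, h2⟩
    exact ⟨Or.inr h1, h2⟩

theorem obstacles_insert_of (h : e.1 ≠ s.1 ∧ 0 < height σ s.2 o.2 e.2) :
    obstacles σ s o (insert e R) = insert e (obstacles σ s o R) := by
  ext q
  simp only [obstacles, Set.mem_ofPred_eq, Set.mem_insert_iff]
  constructor
  · rintro ⟨rfl | h1, h2⟩
    · exact Or.inl rfl
    · exact Or.inr ⟨h1, h2⟩
  · rintro (rfl | ⟨h1, h2⟩)
    · exact ⟨Or.inl rfl, h⟩
    · exact ⟨Or.inr h1, h2⟩

/-- A point on or below the base line is neither an obstacle nor a point to be counted by the heap.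
-/
theorem SideInv.skip (h : SideInv b σ s o A R H lim) (he : e ∈ A)
    (hlow : height σ s.2 o.2 e.2 ≤ 0) : SideInv b σ s o A (insert e R) H lim := by
  have ho : obstacles σ s o (insert e R) = obstacles σ s o R :=
    obstacles_insert_of_not fun h => absurd h.2 (not_lt.mpr hlow)
  refine ⟨?_, Set.insert_subset he h.sub, by rw [ho]; exact h.lim_le, by rw [ho]; exact h.le_lim⟩
  rw [h.heap]
  ext q
  simp only [alive, Set.mem_ofPred_eq, ho, Set.mem_insert_iff]
  constructor
  · rintro ⟨h1, h2⟩
    exact ⟨Or.inr h1, h2⟩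
  · rintro ⟨rfl | h1, h2⟩
    · exact absurd h2.2.1 (not_lt.mpr hlow)
    · exact ⟨h1, h2⟩

/-- A point within the limit is within the distance of every obstacle passed so far, by `lim_le`. -/
theorem SideInv.point (h : SideInv b σ s o A R H lim) (he : e ∈ A) (hc : e.1 = s.1)
    (hh : 0 < height σ s.2 o.2 e.2) (hl : along b s.2 o.2 e.2 ≤ lim) :
    SideInv b σ s o A (insert e R) (insert e H) lim := by
  have ho : obstacles σ s o (insert e R) = obstacles σ s o R :=
    obstacles_insert_of_not fun h => h.1 hc
  refine ⟨?_, Set.insert_subset he h.sub, by rw [ho]; exact h.lim_le, by rw [ho]; exact h.le_lim⟩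
  rw [h.heap]
  ext q
  simp only [alive, Set.mem_ofPred_eq, ho, Set.mem_insert_iff]
  constructor
  · rintro (rfl | ⟨h1, h2⟩)
    · exact ⟨Or.inl rfl, hc, hh, fun q hq => hl.trans (h.lim_le q hq)⟩
    · exact ⟨Or.inr h1, h2⟩
  · rintro ⟨rfl | h1, h2⟩
    · exact Or.inl rfl
    · exact Or.inr ⟨h1, h2⟩

/-- By `le_lim`, a point beyond the limit is beyond some obstacle. Obstacles are never removed, so
the point can be forgotten. -/
theorem SideInv.dead (h : SideInv b σ s o A R H lim) (he : e ∈ A) (hc : e.1 = s.1)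
    (hl : lim < along b s.2 o.2 e.2) : SideInv b σ s o A (insert e R) H lim := by
  have ho : obstacles σ s o (insert e R) = obstacles σ s o R :=
    obstacles_insert_of_not fun h => h.1 hc
  refine ⟨?_, Set.insert_subset he h.sub, by rw [ho]; exact h.lim_le, by rw [ho]; exact h.le_lim⟩
  rw [h.heap]
  ext q
  simp only [alive, Set.mem_ofPred_eq, ho, Set.mem_insert_iff]
  constructor
  · rintro ⟨h1, h2⟩
    exact ⟨Or.inr h1, h2⟩
  · rintro ⟨rfl | h1, h2⟩
    · exact absurd (h.le_lim q he h2.2.2) (not_le.mpr hl)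
    · exact ⟨h1, h2⟩

/-- A new obstacle adds one condition to being alive, namely the one that trims the heap. -/
theorem SideInv.obstacle (h : SideInv b σ s o A R H lim) (he : e ∈ A) (hc : e.1 ≠ s.1)
    (hh : 0 < height σ s.2 o.2 e.2) :
    SideInv b σ s o A (insert e R) {q | q ∈ H ∧ along b s.2 o.2 q.2 ≤ along b s.2 o.2 e.2}
      (min lim (along b s.2 o.2 e.2)) := by
  have ho := obstacles_insert_of (R := R) ⟨hc, hh⟩
  refine ⟨?_, Set.insert_subset he h.sub, ?_, ?_⟩
  · rw [h.heap]
    ext q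
    simp only [alive, Set.mem_ofPred_eq, ho, Set.mem_insert_iff, forall_eq_or_imp]
    constructor
    · rintro ⟨⟨h1, h2, h3, h4⟩, h5⟩
      exact ⟨Or.inr h1, h2, h3, h5, h4⟩
    · rintro ⟨rfl | h1, h2, h3, h4, h5⟩
      · exact absurd h2 hc
      · exact ⟨⟨h1, h2, h3, h5⟩, h4⟩
  · rw [ho]
    rintro q (rfl | hq)
    · exact min_le_right _ _
    · exact (min_le_left _ _).trans (h.lim_le q hq)
  · intro q hq hle
    rw [ho] at hle
    exact le_min (h.le_lim q hq fun p hp => hle p (Or.inr hp)) (hle e (Or.inl rfl))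

/-- All alive points are within the old limit, so an obstacle at or beyond it removes none of them.
-/
theorem SideInv.far (h : SideInv b σ s o A R H lim) (he : e ∈ A) (hc : e.1 ≠ s.1)
    (hh : 0 < height σ s.2 o.2 e.2) (hl : lim ≤ along b s.2 o.2 e.2) :
    SideInv b σ s o A (insert e R) H lim := by
  have := h.obstacle he hc hh
  rw [min_eq_left hl] at this
  convert this using 1
  ext q
  simp only [Set.mem_ofPred_eq, iff_self_and]
  intro hq
  rw [h.heap] at hq
  exact (h.le_lim q (h.sub hq.1) hq.2.2.2).trans hl

end SideInvariant

/-! ### Processing one element with an in-place heap -/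

section SidePrograms

variable {N W : ℕ} {b σ : Bool} {s o : Elem}

/-- The limit given by element register 9, to which register 14 is added. -/
def limExpr (b : Bool) : RealExpr 16 := .add (alongExpr b 9) (.ofWord (.reg 14))

/-- Remove from the heap what lies beyond the limit. -/
def trimHeap (b : Bool) : Program 16 :=
  -- This position exists even if the heap is empty; what it then holds is irrelevant because the
  -- test of the loop also asks for a nonempty heap.
  .seq (.load 8 (.reg 9)) <|
  .loop (.and (wordLT (.const 0) (.reg 10)) (realLT (limExpr b) (alongExpr b 8))) <|
    .seq (heapPop (alongLT b)) (.load 8 (.reg 9))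

/-- Handle the element in register 4, which is at the array position given by register 15. -/
def takeNext (b σ : Bool) : Program 16 :=
  .seq
    (.branch (realLT (realConst 0) (heightExpr σ 4))
      (.branch (sameColor 4 0)
        (.branch (.realLE (alongExpr b 4) (limExpr b))
          (.seq (exchange (.reg 15) (heapPos (.reg 10))) (heapPush (alongLT b))) .skip)
        (.branch (realLT (alongExpr b 4) (limExpr b))
          (.seq (.copy 9 4) <| .seq (.assign 14 (.const 0)) (trimHeap b)) .skip))
      .skip)
    (.assign 15 (.add (.reg 15) (.const 1)))

/-- The limit in the state `u`. -/
def limit (b : Bool) (s o : Elem) (u : State N 16) : ℝ :=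
  along b s.2 o.2 (u.elem 9).2 + u.word 14

theorem eval_limExpr {u : State N 16} (h0 : u.elem 0 = s) (h1 : u.elem 1 = o) :
    (limExpr b).eval u = limit b s o u := by
  simp [limExpr, RealExpr.eval, eval_alongExpr, h0, h1, limit, WordExpr.eval]

/-- Popping stops when the root is within the limit, and the root is the farthest element. Each pop
is paid for by the drop of `30 * L * size`, where `L` is `Nat.log 2 N + 1`. -/
theorem runs_trimHeap {u : State N 16} {base : ℕ} (h0 : u.elem 0 = s) (h1 : u.elem 1 = o)
    (hb : u.word 9 = base) (hbN : base < N) (hN : base + u.word 10 ≤ N) (hW : N ≤ W)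
    (hh : IsHeap (fun i => along b s.2 o.2 (cell u (base + i)).2) (u.word 10)) :
    Runs W (trimHeap b) u fun t v => Keeps [10, 11, 12] [5, 6, 7, 8] u v ∧
      v.word 10 ≤ u.word 10 ∧ PermOn base (base + u.word 10) (cell u) (cell v) ∧
      IsHeap (fun i => along b s.2 o.2 (cell v (base + i)).2) (v.word 10) ∧
      block (cell v) base (base + v.word 10) =
        {e | e ∈ block (cell u) base (base + u.word 10) ∧ along b s.2 o.2 e.2 ≤ limit b s o u} ∧
      t + 30 * (Nat.log 2 N + 1) * v.word 10 ≤ 30 * (Nat.log 2 N + 1) * u.word 10 + 2 := by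
  set L := Nat.log 2 N + 1 with hL
  refine runs_seq (runs_load (by simp [WordExpr.eval, hb, hbN]) ?_)
  refine (runs_loop
    (I := fun v => Keeps [10, 11, 12] [5, 6, 7, 8] u v ∧ v.word 10 ≤ u.word 10 ∧
      PermOn base (base + u.word 10) (cell u) (cell v) ∧
      IsHeap (fun i => along b s.2 o.2 (cell v (base + i)).2) (v.word 10) ∧
      block (cell v) base (base + v.word 10) ⊆ block (cell u) base (base + u.word 10) ∧
      (∀ e ∈ block (cell u) base (base + u.word 10), along b s.2 o.2 e.2 ≤ limit b s o u →
        e ∈ block (cell v) base (base + v.word 10)) ∧ v.elem 8 = cell v base)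
    (Φ := fun v => 30 * L * v.word 10) ?_ ?_).mono ?_
  · rintro v ⟨kv, v10, pv, hv, sub, sup, v8⟩ hT
    have k0 : v.elem 0 = s := by rw [kv.elem 0 (by decide), h0]
    have k1 : v.elem 1 = o := by rw [kv.elem 1 (by decide), h1]
    have v9 : v.word 9 = base := by rw [kv.word 9 (by decide), hb]
    have vl : limit b s o v = limit b s o u := by
      rw [limit, limit, kv.elem 9 (by decide), kv.word 14 (by decide)]
    simp only [Test.Holds, holds_wordLT, holds_realLT, eval_limExpr k0 k1, eval_alongExpr, k0, k1,
      v8, vl, WordExpr.eval] at hT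
    refine runs_seq ((runs_heapPop (compares_alongLT s o b) k0 k1 v9 rfl hT.1 (by omega) hW
      hv).mono ?_)
    rintro t x ⟨kx, x10, px, hx, xl, ht⟩
    have x9 : x.word 9 = base := by rw [kx.word 9 (by decide), v9]
    refine runs_load (by simp [WordExpr.eval, x9, hbN]) ?_
    have hseg : block (cell v) base (base + v.word 10) =
        insert (cell v base) (block (cell x) base (base + x.word 10)) := by
      rw [← px.block_eq, x10]
      conv_lhs => rw [show base + v.word 10 = base + (v.word 10 - 1) + 1 by omega,
        block_succ _ (by omega), xl]
    refine ⟨⟨?_, ?_, ?_, ?_, ?_, ?_, ?_⟩, ?_⟩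
    · have k := kv.trans (kx.mono (by decide) (by decide))
      exact ⟨k.word, fun r hr => by rw [← k.elem r hr]; simp at hr; simp [hr], k.out⟩
    · simp only; omega
    · exact pv.trans (px.mono le_rfl (by omega))
    · simp only [x10, cell_mk x]; exact hx
    · rw [cell_mk x]
      refine subset_trans ?_ sub
      rw [hseg]; exact Set.subset_insert _ _
    · intro e he hle
      have := sup e he hle
      rw [hseg] at this
      rcases this with rfl | h
      · exact absurd hle (not_le.mpr hT.2)
      · exact h
    · simp [WordExpr.eval, x9, cell_mk x, cell_of_lt x hbN]
    · simp only [x10]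
      obtain ⟨m, hm⟩ : ∃ m, v.word 10 = m + 1 := ⟨v.word 10 - 1, by omega⟩
      have e : 30 * L * (m + 1) = 30 * L * m + 30 * L := by ring
      rw [hm, Nat.add_sub_cancel, e]
      omega
  · refine ⟨⟨fun i hi => rfl, fun r hr => by simp at hr; simp [hr], rfl⟩, le_rfl,
      PermOn.refl _ _ _, hh, subset_rfl, fun e he _ => he, ?_⟩
    simp [WordExpr.eval, hb, cell_mk u, cell_of_lt u hbN]
  · rintro t v ⟨⟨kv, v10, pv, hv, sub, sup, v8⟩, hT, ht⟩
    have k0 : v.elem 0 = s := by rw [kv.elem 0 (by decide), h0]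
    have k1 : v.elem 1 = o := by rw [kv.elem 1 (by decide), h1]
    have vl : limit b s o v = limit b s o u := by
      rw [limit, limit, kv.elem 9 (by decide), kv.word 14 (by decide)]
    simp only [Test.Holds, holds_wordLT, holds_realLT, eval_limExpr k0 k1, eval_alongExpr, k0, k1,
      v8, vl, WordExpr.eval] at hT
    refine ⟨kv, v10, pv, hv, Set.Subset.antisymm (fun e he => ⟨sub he, ?_⟩)
      (fun e he => sup e he.1 he.2), by simp only at ht; omega⟩
    obtain ⟨i, hi, rfl⟩ := he
    have hroot := hv.le_root (i := i - base) (by omega)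
    simp only [show base + (i - base) = i by omega, add_zero] at hroot
    refine hroot.trans (not_lt.mp fun hlt => hT ⟨by omega, hlt⟩)

/-- The time bound is amortized. A push raises the potential `30 * L * size`, where `L` is `Nat.log
2 N + 1`, and this surplus later pays for the pop. The heap occupies the front of the passed part,
so the element at `ptr` can be exchanged with the one just behind the heap without touching unpassed
elements. -/
theorem runs_takeNext {u : State N 16} {base ptr : ℕ} {A R : Set Elem} (h0 : u.elem 0 = s)
    (h1 : u.elem 1 = o) (hb : u.word 9 = base) (hp : u.word 15 = ptr) (h4 : u.elem 4 = cell u ptr)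
    (hA : u.elem 4 ∈ A) (hbp : base + u.word 10 ≤ ptr) (hpN : ptr < N) (hW : N ≤ W)
    (hh : IsHeap (fun i => along b s.2 o.2 (cell u (base + i)).2) (u.word 10))
    (hinv : SideInv b σ s o A R (block (cell u) base (base + u.word 10)) (limit b s o u)) :
    Runs W (takeNext b σ) u fun t v => Keeps [10, 11, 12, 14, 15] [5, 6, 7, 8, 9] u v ∧
      v.word 15 = ptr + 1 ∧ base + v.word 10 ≤ ptr + 1 ∧
      PermOn base (ptr + 1) (cell u) (cell v) ∧
      IsHeap (fun i => along b s.2 o.2 (cell v (base + i)).2) (v.word 10) ∧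
      SideInv b σ s o A (insert (u.elem 4) R) (block (cell v) base (base + v.word 10))
        (limit b s o v) ∧
      (limit b s o v = limit b s o u ∨ limit b s o v = along b s.2 o.2 (u.elem 4).2) ∧
      v.word 14 ≤ u.word 14 ∧ t + 30 * (Nat.log 2 N + 1) * v.word 10 ≤
        30 * (Nat.log 2 N + 1) * u.word 10 + 60 * (Nat.log 2 N + 1) := by
  set L := Nat.log 2 N + 1 with hL
  refine runs_seq (Runs.mono (Q := fun t v => Keeps [10, 11, 12, 14, 15] [5, 6, 7, 8, 9] u v ∧
      v.word 15 = ptr ∧ base + v.word 10 ≤ ptr + 1 ∧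
      PermOn base (ptr + 1) (cell u) (cell v) ∧
      IsHeap (fun i => along b s.2 o.2 (cell v (base + i)).2) (v.word 10) ∧
      SideInv b σ s o A (insert (u.elem 4) R) (block (cell v) base (base + v.word 10))
        (limit b s o v) ∧
      (limit b s o v = limit b s o u ∨ limit b s o v = along b s.2 o.2 (u.elem 4).2) ∧
      v.word 14 ≤ u.word 14 ∧ t + 30 * L * v.word 10 ≤ 30 * L * u.word 10 + 59 * L) ?_ ?_)
  · have stay : SideInv b σ s o A (insert (u.elem 4) R) (block (cell u) base (base + u.word 10))
        (limit b s o u) → Keeps [10, 11, 12, 14, 15] [5, 6, 7, 8, 9] u u ∧ u.word 15 = ptr ∧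
      base + u.word 10 ≤ ptr + 1 ∧ PermOn base (ptr + 1) (cell u) (cell u) ∧
      IsHeap (fun i => along b s.2 o.2 (cell u (base + i)).2) (u.word 10) ∧
      SideInv b σ s o A (insert (u.elem 4) R) (block (cell u) base (base + u.word 10))
        (limit b s o u) ∧
      (limit b s o u = limit b s o u ∨ limit b s o u = along b s.2 o.2 (u.elem 4).2) ∧
        u.word 14 ≤ u.word 14 :=
      fun h => ⟨Keeps.refl _ _ _, hp, by omega, PermOn.refl _ _ _, hh, h, Or.inl rfl, le_rfl⟩
    refine runs_branch (fun hT => ?_) (fun hT => runs_skip ?_) <;>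
      simp only [holds_realLT, eval_realConst, eval_heightExpr, h0, h1, Nat.cast_zero] at hT
    · refine runs_branch (fun hC => ?_) (fun hC => ?_) <;>
        simp only [holds_sameColor, h0] at hC
      · refine runs_branch (fun hl => ?_) (fun hl => runs_skip ?_) <;>
          simp only [Test.Holds, eval_limExpr h0 h1, eval_alongExpr, h0, h1] at hl
        · refine runs_seq ((runs_exchange (i := ptr) (j := base + u.word 10)
            (by simpa [WordExpr.eval] using hp) (by simp [heapPos, WordExpr.eval, hb]) hpN
            (by omega)).mono ?_)
          rintro t v ⟨ht, kv, cv⟩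
          have v10 : v.word 10 = u.word 10 := kv.word 10 (by decide)
          have same : ∀ i, base ≤ i → i < base + u.word 10 → cell v i = cell u i := by
            intro i hi hi'
            rw [cv, Function.comp, Equiv.swap_apply_of_ne_of_ne (by omega) (by omega)]
          refine (runs_heapPush (compares_alongLT s o b) (n := u.word 10) (base := base) (s := v)
            (by rw [kv.elem 0 (by decide), h0]) (by rw [kv.elem 1 (by decide), h1])
            (by rw [kv.word 9 (by decide), hb]) v10 (by omega) hW ?_).mono ?_
          · intro i hi hi'
            simp only [same (base + i) (by omega) (by omega),
              same (base + (i - 1) / 2) (by omega) (by omega)]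
            exact hh i hi hi'
          · rintro t' x ⟨kx, x10, px, hx, ht'⟩
            have k := (kv.mono (ws' := [10, 11, 12, 14, 15]) (es' := [5, 6, 7, 8, 9])
              (by decide) (by decide)).trans (kx.mono (by decide) (by decide))
            have hlim : limit b s o x = limit b s o u := by
              rw [limit, limit, kx.elem 9 (by decide), kx.word 14 (by decide),
                kv.elem 9 (by decide), kv.word 14 (by decide)]
            refine ⟨k, ?_, by omega, ?_, by rw [x10]; exact hx, ?_, Or.inl hlim, ?_, ?_⟩
            · rw [kx.word 15 (by decide), kv.word 15 (by decide), hp]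
            -- The exchange and the push move only elements in positions from `base` to `ptr`.
            · refine PermOn.trans ?_ (px.mono le_rfl (by omega))
              rw [cv]
              exact PermOn.swap _ (by omega) (by omega)
            · rw [hlim, x10, px.block_eq, ← add_assoc, block_succ _ (by omega),
                block_congr same]
              have : cell v (base + u.word 10) = u.elem 4 := by rw [cv, h4]; simp
              rw [this]
              exact hinv.point hA hC hT hl
            · rw [kx.word 14 (by decide), kv.word 14 (by decide)]
            · rw [x10, mul_add]
              omega
        · obtain ⟨g1, g2, g3, g4, g5, g6, g7, g8⟩ := stay (hinv.dead hA hC (not_le.mp hl))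
          exact ⟨g1, g2, g3, g4, g5, g6, g7, g8, by omega⟩
      · refine runs_branch (fun hl => ?_) (fun hl => runs_skip ?_) <;>
          simp only [holds_realLT, eval_limExpr h0 h1, eval_alongExpr, h0, h1] at hl
        · refine runs_seq (runs_copy (runs_seq (runs_assign (by simp [WordExpr.eval]) ?_)))
          set v : State N 16 := { u with
            elem := Function.update u.elem 9 (u.elem 4),
            word := Function.update u.word 14 _ } with hv
          have v10 : v.word 10 = u.word 10 := by simp [hv]
          have kv : Keeps [10, 11, 12, 14, 15] [5, 6, 7, 8, 9] u v := by
            refine ⟨fun i hi => ?_, fun r hr => ?_, rfl⟩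
            · simp at hi; simp [hv, hi]
            · simp at hr; simp [hv, hr]
          have v15 : v.word 15 = ptr := by simp [hv, hp]
          have cv : cell v = cell u := rfl
          have vl : limit b s o v = along b s.2 o.2 (u.elem 4).2 := by
            simp [limit, hv, WordExpr.eval]
          have v14 : v.word 14 = 0 := by simp [hv, WordExpr.eval]
          clear_value v
          refine (runs_trimHeap (b := b) (s := s) (o := o) (u := v) (base := base)
            (by rw [kv.elem 0 (by decide), h0]) (by rw [kv.elem 1 (by decide), h1])
            (by rw [kv.word 9 (by decide), hb]) (by omega) (by omega) hW
            (by rw [cv, v10]; exact hh)).mono ?_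
          rintro t x ⟨kx, x10, px, hx, hs, ht⟩
          have xl : limit b s o x = along b s.2 o.2 (u.elem 4).2 := by
            rw [← vl, limit, limit, kx.elem 9 (by decide), kx.word 14 (by decide)]
          rw [cv, v10] at px hs
          rw [v10] at x10 ht
          rw [← hL] at ht
          refine ⟨kv.trans (kx.mono (by decide) (by decide)), by rw [kx.word 15 (by decide), v15],
            by omega, px.mono le_rfl (by omega), hx, ?_, Or.inr xl,
            by rw [kx.word 14 (by decide), v14]; exact Nat.zero_le _, by omega⟩
          -- The obstacle is closer than the old limit, so the minimum in the new limit is the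
          -- distance of the obstacle, represented by a copy of the point and the bit 0.
          have := hinv.obstacle hA hC hT
          rw [min_eq_right hl.le] at this
          rw [hs, xl, vl]
          exact this
        · obtain ⟨g1, g2, g3, g4, g5, g6, g7, g8⟩ := stay (hinv.far hA hC hT (not_lt.mp hl))
          exact ⟨g1, g2, g3, g4, g5, g6, g7, g8, by omega⟩
    · obtain ⟨g1, g2, g3, g4, g5, g6, g7, g8⟩ := stay (hinv.skip hA (not_lt.mp hT))
      exact ⟨g1, g2, g3, g4, g5, g6, g7, g8, by omega⟩
  · rintro t v ⟨kv, v15, g2, g3, g4, g5, g6, g7, ht⟩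
    have e1 : ∀ x : ℕ, limit b s o { v with word := Function.update v.word 15 x } = limit b s o v :=
      fun x => by simp [limit]
    refine runs_assign (by simp [WordExpr.eval]; omega) ⟨?_, ?_, ?_, g3, ?_, ?_, ?_, ?_, ?_⟩
    · exact ⟨fun i hi => by rw [← kv.word i hi]; simp at hi; simp [hi], kv.elem, kv.out⟩
    · simp [WordExpr.eval, v15]
    · simpa using g2
    · simpa [cell_mk v] using g4
    · simpa [cell_mk v, e1] using g5
    · simpa [e1] using g6
    · simpa using g7
    · simp; omega

end SidePrograms

/-! ### The sweep -/

section SidesOfSweep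

variable {N W : ℕ} {s o : Elem} {τ σ : Bool}

/-- The integer registers 3 to 8 store, for the left (`false`) and the right side (`true`), the
position of the next element, the size of the heap, and the bit added to the limit. -/
def ptrReg : Bool → Fin 16
  | true => 4
  | false => 3

def sizeReg : Bool → Fin 16
  | true => 6
  | false => 5

/-- The bit is 1 while the limit lies one unit beyond an extreme point of `P`, that is, before an
obstacle has been taken as the limit, and 0 afterwards. -/
def flagReg : Bool → Fin 16
  | true => 8
  | false => 7

def limReg : Bool → Fin 16
  | true => 3
  | false => 2

def loExpr : Bool → WordExpr 16
  | true => .reg 2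
  | false => .const 0

/-- Handle the next element on the right (`δ = true`) or on the left of `s`. -/
def takeSide (τ σ δ : Bool) : Program 16 :=
  .seq (.assign 9 (loExpr δ)) <| .seq (.assign 10 (.reg (sizeReg δ))) <|
  .seq (.assign 14 (.reg (flagReg δ))) <| .seq (.assign 15 (.reg (ptrReg δ))) <|
  .seq (.copy 9 (limReg δ)) <| .seq (takeNext (τ == δ) σ) <|
  .seq (.assign (sizeReg δ) (.reg 10)) <| .seq (.assign (flagReg δ) (.reg 14)) <|
  .seq (.assign (ptrReg δ) (.reg 15)) (.copy (limReg δ) 9)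

/-- The distance of the nearest obstacle on one side. -/
def sideLimit (τ δ : Bool) (s o : Elem) (u : State N 16) : ℝ :=
  along (τ == δ) s.2 o.2 (u.elem (limReg δ)).2 + u.word (flagReg δ)

def lo (M : ℕ) : Bool → ℕ
  | true => M
  | false => 0

def hi (N M : ℕ) : Bool → ℕ
  | true => N
  | false => M

/-- The side's data are copied to the common registers, `runs_takeNext` is applied, and the data are
copied back; this accounts for the 9 extra steps. Comparing `τ` with `δ` turns the coordinate into
the outward distance from `s` on side `δ`. -/
theorem runs_takeSide {u : State N 16} {M ptr : ℕ} {A R : Set Elem} (δ : Bool) (h0 : u.elem 0 = s)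
    (h1 : u.elem 1 = o) (h2 : u.word 2 = M) (hp : u.word (ptrReg δ) = ptr)
    (h4 : u.elem 4 = cell u ptr) (hA : u.elem 4 ∈ A) (hbp : lo M δ + u.word (sizeReg δ) ≤ ptr)
    (hpN : ptr < N) (hW : N ≤ W) (hflag : u.word (flagReg δ) ≤ W)
    (hh : IsHeap (fun i => along (τ == δ) s.2 o.2 (cell u (lo M δ + i)).2) (u.word (sizeReg δ)))
    (hinv : SideInv (τ == δ) σ s o A R (block (cell u) (lo M δ) (lo M δ + u.word (sizeReg δ)))
      (sideLimit τ δ s o u)) :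
    Runs W (takeSide τ σ δ) u fun t v =>
      Keeps [9, 10, 11, 12, 14, 15, ptrReg δ, sizeReg δ, flagReg δ] [5, 6, 7, 8, 9, limReg δ] u v ∧
      v.word (ptrReg δ) = ptr + 1 ∧ lo M δ + v.word (sizeReg δ) ≤ ptr + 1 ∧
      PermOn (lo M δ) (ptr + 1) (cell u) (cell v) ∧
      IsHeap (fun i => along (τ == δ) s.2 o.2 (cell v (lo M δ + i)).2) (v.word (sizeReg δ)) ∧
      SideInv (τ == δ) σ s o A (insert (u.elem 4) R)
        (block (cell v) (lo M δ) (lo M δ + v.word (sizeReg δ))) (sideLimit τ δ s o v) ∧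
      (sideLimit τ δ s o v = sideLimit τ δ s o u ∨
        sideLimit τ δ s o v = along (τ == δ) s.2 o.2 (u.elem 4).2) ∧
      v.word (flagReg δ) ≤ u.word (flagReg δ) ∧
      t + 30 * (Nat.log 2 N + 1) * v.word (sizeReg δ) ≤
        30 * (Nat.log 2 N + 1) * u.word (sizeReg δ) + 60 * (Nat.log 2 N + 1) + 9 := by
  refine runs_seq (runs_assign ?_ (runs_seq (runs_assign ?_ (runs_seq (runs_assign ?_
    (runs_seq (runs_assign ?_ (runs_seq (runs_copy (runs_seq ?_))))))))))
  · cases δ <;> simp only [loExpr, WordExpr.eval, lo] at hbp ⊢ <;> omega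
  · cases δ <;> simp [loExpr, WordExpr.eval, lo, sizeReg] at hbp ⊢ <;> omega
  · cases δ <;> simpa [loExpr, WordExpr.eval, flagReg, sizeReg] using hflag
  · cases δ <;> simp [loExpr, WordExpr.eval, flagReg, sizeReg, ptrReg] at hp ⊢ <;> omega
  set v : State N 16 := { u with word := _, elem := _ } with hv
  have kv : Keeps [9, 10, 11, 12, 14, 15, ptrReg δ, sizeReg δ, flagReg δ]
      [5, 6, 7, 8, 9, limReg δ] u v := by
    refine ⟨fun i hi => ?_, fun r hr => ?_, rfl⟩
    · simp at hi; simp [hv, hi]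
    · simp at hr; simp [hv, hr]
  have cv : cell v = cell u := rfl
  have v9 : v.word 9 = lo M δ := by
    cases δ <;> simp [hv, loExpr, WordExpr.eval, lo, h2]
  have v10 : v.word 10 = u.word (sizeReg δ) := by
    cases δ <;> simp [hv, WordExpr.eval, sizeReg]
  have v15 : v.word 15 = ptr := by
    rw [← hp]; cases δ <;> simp [hv, WordExpr.eval, ptrReg]
  have v14 : v.word 14 = u.word (flagReg δ) := by
    cases δ <;> simp [hv, WordExpr.eval, flagReg]
  have w9 : v.elem 9 = u.elem (limReg δ) := by simp [hv]
  have v0 : v.elem 0 = s := by simp [hv, h0]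
  have v1 : v.elem 1 = o := by simp [hv, h1]
  have v4 : v.elem 4 = u.elem 4 := by simp [hv]
  have vl : limit (τ == δ) s o v = sideLimit τ δ s o u := by rw [limit, sideLimit, w9, v14]
  clear_value v
  refine (runs_takeNext (b := τ == δ) (σ := σ) (A := A) (R := R) v0 v1 v9 v15
    (by rw [v4, cv, h4]) (by rw [v4]; exact hA) (by rw [v10]; exact hbp) hpN hW
    (by rw [v10, cv]; exact hh) (by rw [v10, cv, vl]; exact hinv)).mono ?_
  rintro t x ⟨kx, x15, x10, px, hx, ix, lx, x14, ht⟩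
  rw [vl, v4] at lx
  rw [v4] at ix
  rw [v10] at ht
  rw [cv] at px
  have kux := kv.trans (kx.mono (ws' := [9, 10, 11, 12, 14, 15, ptrReg δ, sizeReg δ, flagReg δ])
    (es' := [5, 6, 7, 8, 9, limReg δ]) (by simp) (by simp))
  obtain ⟨n1, n2, n3⟩ : sizeReg δ ≠ 14 ∧ sizeReg δ ≠ 15 ∧ flagReg δ ≠ 15 := by
    cases δ <;> decide
  refine runs_seq (runs_assign (by simp only [WordExpr.eval]; omega) ?_)
  refine runs_seq (runs_assign (by simp [WordExpr.eval, n1.symm]; omega) ?_)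
  refine runs_seq (runs_assign (by simp [WordExpr.eval, n2.symm, n3.symm]; omega) (runs_copy ?_))
  set y : State N 16 := { x with word := _, elem := _ } with hy
  have ky : Keeps [9, 10, 11, 12, 14, 15, ptrReg δ, sizeReg δ, flagReg δ]
      [5, 6, 7, 8, 9, limReg δ] u y := by
    refine ⟨fun i hi => ?_, fun r hr => ?_, kux.out⟩
    · rw [← kux.word i hi]; simp at hi; simp [hy, hi]
    · rw [← kux.elem r hr]; simp at hr; simp [hy, hr]
  have cy : cell y = cell x := rfl
  have yp : y.word (ptrReg δ) = ptr + 1 := by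
    rw [← x15]; cases δ <;> simp [hy, WordExpr.eval, ptrReg, sizeReg, flagReg]
  have ys : y.word (sizeReg δ) = x.word 10 := by
    cases δ <;> simp [hy, WordExpr.eval, ptrReg, sizeReg, flagReg]
  have yf : y.word (flagReg δ) = x.word 14 := by
    cases δ <;> simp [hy, WordExpr.eval, ptrReg, sizeReg, flagReg]
  have yl : y.elem (limReg δ) = x.elem 9 := by simp [hy]
  have hl : sideLimit τ δ s o y = limit (τ == δ) s o x := by rw [limit, sideLimit, yl, yf]
  clear_value y
  rw [ys, yf, cy, hl]
  exact ⟨ky, yp, x10, px, hx, ix, lx, by omega, by omega⟩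

end SidesOfSweep

/-! ### The invariant of the sweep and the boxes it reports -/

section Sweep

variable {N W : ℕ} {P : Color → Finset Plane} {s o : Elem} {τ σ : Bool} {B : ℕ → Elem} {M : ℕ}

/-- The rectangle `out` has its colour and contains at least `best` points of this colour. -/
def Achieves (P : Color → Finset Plane) (best : ℕ)
    (out : Option (Color × Plane × Plane × Plane)) : Prop :=
  ∃ col c v w, out = some (col, c, v, w) ∧ v ≠ 0 ∧ w ≠ 0 ∧ inner ℝ v w = 0 ∧
    IsColoredRectangle P col (spanned c v w) ∧ best ≤ rectangleSize P col (spanned c v w)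

def leftExpr (τ : Bool) : RealExpr 16 :=
  .sub (realConst 0) (.add (alongExpr (!τ) 2) (.ofWord (.reg 7)))

def widthExpr (τ : Bool) : RealExpr 16 :=
  .sub (.add (alongExpr τ 3) (.ofWord (.reg 8))) (leftExpr τ)

/-- Put out the current box with height `h` if the number `n` of its points beats register 1. -/
def consider (τ σ : Bool) (h : RealExpr 16) (n : WordExpr 16) : Program 16 :=
  .branch (wordLT (.reg 1) n)
    (.seq (.assign 1 n)
      (.branch (.isRed 0)
        (.output .red (cornerExpr τ (leftExpr τ)) (alongVecExpr τ (widthExpr τ))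
          (heightVecExpr σ h))
        (.output .blue (cornerExpr τ (leftExpr τ)) (alongVecExpr τ (widthExpr τ))
          (heightVecExpr σ h))))
    .skip

theorem eval_leftExpr {u : State N 16} (h0 : u.elem 0 = s) (h1 : u.elem 1 = o) :
    (leftExpr τ).eval u = -sideLimit τ false s o u := by
  cases τ <;> simp [leftExpr, RealExpr.eval, eval_alongExpr, h0, h1, sideLimit, limReg, flagReg,
    WordExpr.eval, realConst]

theorem eval_widthExpr {u : State N 16} (h0 : u.elem 0 = s) (h1 : u.elem 1 = o) :
    (widthExpr τ).eval u = sideLimit τ true s o u - -sideLimit τ false s o u := by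
  rw [widthExpr, RealExpr.eval, eval_leftExpr h0 h1]
  cases τ <;> simp [RealExpr.eval, eval_alongExpr, h0, h1, sideLimit, limReg, flagReg,
    WordExpr.eval]

/-- Register 1 is overwritten before the height is evaluated, so the height expression must not
depend on that register. -/
theorem runs_consider {u : State N 16} {h : RealExpr 16} {n : WordExpr 16} (h0 : u.elem 0 = s)
    (h1 : u.elem 1 = o) (hW : n.eval u ≤ W)
    (hh : ∀ x, h.eval { u with word := Function.update u.word 1 x } = h.eval u) :
    Runs W (consider τ σ h n) u fun t v => v.arr = u.arr ∧ v.elem = u.elem ∧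
      (∀ i, i ≠ 1 → v.word i = u.word i) ∧ n.eval u ≤ v.word 1 ∧ u.word 1 ≤ v.word 1 ∧
      ((v.word 1 = u.word 1 ∧ v.out = u.out) ∨ (v.word 1 = n.eval u ∧
        v.out = some (s.1, cornerPt τ s.2 o.2 (-sideLimit τ false s o u),
          alongVec τ s.2 o.2 (sideLimit τ true s o u - -sideLimit τ false s o u),
          heightVec σ s.2 o.2 (h.eval u)))) ∧ t ≤ 4 := by
  refine runs_branch (fun hT => ?_) (fun hT => runs_skip ?_) <;>
    simp only [holds_wordLT, WordExpr.eval] at hT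
  · refine runs_seq (runs_assign hW ?_)
    set v : State N 16 := { u with word := _ } with hv
    have w1 : v.word 1 = n.eval u := by simp [hv]
    have wi : ∀ i, i ≠ 1 → v.word i = u.word i := fun i hi => by simp [hv, hi]
    have hhv : h.eval v = h.eval u := hh _
    have l1 : ∀ δ, sideLimit τ δ s o v = sideLimit τ δ s o u := by
      intro δ; cases δ <;> simp [sideLimit, hv, flagReg]
    have e0 : v.elem 0 = s := h0
    have e1 : v.elem 1 = o := h1
    have ea : v.arr = u.arr := rfl
    have ee : v.elem = u.elem := rfl
    clear_value v
    refine runs_branch (fun hR => runs_output ?_) (fun hR => runs_output ?_) <;>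
      simp only [Test.Holds, e0] at hR
    · refine ⟨ea, ee, wi, w1.ge, by simp only [w1]; omega, Or.inr ⟨w1, ?_⟩, by omega⟩
      simp only [eval_cornerExpr, eval_alongVecExpr, eval_heightVecExpr, eval_leftExpr e0 e1,
        eval_widthExpr e0 e1, e0, e1, l1, hhv, hR]
    · have hR' : s.1 = Color.blue := by
        cases hs : s.1
        · exact absurd hs hR
        · rfl
      refine ⟨ea, ee, wi, w1.ge, by simp only [w1]; omega, Or.inr ⟨w1, ?_⟩, by omega⟩
      simp only [eval_cornerExpr, eval_alongVecExpr, eval_heightVecExpr, eval_leftExpr e0 e1,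
        eval_widthExpr e0 e1, e0, e1, l1, hhv, hR']
  · exact ⟨rfl, rfl, fun _ _ => rfl, by omega, le_rfl, Or.inl ⟨rfl, rfl⟩, by omega⟩

/-- The situation in which the sweep for the pair `s`, `o` is started: the array `B` is sorted, and
`M` is the number of points on the left of `s`. -/
structure SweepCtx (N : ℕ) (P : Color → Finset Plane) (s o : Elem) (τ σ : Bool) (B : ℕ → Elem)
    (M : ℕ) : Prop where
  mem_s : s.2 ∈ P s.1
  color : s.1 ≠ o.1
  point : s.2 ≠ o.2
  mem_iff : ∀ e : Elem, e.2 ∈ P e.1 ↔ ∃ i < N, B i = e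
  inj : Set.InjOn B (Set.Iio N)
  line : ∀ e : Elem, e.2 ∈ P e.1 → height σ s.2 o.2 e.2 = 0 → e = s ∨ e = o
  M_lt : M < N
  left : ∀ i < M, along τ s.2 o.2 (B i).2 < 0
  right : ∀ i, M ≤ i → i < N → 0 ≤ along τ s.2 o.2 (B i).2
  sorted : ∀ δ i j, lo M δ ≤ i → i < j → j < hi N M δ →
    eventKey σ s o (B i) ≤ eventKey σ s o (B j)

/-- A set of points of the colour of `s`, on one side of the base line, such that no obstacle lies
in the open bounding box. -/
structure IsConfig (P : Color → Finset Plane) (s o : Elem) (τ σ : Bool) (T : Finset Elem) :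
    Prop where
  sub : ∀ e ∈ T, e.2 ∈ P e.1 ∧ e.1 = s.1 ∧ 0 ≤ height σ s.2 o.2 e.2
  empty : ∀ q : Elem, q.2 ∈ P q.1 → q.1 ≠ s.1 → 0 < height σ s.2 o.2 q.2 →
    (∃ p ∈ T, height σ s.2 o.2 q.2 < height σ s.2 o.2 p.2) → ∀ e ∈ T,
      (along τ s.2 o.2 q.2 < 0 → along τ s.2 o.2 q.2 ≤ along τ s.2 o.2 e.2) ∧
      (0 ≤ along τ s.2 o.2 q.2 → along τ s.2 o.2 e.2 ≤ along τ s.2 o.2 q.2)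

/-- The points that the sweep has passed on one side. -/
def passed (B : ℕ → Elem) (M : ℕ) (u : State N 16) (δ : Bool) : Set Elem :=
  block B (lo M δ) (u.word (ptrReg δ))

/-- The content of the heap of one side. -/
def heapSet (M : ℕ) (u : State N 16) (δ : Bool) : Set Elem :=
  block (cell u) (lo M δ) (lo M δ + u.word (sizeReg δ))

/-- The invariant of the sweep, except for the completeness of the search. -/
structure SweepInv (N : ℕ) (P : Color → Finset Plane) (s o : Elem) (τ σ : Bool) (B : ℕ → Elem)
    (M q best : ℕ) (u : State N 16) : Prop where
  e0 : u.elem 0 = s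
  e1 : u.elem 1 = o
  w0 : u.word 0 = q
  w2 : u.word 2 = M
  flag : ∀ δ, u.word (flagReg δ) ≤ 1
  size_le : ∀ δ, lo M δ + u.word (sizeReg δ) ≤ u.word (ptrReg δ)
  ptr_le : ∀ δ, u.word (ptrReg δ) ≤ hi N M δ
  rest : ∀ δ i, u.word (ptrReg δ) ≤ i → i < hi N M δ → cell u i = B i
  perm : PermOn 0 N B (cell u)
  heap : ∀ δ, IsHeap (fun i => along (τ == δ) s.2 o.2 (cell u (lo M δ + i)).2) (u.word (sizeReg δ))
  side : ∀ δ, SideInv (τ == δ) σ s o {e | e.2 ∈ P e.1} (passed B M u δ) (heapSet M u δ)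
    (sideLimit τ δ s o u)
  left : 0 < sideLimit τ false s o u
  right : 0 ≤ sideLimit τ true s o u
  order : ∀ δ δ' i j, lo M δ ≤ i → i < u.word (ptrReg δ) → u.word (ptrReg δ') ≤ j → j < hi N M δ' →
    eventKey σ s o (B i) ≤ eventKey σ s o (B j)
  best_le : best ≤ u.word 1
  good : u.word 1 = 0 ∨ Achieves P (u.word 1) u.out

/-- The sweep has found the sizes of all configurations among the points it has passed. -/
def SweepComplete (P : Color → Finset Plane) (s o : Elem) (τ σ : Bool) (B : ℕ → Elem)
    (M : ℕ) (u : State N 16) : Prop :=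
  ∀ T : Finset Elem, IsConfig P s o τ σ T → 1 < T.card →
    (∀ e ∈ T, e = s ∨ ∃ δ, e ∈ passed B M u δ) → T.card ≤ u.word 1

/-- Elements of one colour are determined by their points, so passing to the points loses nothing.
-/
theorem card_le_rectangleSize {U : Set Plane} {col : Color} {F : Finset Elem}
    (hF : ∀ e ∈ F, e.1 = col ∧ e.2 ∈ P col ∧ e.2 ∈ U) : F.card ≤ rectangleSize P col U := by
  classical
  have hinj : Set.InjOn Prod.snd (F : Set Elem) := by
    intro e he e' he' h
    exact Prod.ext ((hF e he).1.trans (hF e' he').1.symm) h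
  rw [← Finset.card_image_of_injOn hinj, ← Set.ncard_coe_finset]
  refine Set.ncard_le_ncard ?_ ((P col).finite_toSet.subset fun p hp => hp.1)
  intro p hp
  rw [Finset.mem_coe, Finset.mem_image] at hp
  obtain ⟨e, he, rfl⟩ := hp
  exact ⟨(hF e he).2.1, (hF e he).2.2⟩

theorem along_beq_false (τ : Bool) (s o p : Plane) : along (τ == false) s o p = -along τ s o p := by
  rw [← along_not]; cases τ <;> rfl

theorem along_beq_true (τ : Bool) (s o p : Plane) : along (τ == true) s o p = along τ s o p := by
  cases τ <;> rfl

theorem height_self (σ : Bool) (s o : Plane) : height σ s o s = 0 := by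
  cases σ <;> simp [height, signed]

theorem along_self (τ : Bool) (s o : Plane) : along τ s o s = 0 := by
  cases τ <;> simp [along, signed]

variable {q best : ℕ} {u : State N 16}

/-- The points in the heaps, as a finite set. -/
noncomputable def heapFinset (M : ℕ) (u : State N 16) : Finset Elem := by
  classical exact (Finset.range (u.word (sizeReg false))).image (cell u) ∪
    (Finset.Ico M (M + u.word (sizeReg true))).image (cell u)

theorem mem_heapFinset {e : Elem} : e ∈ heapFinset M u ↔ ∃ δ, e ∈ heapSet M u δ := by
  simp [heapFinset, heapSet, block, lo]

theorem card_heapFinset_le :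
    (heapFinset M u).card ≤ u.word (sizeReg false) + u.word (sizeReg true) := by
  classical
  refine (Finset.card_union_le _ _).trans ?_
  gcongr
  · exact Finset.card_image_le.trans (by simp)
  · exact Finset.card_image_le.trans (by simp)

/-- The left heap lies in positions below `M` and the right one in positions from `M` on, and the
array has no repetitions; so the two sizes add up. -/
theorem card_heapFinset (ctx : SweepCtx N P s o τ σ B M) (inv : SweepInv N P s o τ σ B M q best u) :
    (heapFinset M u).card = u.word (sizeReg false) + u.word (sizeReg true) := by
  classical
  have h1 := inv.size_le false
  have h2 := inv.ptr_le false
  have h3 := inv.size_le true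
  have h4 := inv.ptr_le true
  simp only [lo, hi] at h1 h2 h3 h4
  have hinj := inv.perm.injOn le_rfl ctx.inj
  have hM := ctx.M_lt
  have : heapFinset M u = (Finset.range (u.word (sizeReg false)) ∪
      Finset.Ico M (M + u.word (sizeReg true))).image (cell u) := by
    rw [Finset.image_union]; rfl
  rw [this, Finset.card_image_of_injOn, Finset.card_union_of_disjoint]
  · simp
  · rw [Finset.disjoint_left]
    intro i hi hi'
    simp at hi hi'
    omega
  · refine hinj.mono fun i hi => ?_
    simp at hi ⊢
    omega

/-- The current box is a rectangle of the colour of `s`, and it contains the points in the heaps if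
they are not above it. -/
theorem achieves_box (ctx : SweepCtx N P s o τ σ B M) (inv : SweepInv N P s o τ σ B M q best u)
    {h : ℝ} (hh : 0 < h)
    (hobs : ∀ e : Elem, e.2 ∈ P e.1 → e.1 ≠ s.1 → 0 < height σ s.2 o.2 e.2 →
      height σ s.2 o.2 e.2 < h → ∃ δ, e ∈ passed B M u δ) {cnt : ℕ}
    (hcnt : cnt ≤ 1 ∨ cnt = 1 + u.word (sizeReg false) + u.word (sizeReg true) ∧
      ∀ δ, ∀ e ∈ passed B M u δ, height σ s.2 o.2 e.2 ≤ h) :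
    Achieves P cnt (some (s.1, cornerPt τ s.2 o.2 (-sideLimit τ false s o u),
          alongVec τ s.2 o.2 (sideLimit τ true s o u - -sideLimit τ false s o u),
          heightVec σ s.2 o.2 h)) := by
  classical
  have hl := inv.left
  have hr := inv.right
  have hlr : -sideLimit τ false s o u < sideLimit τ true s o u := by linarith
  refine ⟨_, _, _, _, rfl, alongVec_ne_zero ctx.point (by linarith),
    heightVec_ne_zero ctx.point hh, inner_alongVec_heightVec .., ⟨⟨_, _, _,
      alongVec_ne_zero ctx.point (by linarith), heightVec_ne_zero ctx.point hh,
      inner_alongVec_heightVec .., rfl⟩, ?_⟩, ?_⟩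
  -- A point of the other colour in the open box is above the base and below `h`, hence passed; then
  -- its distance is at least the limit of its side, which keeps it out of the open box.
  · intro p hp hint
    change p ∈ interior (box τ σ s.2 o.2 _ _ h) at hint
    rw [mem_interior_box_iff ctx.point hlr hh] at hint
    obtain ⟨⟨h1, h2⟩, h3, h4⟩ := hint
    have hne : s.1.other ≠ s.1 := by cases s.1 <;> simp [Color.other]
    obtain ⟨δ, hδ⟩ := hobs (s.1.other, p) hp hne h3 h4
    have := (inv.side δ).lim_le (s.1.other, p) ⟨hδ, hne, h3⟩
    cases δ
    · rw [along_beq_false] at this; linarith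
    · rw [along_beq_true] at this; linarith
  · have hs : s.2 ∈ box τ σ s.2 o.2 (-sideLimit τ false s o u) (sideLimit τ true s o u) h := by
      rw [mem_box_iff ctx.point hlr hh, along_self, height_self]
      exact ⟨⟨by linarith, hr⟩, le_rfl, hh.le⟩
    -- A count of at most one is certified by `s` alone; otherwise `s` and the two heaps are
    -- counted.
    rcases hcnt with hcnt | ⟨hcnt, hle⟩
    · refine hcnt.trans ?_
      have := card_le_rectangleSize (P := P) (U := box τ σ s.2 o.2 (-sideLimit τ false s o u)
        (sideLimit τ true s o u) h) (col := s.1) (F := {s})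
        (by simpa using ⟨ctx.mem_s, hs⟩)
      rwa [Finset.card_singleton] at this
    · have hmem : ∀ δ, ∀ e ∈ heapSet M u δ, e ∈ alive (τ == δ) σ s o (passed B M u δ) := by
        intro δ e he
        rwa [(inv.side δ).heap] at he
      have hsn : s ∉ heapFinset M u := by
        rw [mem_heapFinset]
        rintro ⟨δ, hδ⟩
        have := (hmem δ s hδ).2.2.1
        rw [height_self] at this
        exact lt_irrefl _ this
      have hcard : (insert s (heapFinset M u)).card = cnt := by
        rw [Finset.card_insert_of_notMem hsn, card_heapFinset ctx inv, hcnt]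
        omega
      rw [← hcard]
      refine card_le_rectangleSize (U := box τ σ s.2 o.2 _ _ h) fun e he => ?_
      rw [Finset.mem_insert, mem_heapFinset] at he
      rcases he with rfl | ⟨δ, hδ⟩
      · exact ⟨rfl, ctx.mem_s, hs⟩
      · obtain ⟨m1, m2, m3, m4⟩ := hmem δ e hδ
        have hP : e.2 ∈ P e.1 := (inv.side δ).sub m1
        have hlim := (inv.side δ).le_lim e hP m4
        refine ⟨m2, m2 ▸ hP, ?_⟩
        rw [mem_box_iff ctx.point hlr hh]
        have hB : ∃ i, (lo M δ ≤ i ∧ i < u.word (ptrReg δ)) ∧ B i = e := m1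
        obtain ⟨i, ⟨hi1, hi2⟩, hBi⟩ := hB
        have hi3 := inv.ptr_le δ
        refine ⟨?_, m3.le, hle δ e m1⟩
        cases δ
        · rw [along_beq_false] at hlim
          have := ctx.left i (by simp only [hi] at hi3; omega)
          rw [hBi] at this
          exact ⟨by linarith, by linarith⟩
        · rw [along_beq_true] at hlim
          have := ctx.right i hi1 (by simp only [hi] at hi3; omega)
          rw [hBi] at this
          exact ⟨by linarith, by linarith⟩

end Sweep

/-! ### One step of the sweep, and completeness of the search -/

section SweepStep

variable {N W : ℕ} {P : Color → Finset Plane} {s o : Elem} {τ σ : Bool} {B : ℕ → Elem} {M : ℕ}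
  {q best : ℕ} {u v : State N 16}

/-- The invariant depends only on the array, element registers 0 to 3 and the integer registers
other than 1, apart from its two clauses on the best rectangle. -/
theorem SweepInv.congr (inv : SweepInv N P s o τ σ B M q best u) (ha : v.arr = u.arr)
    (he : ∀ r, r = 0 ∨ r = 1 ∨ r = 2 ∨ r = 3 → v.elem r = u.elem r)
    (hw : ∀ i, i ≠ 1 → v.word i = u.word i) (hb : best ≤ v.word 1)
    (hg : v.word 1 = 0 ∨ Achieves P (v.word 1) v.out) : SweepInv N P s o τ σ B M q best v := by
  have hc := cell_congr ha
  have hp : ∀ δ, v.word (ptrReg δ) = u.word (ptrReg δ) := fun δ => hw _ (by cases δ <;> decide)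
  have hs : ∀ δ, v.word (sizeReg δ) = u.word (sizeReg δ) := fun δ => hw _ (by cases δ <;> decide)
  have hf : ∀ δ, v.word (flagReg δ) = u.word (flagReg δ) := fun δ => hw _ (by cases δ <;> decide)
  have hl : ∀ δ, sideLimit τ δ s o v = sideLimit τ δ s o u := fun δ => by
    rw [sideLimit, sideLimit, hf, he _ (by cases δ <;> simp [limReg])]
  refine ⟨by rw [he 0 (by simp), inv.e0], by rw [he 1 (by simp), inv.e1],
    by rw [hw 0 (by decide), inv.w0], by rw [hw 2 (by decide), inv.w2], ?_, ?_, ?_, ?_, ?_, ?_, ?_,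
    ?_, ?_, ?_, hb, hg⟩
  · simpa only [hf] using inv.flag
  · simpa only [hs, hp] using inv.size_le
  · simpa only [hp] using inv.ptr_le
  · simpa only [hp, hc] using inv.rest
  · simpa only [hc] using inv.perm
  · simpa only [hc, hs] using inv.heap
  · simpa only [passed, heapSet, hc, hs, hp, hl] using inv.side
  · simpa only [hl] using inv.left
  · simpa only [hl] using inv.right
  · simpa only [hp] using inv.order

theorem height_le_of_eventKey_le {e e' : Elem} (h : eventKey σ s o e ≤ eventKey σ s o e') :
    height σ s.2 o.2 e.2 ≤ height σ s.2 o.2 e'.2 := by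
  rw [eventKey, eventKey, Prod.Lex.toLex_le_toLex] at h
  rcases h with h | h
  · exact h.le
  · exact h.1.le

/-- This is the purpose of the tie-break: at equal height the points of the colour of `s` come
first, so an obstacle on the top side of a box is handled too late to remove a point of that side.
-/
theorem height_lt_of_eventKey_le {e e' : Elem} (h : eventKey σ s o e ≤ eventKey σ s o e')
    (he : e.1 ≠ s.1) (he' : e'.1 = s.1) : height σ s.2 o.2 e.2 < height σ s.2 o.2 e'.2 := by
  rw [eventKey, eventKey, Prod.Lex.toLex_le_toLex] at h
  rcases h with h | h
  · exact h
  · simp [he, he'] at h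

theorem exists_side {i : ℕ} (hi' : i < N) :
    ∃ δ, lo M δ ≤ i ∧ i < hi N M δ := by
  by_cases h : i < M
  · exact ⟨false, Nat.zero_le _, h⟩
  · exact ⟨true, not_lt.mp h, hi'⟩

theorem hi_le (ctx : SweepCtx N P s o τ σ B M) (δ : Bool) : hi N M δ ≤ N := by
  have := ctx.M_lt
  cases δ <;> simp only [hi] <;> omega

/-- The work on side `δ` touches only the registers and the array block of that side, so the other
side keeps its invariant. The choice of a least next element keeps every passed element before every
remaining one. -/
theorem runs_takeSide_inv (ctx : SweepCtx N P s o τ σ B M)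
    (inv : SweepInv N P s o τ σ B M q best u) (δ : Bool) (hδ : u.word (ptrReg δ) < hi N M δ)
    (h4 : u.elem 4 = B (u.word (ptrReg δ)))
    (hmin : ∀ δ' j, u.word (ptrReg δ') ≤ j → j < hi N M δ' →
      eventKey σ s o (B (u.word (ptrReg δ))) ≤ eventKey σ s o (B j)) (hW : N + 1 ≤ W) :
    Runs W (takeSide τ σ δ) u fun t v => SweepInv N P s o τ σ B M q best v ∧
      v.word 1 = u.word 1 ∧ v.elem 4 = u.elem 4 ∧
      v.word (ptrReg δ) = u.word (ptrReg δ) + 1 ∧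
      v.word (ptrReg (!δ)) = u.word (ptrReg (!δ)) ∧
      t + 30 * (Nat.log 2 N + 1) * (v.word (sizeReg δ) + v.word (sizeReg (!δ))) ≤
        30 * (Nat.log 2 N + 1) * (u.word (sizeReg δ) + u.word (sizeReg (!δ))) +
          60 * (Nat.log 2 N + 1) + 9 := by
  have hN := hi_le ctx δ
  have hMN := ctx.M_lt
  set ptr := u.word (ptrReg δ) with hptr
  have hlp : lo M δ ≤ ptr := (Nat.le_add_right _ _).trans (inv.size_le δ)
  have hcur : cell u ptr = B ptr := inv.rest δ ptr le_rfl hδ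
  have hmemB : (B ptr).2 ∈ P (B ptr).1 := (ctx.mem_iff _).mpr ⟨ptr, by omega, rfl⟩
  have hfl := inv.flag δ
  refine (runs_takeSide (τ := τ) (σ := σ) (A := {e | e.2 ∈ P e.1}) (R := passed B M u δ) δ inv.e0
    inv.e1 inv.w2 hptr.symm (by rw [h4, hcur]) (by rw [h4]; exact hmemB) (inv.size_le δ) (by omega)
    (by omega) (by omega) (inv.heap δ) (inv.side δ)).mono ?_
  rintro t v ⟨k, vp, vs, pv, hv, iv, lv, fv, ht⟩
  have other : ∀ δ', δ' ≠ δ → v.word (ptrReg δ') = u.word (ptrReg δ') ∧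
      v.word (sizeReg δ') = u.word (sizeReg δ') ∧ v.word (flagReg δ') = u.word (flagReg δ') ∧
      v.elem (limReg δ') = u.elem (limReg δ') := by
    intro δ' hne
    refine ⟨k.word _ ?_, k.word _ ?_, k.word _ ?_, k.elem _ ?_⟩ <;> cases δ <;> cases δ' <;>
      first | exact absurd rfl hne | decide
  have hcell : ∀ δ', δ' ≠ δ → ∀ i, lo M δ' ≤ i → i < hi N M δ' → cell v i = cell u i := by
    intro δ' hne i h1 h2
    refine pv.eq_outside ?_
    cases δ <;> cases δ' <;> first | exact absurd rfl hne | (simp only [lo, hi] at *; omega)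
  have hlim : ∀ δ', δ' ≠ δ → sideLimit τ δ' s o v = sideLimit τ δ' s o u := fun δ' hne => by
    rw [sideLimit, sideLimit, (other δ' hne).2.2.1, (other δ' hne).2.2.2]
  have hpassed : passed B M v δ = insert (B ptr) (passed B M u δ) := by
    rw [passed, vp, block_succ _ hlp, passed]
  rw [h4] at iv lv
  have hw : ∀ i : Fin 16, i = 0 ∨ i = 1 ∨ i = 2 → v.word i = u.word i := by
    intro i hi
    refine k.word i ?_
    rcases hi with rfl | rfl | rfl <;> cases δ <;> decide
  have he : ∀ i : Fin 16, i = 0 ∨ i = 1 ∨ i = 4 → v.elem i = u.elem i := by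
    intro i hi
    refine k.elem i ?_
    rcases hi with rfl | rfl | rfl <;> cases δ <;> decide
  refine ⟨⟨by rw [he 0 (by simp), inv.e0], by rw [he 1 (by simp), inv.e1],
    by rw [hw 0 (by simp), inv.w0], by rw [hw 2 (by simp), inv.w2], ?_, ?_, ?_, ?_, ?_, ?_, ?_,
    ?_, ?_, ?_, by rw [hw 1 (by simp)]; exact inv.best_le,
    by rw [hw 1 (by simp), k.out]; exact inv.good⟩, hw 1 (by simp), he 4 (by simp), vp,
    (other (!δ) (by cases δ <;> decide)).1, ?_⟩
  · intro δ'
    by_cases hne : δ' = δ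
    · subst hne; omega
    · rw [(other δ' hne).2.2.1]; exact inv.flag δ'
  · intro δ'
    by_cases hne : δ' = δ
    · subst hne; rw [vp]; exact vs
    · rw [(other δ' hne).1, (other δ' hne).2.1]; exact inv.size_le δ'
  · intro δ'
    by_cases hne : δ' = δ
    · subst hne; rw [vp]; omega
    · rw [(other δ' hne).1]; exact inv.ptr_le δ'
  · intro δ' i h1 h2
    by_cases hne : δ' = δ
    · subst hne
      rw [vp] at h1
      rw [pv.eq_outside (by omega)]
      exact inv.rest δ' i (by omega) h2
    · rw [(other δ' hne).1] at h1
      have := inv.size_le δ'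
      rw [hcell δ' hne i (by omega) h2]
      exact inv.rest δ' i h1 h2
  · exact inv.perm.trans (pv.mono (Nat.zero_le _) (by omega))
  · intro δ'
    by_cases hne : δ' = δ
    · subst hne; exact hv
    · rw [(other δ' hne).2.1]
      have h1 := inv.size_le δ'
      have h2 := inv.ptr_le δ'
      intro i hi0 hi1
      simp only
      rw [hcell δ' hne _ (by omega) (by omega), hcell δ' hne _ (by omega) (by omega)]
      exact inv.heap δ' i hi0 hi1
  · intro δ'
    by_cases hne : δ' = δ
    · subst hne; rw [hpassed]; exact iv
    · have h1 := inv.size_le δ'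
      have h2 := inv.ptr_le δ'
      have e : heapSet M v δ' = heapSet M u δ' := by
        rw [heapSet, heapSet, (other δ' hne).2.1]
        exact block_congr fun i hi0 hi1 => hcell δ' hne i hi0 (by omega)
      have := inv.side δ'
      rwa [← e, passed, ← (other δ' hne).1, ← hlim δ' hne] at this
  · by_cases hne : false = δ
    · subst hne
      rcases lv with lv | lv
      · rw [lv]; exact inv.left
      · have := ctx.left ptr hδ
        rw [lv, along_beq_false]; linarith
    · rw [hlim _ hne]; exact inv.left
  · by_cases hne : true = δ
    · subst hne
      rcases lv with lv | lv
      · rw [lv]; exact inv.right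
      · have := ctx.right ptr hlp hδ
        rw [lv, along_beq_true]; linarith
    · rw [hlim _ hne]; exact inv.right
  · intro δ₁ δ₂ i j h1 h2 g3 g4
    have h3' : u.word (ptrReg δ₂) ≤ j := by
      by_cases hne : δ₂ = δ
      · subst hne; omega
      · rwa [(other δ₂ hne).1] at g3
    by_cases hne : δ₁ = δ
    · subst hne
      rw [vp] at h2
      rcases Nat.lt_succ_iff_lt_or_eq.mp h2 with h5 | rfl
      · exact inv.order _ _ i j h1 h5 h3' g4
      · exact hmin δ₂ j h3' g4
    · rw [(other δ₁ hne).1] at h2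
      exact inv.order _ _ i j h1 h2 h3' g4
  · have e : ∀ a b : ℕ, 30 * (Nat.log 2 N + 1) * (a + b) =
        30 * (Nat.log 2 N + 1) * a + 30 * (Nat.log 2 N + 1) * b := fun a b => by ring
    rw [(other (!δ) (by cases δ <;> decide)).2.1, e, e]
    omega

def sizesExpr : WordExpr 16 := .add (.const 1) (.add (.reg 5) (.reg 6))

/-- Handle the next element of one side, and consider the box below it. -/
def sweepStep (τ σ δ : Bool) : Program 16 :=
  .seq (takeSide τ σ δ) <|
  .branch (realLT (realConst 0) (heightExpr σ 4)) (consider τ σ (heightExpr σ 4) sizesExpr) .skip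

/-- A configuration that uses the new element `cur` has it as a last point in the order of the
sweep. All passed obstacles are then strictly lower than `cur`, so `IsConfig.empty` applies to them
and every point of the configuration other than `s` is still in a heap. A configuration without
`cur` was covered before. -/
theorem SweepComplete.step (ctx : SweepCtx N P s o τ σ B M)
    (inv : SweepInv N P s o τ σ B M q best u) (comp : SweepComplete P s o τ σ B M u)
    {q' best' : ℕ} (inv' : SweepInv N P s o τ σ B M q' best' v) (δ : Bool)
    (hδ : u.word (ptrReg δ) < hi N M δ)
    (hp : v.word (ptrReg δ) = u.word (ptrReg δ) + 1)
    (hp' : v.word (ptrReg (!δ)) = u.word (ptrReg (!δ))) (h1 : u.word 1 ≤ v.word 1)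
    (hsize : 0 < height σ s.2 o.2 (B (u.word (ptrReg δ))).2 →
      1 + (v.word (sizeReg false) + v.word (sizeReg true)) ≤ v.word 1) :
    SweepComplete P s o τ σ B M v := by
  classical
  intro T hT hcard hsub
  set cur := B (u.word (ptrReg δ)) with hcur
  have hlp : lo M δ ≤ u.word (ptrReg δ) := (Nat.le_add_right _ _).trans (inv.size_le δ)
  have hpassed : ∀ δ', passed B M v δ' ⊆ insert cur (passed B M u δ') := by
    intro δ'
    by_cases hne : δ' = δ
    · subst hne; rw [passed, hp, block_succ _ hlp, passed]
    · have : δ' = !δ := by cases δ <;> cases δ' <;> simp_all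
      subst this
      rw [passed, hp', passed]
      exact Set.subset_insert _ _
  by_cases hc : cur ∈ T ∧ cur ≠ s
  -- The base line carries only `s` and `o`, and `o` has the other colour.
  · have hpos : ∀ e ∈ T, e ≠ s → 0 < height σ s.2 o.2 e.2 := by
      intro e he hes
      obtain ⟨m1, m2, m3⟩ := hT.sub e he
      refine lt_of_le_of_ne m3 fun h0 => ?_
      rcases ctx.line e m1 h0.symm with rfl | rfl
      · exact hes rfl
      · exact ctx.color m2.symm
    have hT' : T ⊆ insert s (heapFinset M v) := by
      intro e he
      rw [Finset.mem_insert, mem_heapFinset]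
      by_cases hes : e = s
      · exact Or.inl hes
      · obtain ⟨δ', hδ'⟩ := (hsub e he).resolve_left hes
        refine Or.inr ⟨δ', ?_⟩
        rw [(inv'.side δ').heap]
        obtain ⟨m1, m2, m3⟩ := hT.sub e he
        refine ⟨hδ', m2, hpos e he hes, ?_⟩
        rintro r ⟨r1, r2, r3⟩
        -- The obstacle cannot be `cur`, which has the colour of `s`, so it was passed before this
        -- step.
        have hru : r ∈ passed B M u δ' := by
          rcases hpassed δ' r1 with rfl | h
          · exact absurd (hT.sub _ hc.1).2.1 r2
          · exact h
        obtain ⟨i, ⟨hi0, hi1⟩, rfl⟩ := hru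
        have hiN : i < hi N M δ' := lt_of_lt_of_le hi1 (inv.ptr_le δ')
        have hkey := inv.order δ' δ i _ hi0 hi1 le_rfl hδ
        have hlt := height_lt_of_eventKey_le hkey r2 (hT.sub _ hc.1).2.1
        have hem := hT.empty (B i)
          ((ctx.mem_iff _).mpr ⟨i, lt_of_lt_of_le hiN (hi_le ctx δ'), rfl⟩) r2 r3
          ⟨cur, hc.1, hlt⟩ e he
        cases δ'
        · rw [along_beq_false, along_beq_false]
          have := hem.1 (ctx.left i hiN)
          linarith
        · rw [along_beq_true, along_beq_true]
          exact hem.2 (ctx.right i hi0 hiN)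
    have c1 := (Finset.card_le_card hT').trans (Finset.card_insert_le _ _)
    have c2 := card_heapFinset_le (M := M) (u := v)
    have c3 := hsize (hpos cur hc.1 hc.2)
    omega
  · refine (comp T hT hcard fun e he => ?_).trans h1
    rcases hsub e he with h | ⟨δ', hδ'⟩
    · exact Or.inl h
    · rcases hpassed δ' hδ' with rfl | h
      · left
        by_contra hne
        exact hc ⟨he, hne⟩
      · exact Or.inr ⟨δ', h⟩

/-- The reported box has its top at the current element. Everything passed is at most that high, and
every strictly lower point has been passed, which are the two requirements of `achieves_box`. -/
theorem runs_sweepStep (ctx : SweepCtx N P s o τ σ B M)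
    (inv : SweepInv N P s o τ σ B M q best u) (comp : SweepComplete P s o τ σ B M u) (δ : Bool)
    (hδ : u.word (ptrReg δ) < hi N M δ) (h4 : u.elem 4 = B (u.word (ptrReg δ)))
    (hmin : ∀ δ' j, u.word (ptrReg δ') ≤ j → j < hi N M δ' →
      eventKey σ s o (B (u.word (ptrReg δ))) ≤ eventKey σ s o (B j)) (hW : N + 1 ≤ W) :
    Runs W (sweepStep τ σ δ) u fun t v => SweepInv N P s o τ σ B M q best v ∧
      SweepComplete P s o τ σ B M v ∧ 
      v.word 3 + v.word 4 = u.word 3 + u.word 4 + 1 ∧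
      t + 30 * (Nat.log 2 N + 1) * (v.word 5 + v.word 6) ≤
        30 * (Nat.log 2 N + 1) * (u.word 5 + u.word 6) + 60 * (Nat.log 2 N + 1) + 14 := by
  refine runs_seq ((runs_takeSide_inv ctx inv δ hδ h4 hmin hW).mono ?_)
  rintro t v ⟨iv, v1, v4, vp, vp', ht⟩
  have hsum : ∀ x : State N 16, x.word (sizeReg δ) + x.word (sizeReg (!δ)) = x.word 5 + x.word 6 :=
    fun x => by cases δ <;> simp [sizeReg, add_comm]
  have hsump : v.word 3 + v.word 4 = u.word 3 + u.word 4 + 1 := by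
    cases δ <;> simp [ptrReg] at vp vp' <;> omega
  rw [hsum, hsum] at ht
  have hcur : v.elem 4 = B (u.word (ptrReg δ)) := by rw [v4, h4]
  have hlp : lo M δ ≤ u.word (ptrReg δ) := (Nat.le_add_right _ _).trans (inv.size_le δ)
  refine runs_branch (fun hT => ?_) (fun hT => runs_skip ?_) <;>
    simp only [holds_realLT, eval_realConst, eval_heightExpr, iv.e0, iv.e1, hcur,
      Nat.cast_zero] at hT
  · have b1 := iv.size_le false
    have b2 := iv.ptr_le false
    have b3 := iv.size_le true
    have b4 := iv.ptr_le true
    simp only [lo, hi, sizeReg, ptrReg] at b1 b2 b3 b4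
    refine (runs_consider (τ := τ) (σ := σ) iv.e0 iv.e1 (n := sizesExpr)
      (by simp only [sizesExpr, WordExpr.eval]; omega)
      (fun x => by rw [eval_heightExpr, eval_heightExpr])).mono ?_
    rintro t' x ⟨xa, xe, xw, xn, xb, xo, ht'⟩
    have hpassed : ∀ δ', ∀ e ∈ passed B M v δ',
        eventKey σ s o e ≤ eventKey σ s o (B (u.word (ptrReg δ))) := by
      rintro δ' e ⟨i, ⟨hi0, hi1⟩, rfl⟩
      by_cases hne : δ' = δ
      · subst hne
        rw [vp] at hi1
        rcases Nat.lt_succ_iff_lt_or_eq.mp hi1 with h5 | rfl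
        · exact inv.order _ _ i _ hi0 h5 le_rfl hδ
        · exact le_rfl
      · have : δ' = !δ := by cases δ <;> cases δ' <;> simp_all
        subst this
        rw [vp'] at hi1
        exact inv.order _ _ i _ hi0 hi1 le_rfl hδ
    have ix : SweepInv N P s o τ σ B M q best x := by
      refine iv.congr xa (fun r _ => by rw [xe]) xw (iv.best_le.trans xb) ?_
      rcases xo with ⟨x1, xo⟩ | ⟨x1, xo⟩
      · rw [x1, xo]; exact iv.good
      · right
        rw [x1, xo, eval_heightExpr, iv.e0, iv.e1, hcur]
        refine achieves_box ctx iv hT ?_ (Or.inr ⟨?_, ?_⟩)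
        · intro e he hne hpos hlt
          obtain ⟨i, hiN, rfl⟩ := (ctx.mem_iff e).mp he
          obtain ⟨δ', h1, h2⟩ := exists_side (M := M) hiN
          refine ⟨δ', i, ⟨h1, ?_⟩, rfl⟩
          by_contra hge
          have := iv.order δ δ' (u.word (ptrReg δ)) i hlp (by omega) (not_lt.mp hge) h2
          exact absurd hlt (not_lt.mpr (height_le_of_eventKey_le this))
        · simp [sizesExpr, WordExpr.eval, sizeReg, add_assoc]
        · exact fun δ' e he => height_le_of_eventKey_le (hpassed δ' e he)
    have w3 := xw 3 (by decide)
    have w4 := xw 4 (by decide)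
    have w5 := xw 5 (by decide)
    have w6 := xw 6 (by decide)
    refine ⟨ix, ?_, by omega, ?_⟩
    · refine comp.step ctx inv ix δ hδ ?_ ?_ (by omega) fun _ => ?_
      · rw [xw _ (by cases δ <;> decide), vp]
      · rw [xw _ (by cases δ <;> decide), vp']
      · simp only [sizesExpr, WordExpr.eval] at xn
        simp only [sizeReg]
        omega
    · rw [w5, w6]; omega
  · refine ⟨iv, ?_, hsump, by omega⟩
    exact comp.step ctx inv iv δ hδ vp vp' v1.ge fun h => absurd h hT

/-- One step of the sweep: choose the lower one of the next elements of the two sides. -/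
def sweepBody (τ σ : Bool) : Program 16 :=
  .branch (wordLT (.reg 3) (.reg 2))
    (.seq (.load 4 (.reg 3))
      (.branch (wordLT (.reg 4) .len)
        (.seq (.load 8 (.reg 4))
          (.branch (eventLT σ 8 4) (.seq (.copy 4 8) (sweepStep τ σ true)) (sweepStep τ σ false)))
        (sweepStep τ σ false)))
    (.seq (.load 4 (.reg 4)) (sweepStep τ σ true))

def sweep (τ σ : Bool) : Program 16 :=
  .loop (orTest (wordLT (.reg 3) (.reg 2)) (wordLT (.reg 4) .len)) (sweepBody τ σ)

theorem SweepComplete.congr (h : SweepComplete P s o τ σ B M u) (hw : v.word = u.word) :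
    SweepComplete P s o τ σ B M v := by
  simpa only [SweepComplete, passed, hw] using h

theorem eventKey_le_of_side (ctx : SweepCtx N P s o τ σ B M) (δ : Bool) {i j : ℕ}
    (h1 : lo M δ ≤ i) (h2 : i ≤ j) (h3 : j < hi N M δ) :
    eventKey σ s o (B i) ≤ eventKey σ s o (B j) := by
  rcases h2.lt_or_eq with h | rfl
  · exact ctx.sorted δ i j h1 h h3
  · exact le_rfl

/-- Both sides are sorted, so the smaller of their first remaining elements is least among all
remaining ones. -/
theorem runs_sweepBody (ctx : SweepCtx N P s o τ σ B M)
    (inv : SweepInv N P s o τ σ B M q best u) (comp : SweepComplete P s o τ σ B M u)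
    (hlt : u.word 3 < M ∨ u.word 4 < N) (hW : N + 1 ≤ W) :
    Runs W (sweepBody τ σ) u fun t v => SweepInv N P s o τ σ B M q best v ∧
      SweepComplete P s o τ σ B M v ∧ 
      v.word 3 + v.word 4 = u.word 3 + u.word 4 + 1 ∧
      t + 30 * (Nat.log 2 N + 1) * (v.word 5 + v.word 6) ≤
        30 * (Nat.log 2 N + 1) * (u.word 5 + u.word 6) + 60 * (Nat.log 2 N + 1) + 20 := by
  have hMN := ctx.M_lt
  have hpl := inv.ptr_le false
  have hpr := inv.ptr_le true
  have hlr := inv.size_le true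
  simp only [ptrReg, hi, lo] at hpl hpr hlr
  have hw2 := inv.w2
  have hleft : u.word 3 < M → ∀ h, u.arr ⟨u.word 3, h⟩ = B (u.word 3) := fun h h' => by
    rw [← cell_of_lt]; exact inv.rest false _ le_rfl h
  have hright : ∀ h, u.arr ⟨u.word 4, h⟩ = B (u.word 4) := fun h => by
    rw [← cell_of_lt]; exact inv.rest true _ le_rfl h
  have step : ∀ (δ : Bool) (v : State N 16), v.arr = u.arr → v.word = u.word → v.out = u.out →
      (∀ r, r ≠ 4 → r ≠ 8 → v.elem r = u.elem r) → v.elem 4 = B (u.word (ptrReg δ)) →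
      u.word (ptrReg δ) < hi N M δ →
      (u.word (ptrReg !δ) < hi N M (!δ) →
        eventKey σ s o (B (u.word (ptrReg δ))) ≤ eventKey σ s o (B (u.word (ptrReg !δ)))) →
      Runs W (sweepStep τ σ δ) v fun t x => SweepInv N P s o τ σ B M q best x ∧
        SweepComplete P s o τ σ B M x ∧ 
        x.word 3 + x.word 4 = u.word 3 + u.word 4 + 1 ∧
        t + 30 * (Nat.log 2 N + 1) * (x.word 5 + x.word 6) ≤
          30 * (Nat.log 2 N + 1) * (u.word 5 + u.word 6) + 60 * (Nat.log 2 N + 1) + 14 := by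
    intro δ v va vw vo ve v4 hδ hle
    have iv : SweepInv N P s o τ σ B M q best v := by
      refine inv.congr va (fun r hr => ve r ?_ ?_) (fun i _ => by rw [vw])
        (by rw [vw]; exact inv.best_le) (by rw [vw, vo]; exact inv.good)
      · rcases hr with rfl | rfl | rfl | rfl <;> decide
      · rcases hr with rfl | rfl | rfl | rfl <;> decide
    have := runs_sweepStep ctx iv (comp.congr vw) δ (by rw [vw]; exact hδ) (by rw [vw]; exact v4)
      (by
        rw [vw]
        intro δ' j h1 h2
        have hl := inv.size_le δ
        have hl' := inv.size_le (!δ)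
        by_cases hne : δ' = δ
        · subst hne
          exact eventKey_le_of_side ctx δ' (by omega) h1 h2
        · have : δ' = !δ := by cases δ <;> cases δ' <;> simp_all
          subst this
          exact (hle (by omega)).trans (eventKey_le_of_side ctx (!δ) (by omega) h1 h2)) hW
    rwa [vw] at this
  refine runs_branch (fun h3 => ?_) (fun h3 => ?_) <;>
    simp only [holds_wordLT, WordExpr.eval, hw2] at h3
  · refine runs_seq (runs_load (by simp only [WordExpr.eval]; omega) ?_)
    refine runs_branch (fun h4 => ?_) (fun h4 => ?_) <;>
      simp only [holds_wordLT, WordExpr.eval] at h4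
    · refine runs_seq (runs_load h4 (runs_branch (fun h5 => ?_) (fun h5 => ?_)))
      · rw [holds_eventLT _ s o σ (by simp [inv.e0]) (by simp [inv.e1])] at h5
        simp [WordExpr.eval, hleft h3, hright] at h5
        refine runs_seq (runs_copy ?_)
        refine (step true _ (by rfl) (by rfl) (by rfl) (fun r h4 h8 => ?_) ?_
          h4 fun _ => h5.le).mono ?_
        · simp [h4, h8]
        · simp [WordExpr.eval, hright, ptrReg]
        · rintro t v ⟨g1, g2, g3, g4⟩
          exact ⟨g1, g2, g3, by omega⟩
      · rw [holds_eventLT _ s o σ (by simp [inv.e0]) (by simp [inv.e1])] at h5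
        simp [WordExpr.eval, hleft h3, hright] at h5
        refine (step false _ (by rfl) (by rfl) (by rfl) (fun r h4 h8 => ?_) ?_
          h3 fun _ => h5).mono ?_
        · simp [h4, h8]
        · simp [WordExpr.eval, hleft h3, ptrReg]
        · rintro t v ⟨g1, g2, g3, g4⟩
          exact ⟨g1, g2, g3, by omega⟩
    · refine (step false _ (by rfl) (by rfl) (by rfl) (fun r h4 h8 => ?_) ?_
        h3 fun h => absurd h h4).mono ?_
      · simp [h4]
      · simp [WordExpr.eval, hleft h3, ptrReg]
      · rintro t v ⟨g1, g2, g3, g4⟩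
        exact ⟨g1, g2, g3, by omega⟩
  · have h4 : u.word 4 < N := hlt.resolve_left h3
    refine runs_seq (runs_load h4 ?_)
    refine (step true _ (by rfl) (by rfl) (by rfl) (fun r h4 h8 => ?_) ?_
      h4 fun h => absurd h h3).mono ?_
    · simp [h4]
    · simp [WordExpr.eval, hright, ptrReg]
    · rintro t v ⟨g1, g2, g3, g4⟩
      exact ⟨g1, g2, g3, by omega⟩

theorem runs_sweep (ctx : SweepCtx N P s o τ σ B M)
    (inv : SweepInv N P s o τ σ B M q best u) (comp : SweepComplete P s o τ σ B M u)
    (h3 : u.word 3 = 0) (h4 : u.word 4 = M) (h5 : u.word 5 = 0) (h6 : u.word 6 = 0)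
    (hW : N + 1 ≤ W) :
    Runs W (sweep τ σ) u fun t v => SweepInv N P s o τ σ B M q best v ∧
      SweepComplete P s o τ σ B M v ∧ (∀ δ, v.word (ptrReg δ) = hi N M δ) ∧
      t ≤ 81 * (N * (Nat.log 2 N + 1)) + 1 := by
  have hMN := ctx.M_lt
  set L := Nat.log 2 N + 1 with hL
  refine (runs_loop
    (I := fun v => SweepInv N P s o τ σ B M q best v ∧ SweepComplete P s o τ σ B M v)
    -- The pointers start at 0 and `M` and end at `M` and `N`, so `N` elements remain at the
    -- beginning. Besides its amortized part, a round costs at most `60 * L + 20` steps and one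
    -- test, which is at most `81 * L`.
    (Φ := fun v => 81 * ((N + M - (v.word 3 + v.word 4)) * L) + 30 * L * (v.word 5 + v.word 6))
    ?_ ⟨inv, comp⟩).mono ?_
  · rintro v ⟨iv, cv⟩ hT
    simp only [holds_orTest, holds_wordLT, WordExpr.eval, iv.w2] at hT
    have b2 := iv.ptr_le false
    have b4 := iv.ptr_le true
    simp only [hi, ptrReg] at b2 b4
    refine (runs_sweepBody ctx iv cv hT hW).mono ?_
    rintro t x ⟨ix, cx, xs, ht⟩
    refine ⟨⟨ix, cx⟩, ?_⟩
    obtain ⟨m, hm⟩ : ∃ m, N + M - (v.word 3 + v.word 4) = m + 1 :=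
      ⟨N + M - (v.word 3 + v.word 4) - 1, by omega⟩
    have hm' : N + M - (x.word 3 + x.word 4) = m := by omega
    have e : 81 * ((m + 1) * L) = 81 * (m * L) + 81 * L := by ring
    rw [hm, hm', e]
    rw [← hL] at ht
    omega
  · rintro t v ⟨⟨iv, cv⟩, hT, ht⟩
    simp only [holds_orTest, holds_wordLT, WordExpr.eval, iv.w2, not_or, not_lt] at hT
    refine ⟨iv, cv, fun δ => ?_, ?_⟩
    · have := iv.ptr_le δ
      cases δ <;> simp only [hi, ptrReg] at this ⊢ <;> omega
    · simp only [h3, h4, h5, h6, show N + M - (0 + M) = N by omega] at ht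
      omega

end SweepStep

/-! ### Preparing and running the sweep for one frame -/

section PairSweep

variable {N W : ℕ} {P : Color → Finset Plane} {s o : Elem} {τ σ : Bool} {u : State N 16}

/-- Let the limit register of one side hold a point that is extreme in this direction. -/
def scanLimit (τ δ : Bool) : Program 16 :=
  .seq (.copy (limReg δ) 0) <| .seq (.assign 13 (.const 0)) <|
  .loop (wordLT (.reg 13) .len) <|
    .seq (.load 4 (.reg 13)) <|
    .seq (.branch (alongLT (τ == δ) (limReg δ) 4) (.copy (limReg δ) 4) .skip)
      (.assign 13 (.add (.reg 13) (.const 1)))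

/-- The search for an extreme point starts with `s` itself, whose coordinate is 0; hence the result
is nonnegative, and the initial limit one unit farther out is positive and beyond every point. -/
theorem runs_scanLimit (δ : Bool) (h0 : u.elem 0 = s) (h1 : u.elem 1 = o) (hW : N ≤ W) :
    Runs W (scanLimit τ δ) u fun t v => Keeps [13] [4, limReg δ] u v ∧ v.arr = u.arr ∧
      (∀ i < N, along (τ == δ) s.2 o.2 (cell u i).2 ≤
        along (τ == δ) s.2 o.2 (v.elem (limReg δ)).2) ∧
      0 ≤ along (τ == δ) s.2 o.2 (v.elem (limReg δ)).2 ∧ t ≤ 5 * N + 3 := by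
  refine runs_seq (runs_copy (runs_seq (runs_assign (by simp [WordExpr.eval]) ?_)))
  have hn0 : (0 : Fin 16) ≠ limReg δ := by cases δ <;> decide
  have hn1 : (1 : Fin 16) ≠ limReg δ := by cases δ <;> decide
  have hn4 : (4 : Fin 16) ≠ limReg δ := by cases δ <;> decide
  refine (runs_loop
    (I := fun v => Keeps [13] [4, limReg δ] u v ∧ v.arr = u.arr ∧ v.word 13 ≤ N ∧
      (∀ i < v.word 13, along (τ == δ) s.2 o.2 (cell u i).2 ≤
        along (τ == δ) s.2 o.2 (v.elem (limReg δ)).2) ∧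
      0 ≤ along (τ == δ) s.2 o.2 (v.elem (limReg δ)).2)
    (Φ := fun v => 5 * (N - v.word 13)) ?_ ?_).mono ?_
  · rintro v ⟨kv, av, v13, hle, hpos⟩ hT
    simp only [holds_wordLT, WordExpr.eval] at hT
    have k0 : v.elem 0 = s := by rw [kv.elem 0 (by simp [hn0]), h0]
    have k1 : v.elem 1 = o := by rw [kv.elem 1 (by simp [hn1]), h1]
    refine runs_seq (runs_load hT ?_)
    have hcell : v.arr ⟨(WordExpr.reg 13).eval v, hT⟩ = cell u (v.word 13) := by
      rw [← cell_congr av, cell_of_lt v hT]; rfl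
    rw [hcell]
    refine runs_seq (runs_branch (fun hL => runs_copy ?_) (fun hL => runs_skip ?_)) <;>
      simp only [alongLT, holds_realLT, eval_alongExpr, Function.update_self, ne_eq,
        hn4.symm, not_false_eq_true, Function.update_of_ne, k0, k1,
        show (0 : Fin 16) ≠ 4 by decide, show (1 : Fin 16) ≠ 4 by decide] at hL
    · refine runs_assign (by simp [WordExpr.eval]; omega) ⟨⟨?_, av, ?_, ?_, ?_⟩, ?_⟩
      · refine ⟨fun i hi => ?_, fun r hr => ?_, kv.out⟩
        · rw [← kv.word i hi]; simp at hi; simp [hi]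
        · rw [← kv.elem r hr]; simp at hr; simp [hr]
      · simp [WordExpr.eval]; omega
      · intro i hi
        simp [WordExpr.eval] at hi
        simp only [Function.update_self]
        rcases hi.lt_or_eq with h | rfl
        · exact (hle i h).trans hL.le
        · exact le_rfl
      · simp only [Function.update_self]
        exact hpos.trans hL.le
      · simp [WordExpr.eval]; omega
    · refine runs_assign (by simp [WordExpr.eval]; omega) ⟨⟨?_, av, ?_, ?_, ?_⟩, ?_⟩
      · refine ⟨fun i hi => ?_, fun r hr => ?_, kv.out⟩
        · rw [← kv.word i hi]; simp at hi; simp [hi]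
        · rw [← kv.elem r hr]; simp at hr; simp [hr]
      · simp [WordExpr.eval]; omega
      · intro i hi
        simp [WordExpr.eval] at hi
        simp only [ne_eq, hn4.symm, not_false_eq_true, Function.update_of_ne]
        rcases hi.lt_or_eq with h | rfl
        · exact hle i h
        · exact not_lt.mp hL
      · simpa [hn4.symm] using hpos
      · simp [WordExpr.eval]; omega
  · refine ⟨⟨fun i hi => ?_, fun r hr => ?_, rfl⟩, rfl, ?_, ?_, ?_⟩
    · simp at hi; simp [hi]
    · simp at hr; simp [hr]
    · simp [WordExpr.eval]
    · intro i hi; simp [WordExpr.eval] at hi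
    · simp [h0, along_self]
  · rintro t v ⟨⟨kv, av, v13, hle, hpos⟩, hT, ht⟩
    simp only [holds_wordLT, WordExpr.eval, not_lt] at hT
    refine ⟨kv, av, fun i hi => hle i (by omega), hpos, ?_⟩
    simp [WordExpr.eval] at ht
    omega

/-- Let register 2 hold the number of points on the left of `s` in the sorted array. -/
def countLeft (τ : Bool) : Program 16 :=
  .seq (.assign 2 (.const 0)) <| .seq (.load 4 (.reg 2)) <|
  .loop (realLT (alongExpr τ 4) (realConst 0)) <|
    .seq (.assign 2 (.add (.reg 2) (.const 1))) (.load 4 (.reg 2))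

/-- `s` is not on its own left and serves as a sentinel: the loop cannot run past its position. -/
theorem runs_countLeft (h0 : u.elem 0 = s) (h1 : u.elem 1 = o) (hW : N ≤ W)
    (hs : ∃ i < N, cell u i = s) :
    Runs W (countLeft τ) u fun t v => Keeps [2] [4] u v ∧ v.arr = u.arr ∧ v.word 2 < N ∧
      (∀ i < v.word 2, along τ s.2 o.2 (cell u i).2 < 0) ∧
      0 ≤ along τ s.2 o.2 (cell u (v.word 2)).2 ∧ t ≤ 3 * N + 3 := by
  obtain ⟨j, hj, hjs⟩ := hs
  refine runs_seq (runs_assign (by simp [WordExpr.eval]) ?_)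
  refine runs_seq (runs_load (by simp [WordExpr.eval]; omega) ?_)
  refine (runs_loop
    (I := fun v => Keeps [2] [4] u v ∧ v.arr = u.arr ∧ v.word 2 ≤ j ∧
      (∀ i < v.word 2, along τ s.2 o.2 (cell u i).2 < 0) ∧ v.elem 4 = cell u (v.word 2))
    (Φ := fun v => 3 * (N - v.word 2)) ?_ ?_).mono ?_
  · rintro v ⟨kv, av, v2, hle, v4⟩ hT
    have k0 : v.elem 0 = s := by rw [kv.elem 0 (by decide), h0]
    have k1 : v.elem 1 = o := by rw [kv.elem 1 (by decide), h1]
    simp only [holds_realLT, eval_alongExpr, eval_realConst, k0, k1, v4, Nat.cast_zero] at hT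
    have hlt : v.word 2 < j := by
      refine lt_of_le_of_ne v2 fun h => ?_
      rw [h, hjs, along_self] at hT
      exact lt_irrefl _ hT
    refine runs_seq (runs_assign (by simp [WordExpr.eval]; omega) ?_)
    refine runs_load (by simp [WordExpr.eval]; omega) ⟨⟨⟨fun i hi => ?_, fun r hr => ?_, kv.out⟩,
      av, ?_, ?_, ?_⟩, ?_⟩
    · rw [← kv.word i hi]; simp at hi; simp [hi]
    · rw [← kv.elem r hr]; simp at hr; simp [hr]
    · simp [WordExpr.eval]; omega
    · intro i hi
      simp [WordExpr.eval] at hi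
      rcases hi.lt_or_eq with h | rfl
      · exact hle i h
      · exact hT
    · rw [← cell_congr av]
      simp [WordExpr.eval, cell_of_lt v (show v.word 2 + 1 < N by omega)]
    · simp [WordExpr.eval]; omega
  · refine ⟨⟨fun i hi => ?_, fun r hr => ?_, rfl⟩, rfl, ?_, ?_, ?_⟩
    · simp at hi; simp [hi]
    · simp at hr; simp [hr]
    · simp [WordExpr.eval]
    · intro i hi; simp [WordExpr.eval] at hi
    · simp [WordExpr.eval, cell_of_lt u (show 0 < N by omega)]
  · rintro t v ⟨⟨kv, av, v2, hle, v4⟩, hT, ht⟩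
    have k0 : v.elem 0 = s := by rw [kv.elem 0 (by decide), h0]
    have k1 : v.elem 1 = o := by rw [kv.elem 1 (by decide), h1]
    simp only [holds_realLT, eval_alongExpr, eval_realConst, k0, k1, v4, Nat.cast_zero,
      not_lt] at hT
    refine ⟨kv, av, by omega, hle, hT, ?_⟩
    simp [WordExpr.eval] at ht
    omega

/-- No element has been passed, both heaps are empty, and both limits are one unit beyond the
extreme points. -/
def initSweep : Program 16 :=
  .seq (.assign 3 (.const 0)) <| .seq (.assign 4 (.reg 2)) <| .seq (.assign 5 (.const 0)) <|
  .seq (.assign 6 (.const 0)) <| .seq (.assign 7 (.const 1)) (.assign 8 (.const 1))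

/-- Find the largest box whose base contains the points in registers 0 and 1. -/
def processPair (τ σ : Bool) : Program 16 :=
  .seq (heapSort (sideLT τ σ)) <| .seq (countLeft τ) <|
  .seq (scanLimit τ false) <| .seq (scanLimit τ true) <| .seq initSweep <|
  .seq (sweep τ σ) (consider τ σ (realConst 1) (.const 1))

theorem runs_initSweep {M : ℕ} (h2 : u.word 2 = M) (hM : M ≤ W) (hW : 1 ≤ W) :
    Runs W initSweep u fun t v => Keeps [3, 4, 5, 6, 7, 8] [] u v ∧ v.arr = u.arr ∧
      v.word 3 = 0 ∧ v.word 4 = M ∧ v.word 5 = 0 ∧ v.word 6 = 0 ∧ v.word 7 = 1 ∧ v.word 8 = 1 ∧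
      t = 6 := by
  refine runs_seq (runs_assign (by simp [WordExpr.eval]) (runs_seq (runs_assign
    (by simp [WordExpr.eval, h2, hM]) (runs_seq (runs_assign (by simp [WordExpr.eval])
    (runs_seq (runs_assign (by simp [WordExpr.eval]) (runs_seq (runs_assign
    (by simpa [WordExpr.eval] using hW) (runs_assign (by simpa [WordExpr.eval] using hW)
    ?_))))))))))
  refine ⟨⟨fun i hi => ?_, fun r hr => rfl, rfl⟩, rfl, ?_⟩
  · simp at hi; simp [hi]
  · simp [WordExpr.eval, h2]

/-- The pairs of points whose line can carry the base of a box. -/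
structure PairCtx (P : Color → Finset Plane) (s o : Elem) : Prop where
  mem_s : s.2 ∈ P s.1
  color : s.1 ≠ o.1
  point : s.2 ≠ o.2
  line : ∀ σ, ∀ e : Elem, e.2 ∈ P e.1 → height σ s.2 o.2 e.2 = 0 → e = s ∨ e = o

theorem sideInv_empty (b σ : Bool) (s o : Elem) {A : Set Elem} {lim : ℝ}
    (h : ∀ e ∈ A, along b s.2 o.2 e.2 ≤ lim) : SideInv b σ s o A ∅ ∅ lim :=
  ⟨by ext; simp [alive], Set.empty_subset _, by simp [obstacles], fun e he _ => h e he⟩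

/-- After the sweep every point has been passed, so the completeness statement covers all
configurations with at least two points. -/
theorem runs_processPair (pair : PairCtx P s o) (h0 : u.elem 0 = s) (h1 : u.elem 1 = o)
    (hmem : ∀ e : Elem, e.2 ∈ P e.1 ↔ ∃ i < N, cell u i = e)
    (hinj : Set.InjOn (cell u) (Set.Iio N)) (hW : N + 1 ≤ W)
    (hgood : u.word 1 = 0 ∨ Achieves P (u.word 1) u.out) :
    Runs W (processPair τ σ) u fun t v => v.elem 0 = s ∧ v.elem 1 = o ∧ v.word 0 = u.word 0 ∧
      PermOn 0 N (cell u) (cell v) ∧ u.word 1 ≤ v.word 1 ∧ Achieves P (v.word 1) v.out ∧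
      (∀ T, IsConfig P s o τ σ T → T.card ≤ v.word 1) ∧
      t ≤ 160 * (N * (Nat.log 2 N + 1)) := by
  obtain ⟨i₀, hi₀, hs₀⟩ := (hmem s).mp pair.mem_s
  refine runs_seq ((runs_heapSort (compares_sideLT s o τ σ) h0 h1 (by omega) (by omega)).mono ?_)
  rintro t₁ a ⟨ka, pa, sa, ht₁⟩
  have a0 : a.elem 0 = s := by rw [ka.elem 0 (by decide), h0]
  have a1 : a.elem 1 = o := by rw [ka.elem 1 (by decide), h1]
  have hmem' : ∀ e : Elem, e.2 ∈ P e.1 ↔ ∃ i < N, cell a i = e := by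
    intro e
    rw [hmem]
    have := pa.block_eq
    simp only [block, Set.ext_iff, Set.mem_ofPred_eq, Nat.zero_le, true_and] at this
    exact (this e).symm
  refine runs_seq ((runs_countLeft (τ := τ) a0 a1 (by omega) ((hmem' s).mp pair.mem_s)).mono ?_)
  rintro t₂ b ⟨kb, ab, hM, hleft, hright, ht₂⟩
  have b0 : b.elem 0 = s := by rw [kb.elem 0 (by decide), a0]
  have b1 : b.elem 1 = o := by rw [kb.elem 1 (by decide), a1]
  have cb := cell_congr ab
  set M := b.word 2 with hMdef
  refine runs_seq ((runs_scanLimit (τ := τ) (W := W) false b0 b1 (by omega)).mono ?_)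
  rintro t₃ c ⟨kc, ac, hlc, hlc0, ht₃⟩
  have c0 : c.elem 0 = s := by rw [kc.elem 0 (by decide), b0]
  have c1 : c.elem 1 = o := by rw [kc.elem 1 (by decide), b1]
  have cc := cell_congr ac
  refine runs_seq ((runs_scanLimit (τ := τ) (W := W) true c0 c1 (by omega)).mono ?_)
  rintro t₄ d ⟨kd, ad, hld, hld0, ht₄⟩
  have cd := cell_congr ad
  refine runs_seq ((runs_initSweep (M := M) (W := W) (u := d)
    (by rw [kd.word 2 (by decide), kc.word 2 (by decide)]) (by omega) (by omega)).mono ?_)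
  rintro t₅ e ⟨ke, ae, e3, e4, e5, e6, e7, e8, ht₅⟩
  have ce : cell e = cell a := by rw [cell_congr ae, cd, cc, cb]
  have kde := (kd.mono (ws' := [13, 3, 4, 5, 6, 7, 8]) (es' := [4, limReg true]) (by decide)
    (by decide)).trans (ke.mono (by decide) (by decide))
  have el : ∀ δ, (∀ i < N, along (τ == δ) s.2 o.2 (cell a i).2 ≤
        along (τ == δ) s.2 o.2 (e.elem (limReg δ)).2) ∧
      0 ≤ along (τ == δ) s.2 o.2 (e.elem (limReg δ)).2 := by
    intro δ
    cases δ
    · rw [kde.elem _ (by decide), ← cb]; exact ⟨hlc, hlc0⟩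
    · rw [ke.elem _ (by decide), ← cb, ← cc]; exact ⟨hld, hld0⟩
  have kall : Keeps [9, 10, 11, 12, 2, 13, 3, 4, 5, 6, 7, 8] [5, 6, 7, 4, 2, 3] u e :=
    (((ka.mono (by decide) (by decide)).trans (kb.mono (by decide) (by decide))).trans
      (kc.mono (by decide) (by decide))).trans (kde.mono (by decide) (by decide))
  have ctx : SweepCtx N P s o τ σ (cell a) M := by
    refine ⟨pair.mem_s, pair.color, pair.point, hmem', pa.injOn le_rfl hinj,
      pair.line σ, hM, hleft, fun i h1 h2 => ?_, fun δ i j h1 h2 h3 => ?_⟩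
    · rcases h1.lt_or_eq with h | rfl
      -- The element at position `M` is not on the left of `s`, so by the side component of the key
      -- nothing after it is.
      · have := sa M i h h2
        rw [sideKey, sideKey, Prod.Lex.toLex_le_toLex, if_neg (not_lt.mpr hright)] at this
        by_contra hneg
        simp [not_le.mp hneg] at this
      · exact hright
    · have hr : ∀ i, M ≤ i → i < N → 0 ≤ along τ s.2 o.2 (cell a i).2 := by
        intro i h1 h2
        rcases h1.lt_or_eq with h | rfl
        · have := sa M i h h2
          rw [sideKey, sideKey, Prod.Lex.toLex_le_toLex, if_neg (not_lt.mpr hright)] at this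
          by_contra hneg
          simp [not_le.mp hneg] at this
        · exact hright
      cases δ
      · simp only [hi] at h3
        have := sa i j h2 (by omega)
        rw [sideKey, sideKey, Prod.Lex.toLex_le_toLex, if_pos (hleft i (by omega)),
          if_pos (hleft j h3)] at this
        simpa using this
      · simp only [hi, lo] at h1 h3
        have := sa i j h2 h3
        rw [sideKey, sideKey, Prod.Lex.toLex_le_toLex, if_neg (not_lt.mpr (hr i h1 (by omega))),
          if_neg (not_lt.mpr (hr j (by omega) h3))] at this
        simpa using this
  have ep : ∀ δ, e.word (ptrReg δ) = lo M δ := fun δ => by cases δ <;> simp [ptrReg, lo, e3, e4]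
  have es : ∀ δ, e.word (sizeReg δ) = 0 := fun δ => by cases δ <;> simp [sizeReg, e5, e6]
  have ef : ∀ δ, e.word (flagReg δ) = 1 := fun δ => by cases δ <;> simp [flagReg, e7, e8]
  have inv : SweepInv N P s o τ σ (cell a) M (u.word 0) (u.word 1) e := by
    refine ⟨by rw [kall.elem 0 (by decide), h0], by rw [kall.elem 1 (by decide), h1],
      kall.word 0 (by decide), ?_, fun δ => (ef δ).le, fun δ => by rw [es, ep, add_zero], ?_,
      fun δ i _ _ => by rw [ce], by rw [ce]; exact PermOn.refl _ _ _, ?_, ?_, ?_, ?_, ?_, ?_, ?_⟩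
    · rw [kde.word 2 (by decide), kc.word 2 (by decide)]
    · intro δ; rw [ep]; cases δ <;> simp only [lo, hi] <;> omega
    · intro δ i _ h; rw [es] at h; omega
    · intro δ
      rw [passed, heapSet, ep, es, add_zero, block_self, block_self]
      refine sideInv_empty _ _ _ _ fun x hx => ?_
      obtain ⟨i, hi, rfl⟩ := (hmem' x).mp hx
      rw [sideLimit, ef]
      have := (el δ).1 i hi
      push_cast
      linarith
    · rw [sideLimit, ef]; have := (el false).2; push_cast; linarith
    · rw [sideLimit, ef]; have := (el true).2; push_cast; linarith
    · intro δ δ' i j h1 h2; rw [ep] at h2; omega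
    · rw [kall.word 1 (by decide)]
    · rw [kall.word 1 (by decide), kall.out]; exact hgood
  have comp : SweepComplete P s o τ σ (cell a) M e := by
    intro T hT hcard hsub
    have : T ⊆ {s} := fun x hx => by
      rcases hsub x hx with h | ⟨δ, h⟩
      · simp [h]
      · rw [passed, ep, block_self] at h; exact absurd h (Set.notMem_empty _)
    have := Finset.card_le_card this
    rw [Finset.card_singleton] at this
    omega
  refine runs_seq ((runs_sweep ctx inv comp e3 e4 e5 e6 hW).mono ?_)
  rintro t₆ f ⟨invf, compf, fp, ht₆⟩
  -- A last box of arbitrary height 1 around `s` covers the configurations with at most one point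
  -- and guarantees that some rectangle has been put out. It is legal because all obstacles have
  -- been passed.
  refine (runs_consider (τ := τ) (σ := σ) invf.e0 invf.e1 (h := realConst 1) (n := .const 1)
    (by simp only [WordExpr.eval]; omega) (fun x => rfl)).mono ?_
  rintro t₇ g ⟨ga, ge, gw, gn, gb, go, ht₇⟩
  simp only [WordExpr.eval] at gn go
  have hpass : ∀ x : Elem, x.2 ∈ P x.1 → ∃ δ, x ∈ passed (cell a) M f δ := by
    intro x hx
    obtain ⟨i, hi, rfl⟩ := (hmem' x).mp hx
    obtain ⟨δ, g1, g2⟩ := exists_side (M := M) hi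
    exact ⟨δ, i, ⟨g1, by rw [fp]; exact g2⟩, rfl⟩
  refine ⟨by rw [ge, invf.e0], by rw [ge, invf.e1], by rw [gw 0 (by decide), invf.w0],
    pa.trans (by rw [cell_congr ga]; exact invf.perm), invf.best_le.trans gb, ?_, ?_, ?_⟩
  · rcases go with ⟨g1, go⟩ | ⟨g1, go⟩
    · rw [g1, go]
      exact invf.good.resolve_left (by omega)
    · rw [g1, go, eval_realConst]
      exact achieves_box ctx invf (by simp) (fun x hx _ _ _ => hpass x hx) (Or.inl le_rfl)
  · intro T hT
    by_cases hcard : 1 < T.card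
    · exact (compf T hT hcard fun x hx => Or.inr (hpass x (hT.sub x hx).1)).trans gb
    · omega
  · have hL : N ≤ N * (Nat.log 2 N + 1) := Nat.le_mul_of_pos_right _ (by omega)
    have hN : 1 ≤ N := by omega
    omega

end PairSweep

/-! ### Rotating a rectangle until it rests on a bichromatic pair -/

section Rotation

theorem Color.eq_other {a b : Color} (h : a ≠ b) : a = b.other := by
  cases a <;> cases b <;> simp_all [Color.other]

/-- The least coordinate in the direction `g` of the points of `S`, relative to `q`. -/
noncomputable def offset (S : Finset Plane) (hS : S.Nonempty) (q : Plane) (g : ℝ × ℝ) : ℝ :=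
  S.inf' hS fun p => (p 0 - q 0) * g.1 + (p 1 - q 1) * g.2

/-- How far `q` is outside the bounding box of `S` in the direction `g`. -/
noncomputable def clearance (S : Finset Plane) (hS : S.Nonempty) (q : Plane) (g : ℝ × ℝ) : ℝ :=
  (offset S hS q (g.1, g.2) ⊔ offset S hS q (-g.1, -g.2)) ⊔
    (offset S hS q (-g.2, g.1) ⊔ offset S hS q (g.2, -g.1))

variable {S O : Finset Plane} (hS : S.Nonempty) {q : Plane} {g : ℝ × ℝ}

theorem continuous_offset (q : Plane) : Continuous (offset S hS q) := by
  unfold offset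
  refine Continuous.finset_inf'_apply hS fun p _ => ?_
  fun_prop

theorem continuous_clearance (q : Plane) : Continuous (clearance S hS q) := by
  have h := continuous_offset hS q
  unfold clearance
  fun_prop

theorem offset_nonneg_iff :
    0 ≤ offset S hS q g ↔ ∀ p ∈ S, 0 ≤ (p 0 - q 0) * g.1 + (p 1 - q 1) * g.2 :=
  Finset.le_inf'_iff hS _

theorem exists_offset_eq :
    ∃ p ∈ S, offset S hS q g = (p 0 - q 0) * g.1 + (p 1 - q 1) * g.2 :=
  Finset.exists_mem_eq_inf' hS _

/-- A quarter turn permutes the four outward directions of the box. -/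
theorem clearance_rotate : clearance S hS q (-g.2, g.1) = clearance S hS q g := by
  simp only [clearance, neg_neg]
  rw [sup_comm (offset S hS q (g.1, g.2) ⊔ _), sup_comm (offset S hS q (-g.1, -g.2))]

/-- The nonzero directions are connected. -/
theorem isPreconnected_directions : IsPreconnected ({0}ᶜ : Set (ℝ × ℝ)) := by
  refine (isConnected_compl_singleton_of_one_lt_rank ?_ 0).isPreconnected
  simp
  norm_num

/-- If every point of `O` is outside the bounding box of `S` in some direction, then it is so in a
direction for which a point of `O` and a point of `S` lie on the same side of the box. -/
theorem exists_tangent_direction (hO : O.Nonempty)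
    (h : ∃ g : ℝ × ℝ, g ≠ 0 ∧ ∀ q ∈ O, 0 ≤ clearance S hS q g) :
    ∃ g : ℝ × ℝ, g ≠ 0 ∧ (∀ q ∈ O, 0 ≤ clearance S hS q g) ∧
      ∃ o ∈ O, offset S hS o g = 0 := by
  -- `H` is nonnegative exactly in the directions whose open bounding box of `S` contains no point
  -- of `O`.
  set H : ℝ × ℝ → ℝ := fun g => O.inf' hO fun q => clearance S hS q g with hH
  have Hc : Continuous H := Continuous.finset_inf'_apply hO fun q _ => continuous_clearance hS q
  have Hn : ∀ g, 0 ≤ H g ↔ ∀ q ∈ O, 0 ≤ clearance S hS q g := fun g => Finset.le_inf'_iff hO _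
  obtain ⟨g₀, hg₀, hgood⟩ := h
  rw [← Hn] at hgood
  by_cases hneg : ∃ g₁ : ℝ × ℝ, g₁ ≠ 0 ∧ H g₁ ≤ 0
  · obtain ⟨g₁, hg₁, hn⟩ := hneg
    obtain ⟨g, hg, hg0⟩ := isPreconnected_directions.intermediate_value hg₁ hg₀ Hc.continuousOn
      ⟨hn, hgood⟩
    have hgn : g ≠ 0 := hg
    obtain ⟨o, ho, hoeq⟩ := Finset.exists_mem_eq_inf' hO fun q => clearance S hS q g
    have hc : clearance S hS o g = 0 := hoeq.symm.trans hg0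
    have hall := (Hn g).mp hg0.ge
    have rot : ∀ g : ℝ × ℝ, g ≠ 0 → ((-g.2, g.1) : ℝ × ℝ) ≠ 0 := by
      intro g hg h0
      simp only [Prod.mk_eq_zero, neg_eq_zero] at h0
      exact hg (Prod.ext h0.2 h0.1)
    have hall' : ∀ g : ℝ × ℝ, (∀ q ∈ O, 0 ≤ clearance S hS q g) →
        ∀ q ∈ O, 0 ≤ clearance S hS q (-g.2, g.1) := fun g hg q hq => by
      rw [clearance_rotate]; exact hg q hq
    have r1 := rot g hgn
    have r2 := rot _ r1
    have r3 := rot _ r2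
    have a1 := hall' g hall
    have a2 := hall' _ a1
    have a3 := hall' _ a2
    simp only [neg_neg] at r2 r3 a2 a3
    have hmax : offset S hS o (g.1, g.2) = 0 ∨ offset S hS o (-g.1, -g.2) = 0 ∨
        offset S hS o (-g.2, g.1) = 0 ∨ offset S hS o (g.2, -g.1) = 0 := by
      -- The maximum of four offsets is 0, so one of them is 0: `o` lies on the line of one of the
      -- four sides.
      unfold clearance at hc
      rcases max_choice (offset S hS o (g.1, g.2) ⊔ offset S hS o (-g.1, -g.2))
        (offset S hS o (-g.2, g.1) ⊔ offset S hS o (g.2, -g.1)) with e | e <;> rw [e] at hc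
      · rcases max_choice (offset S hS o (g.1, g.2)) (offset S hS o (-g.1, -g.2)) with e | e <;>
          rw [e] at hc <;> simp [hc]
      · rcases max_choice (offset S hS o (-g.2, g.1)) (offset S hS o (g.2, -g.1)) with e | e <;>
          rw [e] at hc <;> simp [hc]
    -- Quarter turns make the touched side the one that belongs to `g` itself.
    rcases hmax with h | h | h | h
    · exact ⟨g, hgn, hall, o, ho, h⟩
    · exact ⟨_, r2, a2, o, ho, h⟩
    · exact ⟨_, r1, a1, o, ho, h⟩
    · exact ⟨_, r3, a3, o, ho, h⟩
  -- Here every direction is admissible and no point of `O` ever touches the box. It is enough to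
  -- bring the line of one side to a chosen `o`; the offset of `o` changes sign between some
  -- direction and its opposite.
  · push Not at hneg
    have hall : ∀ g : ℝ × ℝ, g ≠ 0 → ∀ q ∈ O, 0 ≤ clearance S hS q g :=
      fun g hg => (Hn g).mp (hneg g hg).le
    obtain ⟨o, ho⟩ := hO
    obtain ⟨p, hp⟩ := hS
    obtain ⟨g₁, hg₁, h₁⟩ : ∃ g₁ : ℝ × ℝ, g₁ ≠ 0 ∧ 0 ≤ offset S ⟨p, hp⟩ o g₁ := by
      have hc := hall (1, 0) (by simp) o ho
      simp only [clearance, le_sup_iff] at hc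
      rcases hc with (h | h) | h | h <;> exact ⟨_, by simp, h⟩
    have h₂ : offset S ⟨p, hp⟩ o (-g₁) ≤ 0 := by
      refine (Finset.inf'_le _ hp).trans ?_
      have := (offset_nonneg_iff ⟨p, hp⟩).mp h₁ p hp
      simp only [Prod.fst_neg, Prod.snd_neg]
      linarith
    obtain ⟨g, hg, hg0⟩ := isPreconnected_directions.intermediate_value
      (show -g₁ ∈ ({0}ᶜ : Set (ℝ × ℝ)) by simpa using hg₁) hg₁
      (continuous_offset ⟨p, hp⟩ o).continuousOn ⟨h₂, h₁⟩
    exact ⟨g, hg, hall g hg, o, ho, hg0⟩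

variable {P : Color → Finset Plane} {col : Color} {U : Set Plane}

/-- A direction of a side of a coloured rectangle has the points of the other colour outside. -/
theorem clearance_of_rectangle {v w c : Plane} (hv : v ≠ 0) (hw : w ≠ 0) (hvw : inner ℝ v w = 0)
    (hsub : ∀ p ∈ S, p ∈ spanned c v w) (hq : q ∉ interior (spanned c v w)) :
    0 ≤ clearance S hS q (v 0, v 1) := by
  have hvp := normSq_pos hv
  simp only [clearance, le_sup_iff, offset_nonneg_iff]
  have hS' := fun p hp => (mem_spanned_iff hv hw hvw).mp (hsub p hp)
  rw [mem_interior_spanned_iff hv hw hvw] at hq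
  simp only [inner_eq, PiLp.sub_apply] at hS' hq hvw
  obtain ⟨μ, hμ0, hμ1⟩ := exists_perpendicular hvp hvw
  by_contra hc
  push Not at hc
  obtain ⟨⟨⟨p₁, m₁, h₁⟩, p₂, m₂, h₂⟩, ⟨p₃, m₃, h₃⟩, p₄, m₄, h₄⟩ := hc
  have k₁ := (hS' p₁ m₁).1
  have k₂ := (hS' p₂ m₂).1
  have k₃ := (hS' p₃ m₃).2
  have k₄ := (hS' p₄ m₄).2
  -- The side `w` is a nonzero multiple of the quarter turn of `v`. Its sign is unknown, but the two
  -- quarter turns occur symmetrically in `clearance`.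
  have hμ : μ ≠ 0 := by
    rintro rfl
    have := normSq_pos hw
    simp [hμ0, hμ1] at this
  refine hq ⟨⟨by linarith, by linarith⟩, ?_⟩
  rw [hμ0, hμ1] at k₃ k₄ ⊢
  rcases hμ.lt_or_gt with h | h
  · have e₃ := mul_pos_of_neg_of_neg h h₃
    have e₄ := mul_pos_of_neg_of_neg h h₄
    constructor <;> nlinarith
  · have e₃ := mul_neg_of_pos_of_neg h h₃
    have e₄ := mul_neg_of_pos_of_neg h h₄
    constructor <;> nlinarith

/-- A point set that touches a point `o` of the other colour from one side, in a direction whose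
bounding box has no such point inside, is a configuration of a pair. -/
theorem exists_isConfig_of_direction {O : Finset Plane} (hSP : S ⊆ P col) (hO : O = P col.other)
    (hdis : Disjoint (P col) O) (hg : g ≠ 0) (hclear : ∀ q ∈ O, 0 ≤ clearance S hS q g)
    {o : Plane} (ho : o ∈ O) (htouch : offset S hS o g = 0) :
    ∃ s ∈ S, ∃ τ σ, IsConfig P (col, s) (col.other, o) τ σ
      (S.map ⟨Prod.mk col, Prod.mk_right_injective col⟩) := by
  obtain ⟨s, hs, hsg⟩ := exists_offset_eq hS (q := o) (g := g)
  rw [htouch] at hsg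
  have hso : s ≠ o := fun h => Finset.disjoint_left.mp hdis (hSP hs) (h ▸ ho)
  have hside := (offset_nonneg_iff hS).mp htouch.ge
  obtain ⟨x, y⟩ := g
  simp only at hsg hside
  have hxy : 0 < x * x + y * y := by
    by_contra hc
    refine hg (Prod.ext ?_ ?_) <;> simp <;> nlinarith [mul_self_nonneg x, mul_self_nonneg y]
  -- The vector from `s` to `o` is orthogonal to `g`, so `height` is a multiple of the coordinate in
  -- direction `g`; the sign `σ` is chosen such that `S` lies above the base.
  obtain ⟨l, hl0, hl1⟩ := exists_perpendicular (x := o 0 - s 0) (y := o 1 - s 1) hxy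
    (by linear_combination hsg)
  have hl : l ≠ 0 := by
    rintro rfl
    apply hso
    ext i
    fin_cases i <;> simp <;> linarith
  obtain ⟨σ, r, hr, hheight⟩ : ∃ σ : Bool, ∃ r : ℝ, 0 < r ∧
      ∀ p : Plane, height σ s o p = r * ((p 0 - s 0) * x + (p 1 - s 1) * y) := by
    rcases hl.lt_or_gt with h | h
    · exact ⟨true, -l, by linarith, fun p => by simp only [height, signed, hl0, hl1]; simp; ring⟩
    · exact ⟨false, l, h, fun p => by simp only [height, signed, hl0, hl1]; simp; ring⟩
  have halong : ∀ p : Plane, along true s o p = l * ((p 0 - s 0) * -y + (p 1 - s 1) * x) := by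
    intro p; simp only [along, signed, hl0, hl1]; simp; ring
  -- The sweep assigns an obstacle exactly above `s` to the right side. This is wrong if all of `S`
  -- lies to the right of `s`; the frame is then mirrored. Consequently, with this `τ`, if no point
  -- of `S` is on the left then none is strictly on the right.
  obtain ⟨τ, hτ⟩ : ∃ τ : Bool, (∀ p ∈ S, 0 ≤ along τ s o p) → ∀ p ∈ S, along τ s o p ≤ 0 := by
    by_cases h : ∀ p ∈ S, 0 ≤ along true s o p
    · refine ⟨false, fun _ p hp => ?_⟩
      have := along_not true s o p
      simp only [Bool.not_true] at this
      rw [this]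
      linarith [h p hp]
    · exact ⟨true, fun h' => absurd h' h⟩
  have hside' : ∀ q ∈ O, 0 < height σ s o q → (∃ p ∈ S, height σ s o q < height σ s o p) →
      (∀ p ∈ S, along τ s o q ≤ along τ s o p) ∨ ∀ p ∈ S, along τ s o p ≤ along τ s o q := by
    rintro q hq hpos ⟨p, hp, hlt⟩
    rw [hheight, hheight, mul_lt_mul_iff_right₀ hr] at hlt
    rw [hheight, mul_pos_iff_of_pos_left hr] at hpos
    have hc := hclear q hq
    simp only [clearance, le_sup_iff, offset_nonneg_iff] at hc
    have key : (∀ p ∈ S, along true s o q ≤ along true s o p) ∨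
        ∀ p ∈ S, along true s o p ≤ along true s o q := by
      simp only [halong]
      -- The obstacle is above the base and below a point of `S`, so it cannot be outside the box
      -- through the bottom or the top; it is outside on the left or on the right.
      rcases hc with (hc | hc) | hc | hc
      · have := hc s hs
        linarith
      · have := hc p hp
        linarith
      · rcases hl.lt_or_gt with h | h
        · refine Or.inr fun e he => ?_
          nlinarith [hc e he]
        · refine Or.inl fun e he => ?_
          nlinarith [hc e he]
      · rcases hl.lt_or_gt with h | h
        · refine Or.inl fun e he => ?_
          nlinarith [hc e he]
        · refine Or.inr fun e he => ?_
          nlinarith [hc e he]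
    cases τ with
    | true => exact key
    | false =>
      have e := fun p => along_not true s o p
      simp only [Bool.not_true] at e
      simp only [e, neg_le_neg_iff]
      exact key.symm
  refine ⟨s, hs, τ, σ, ?_, ?_⟩
  · simp only [Finset.mem_map, Function.Embedding.coeFn_mk]
    rintro _ ⟨p, hp, rfl⟩
    refine ⟨hSP hp, rfl, ?_⟩
    simp only [hheight]
    have := hside p hp
    have : 0 ≤ (p 0 - s 0) * x + (p 1 - s 1) * y := by linarith
    positivity
  · rintro ⟨cq, q⟩ hq hne hpos ⟨p, hp, hlt⟩
    simp only [Finset.mem_map, Function.Embedding.coeFn_mk] at hp ⊢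
    simp only at hq hne hpos hlt
    obtain ⟨p, hp, rfl⟩ := hp
    have hcq : cq = col.other := Color.eq_other hne
    subst hcq
    rintro _ ⟨e, he, rfl⟩
    simp only
    have hz : along τ s o s = 0 := along_self τ s o
    rcases hside' q (hO ▸ hq) hpos ⟨p, hp, hlt⟩ with h | h
    · refine ⟨fun _ => h e he, fun hq0 => ?_⟩
      -- An obstacle with nonnegative coordinate that is on the left of all of `S` forces `S` to
      -- have nonnegative coordinates; by the choice of `τ` they are then at most 0.
      exact (hτ (fun p hp => hq0.trans (h p hp)) e he).trans hq0
    · refine ⟨fun hq0 => ?_, fun _ => h e he⟩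
      have := h s hs
      linarith

/-- Every coloured rectangle that contains a point of its colour gives a configuration of a pair
with the same number of points. -/
theorem exists_isConfig (hU : IsColoredRectangle P col U) (hdis : Disjoint (P col) (P col.other))
    (hO : (P col.other).Nonempty) (hpos : rectangleSize P col U ≠ 0) :
    ∃ s ∈ P col, ∃ o ∈ P col.other, ∃ τ σ T, IsConfig P (col, s) (col.other, o) τ σ T ∧
      T.card = rectangleSize P col U := by
  classical
  obtain ⟨⟨c, v, w, hv, hw, hvw, rfl⟩, hobs⟩ := hU
  set S := (P col).filter (· ∈ spanned c v w) with hSdef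
  have hcard : rectangleSize P col (spanned c v w) = S.card := by
    rw [rectangleSize, ← Set.ncard_coe_finset]
    congr 1
    ext p
    simp [hSdef]
  have hS : S.Nonempty := by
    rw [← Finset.card_pos]
    omega
  obtain ⟨g, hg, hclear, o, ho, htouch⟩ := exists_tangent_direction hS hO
    ⟨(v 0, v 1), fun h => hv (by
      simp only [Prod.mk_eq_zero] at h
      ext i
      fin_cases i <;> simp [h]), fun q hq => clearance_of_rectangle hS hv hw hvw
        (fun p hp => (Finset.mem_filter.mp hp).2) (hobs q hq)⟩
  obtain ⟨s, hs, τ, σ, hconf⟩ := exists_isConfig_of_direction hS (Finset.filter_subset _ _) rfl hdis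
    hg hclear ho htouch
  exact ⟨s, (Finset.mem_filter.mp hs).1, o, ho, τ, σ, _, hconf, by rw [Finset.card_map, hcard]⟩

end Rotation

/-! ### The algorithm -/

section Main

variable {N W : ℕ} {P : Color → Finset Plane} {s o : Elem} {u : State N 16} {A B : ℕ → Elem}

/-- The first `N` values of `A` are the coloured points of `P`, without repetition. -/
structure Lists (N : ℕ) (P : Color → Finset Plane) (A : ℕ → Elem) : Prop where
  mem : ∀ e : Elem, e.2 ∈ P e.1 ↔ ∃ i < N, A i = e
  inj : Set.InjOn A (Set.Iio N)

theorem Lists.permOn (h : Lists N P A) (hp : PermOn 0 N A B) : Lists N P B := by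
  refine ⟨fun e => ?_, hp.injOn le_rfl h.inj⟩
  rw [h.mem]
  have := hp.block_eq
  simp only [block, Set.ext_iff, Set.mem_ofPred_eq, Nat.zero_le, true_and] at this
  exact (this e).symm

theorem lists_init {k : ℕ} {a : Fin N → Elem} (h : IsListing a P) :
    Lists N P (cell (State.init k a)) := by
  refine ⟨fun e => ?_, fun i hi j hj hij => ?_⟩
  · rw [← h.2 e.1 e.2]
    constructor
    · rintro ⟨i, hi⟩
      exact ⟨i, i.2, by rw [cell_of_lt _ i.2]; exact hi⟩
    · rintro ⟨i, hi, he⟩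
      exact ⟨⟨i, hi⟩, by rw [cell_of_lt _ hi] at he; exact he⟩
  · rw [cell_of_lt _ hi, cell_of_lt _ hj] at hij
    exact congrArg Fin.val (h.1 hij)

theorem elem_eq_of_point_eq (hdis : Disjoint (P .red) (P .blue)) {e e' : Elem} (h : e.2 ∈ P e.1)
    (h' : e'.2 ∈ P e'.1) (hp : e.2 = e'.2) : e = e' := by
  obtain ⟨c, p⟩ := e
  obtain ⟨c', p'⟩ := e'
  obtain rfl : p = p' := hp
  cases c <;> cases c'
  · rfl
  · exact absurd h' (Finset.disjoint_left.mp hdis h)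
  · exact absurd h (Finset.disjoint_left.mp hdis h')
  · rfl

theorem Lists.eq_of_point_eq (h : Lists N P A) (hdis : Disjoint (P .red) (P .blue)) {i j : ℕ}
    (hi : i < N) (hj : j < N) (hij : (A i).2 = (A j).2) : A i = A j :=
  elem_eq_of_point_eq hdis ((h.mem _).mpr ⟨i, hi, rfl⟩) ((h.mem _).mpr ⟨j, hj, rfl⟩) hij

/-- The increasing order of the array is unique. -/
theorem sorted_unique (hA : Lists N P A) (hdis : Disjoint (P .red) (P .blue))
    (hp : PermOn 0 N A B) (sA : ∀ i j, i < j → j < N → lexKey (A i) ≤ lexKey (A j))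
    (sB : ∀ i j, i < j → j < N → lexKey (B i) ≤ lexKey (B j)) : B = A := by
  have mono : ∀ D : ℕ → Elem, Lists N P D → (∀ i j, i < j → j < N → lexKey (D i) ≤ lexKey (D j)) →
      StrictMono fun i : Fin N => lexKey (D i) := by
    intro D hD sD i j hij
    refine lt_of_le_of_ne (sD i j hij j.2) fun h => ?_
    have := hD.inj i.2 j.2 (hD.eq_of_point_eq hdis i.2 j.2 (lexKey_snd h))
    exact hij.ne (Fin.ext this)
  have hB := hA.permOn hp
  -- Two strictly increasing enumerations with the same range coincide.
  have key := ((mono B hB sB).range_inj (mono A hA sA)).mp (by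
    ext x
    constructor
    · rintro ⟨i, rfl⟩
      obtain ⟨j, hj, h⟩ := (hA.mem _).mp ((hB.mem _).mpr ⟨i, i.2, rfl⟩)
      exact ⟨⟨j, hj⟩, by simp [h]⟩
    · rintro ⟨i, rfl⟩
      obtain ⟨j, hj, h⟩ := (hB.mem _).mp ((hA.mem _).mpr ⟨i, i.2, rfl⟩)
      exact ⟨⟨j, hj⟩, by simp [h]⟩)
  funext i
  by_cases hi : i < N
  · obtain ⟨j, hj, h⟩ := hp.exists_eq ⟨i.zero_le, hi⟩
    have h1 : lexKey (B i) = lexKey (A i) := congrFun key ⟨i, hi⟩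
    rw [h] at h1 ⊢
    exact hA.eq_of_point_eq hdis hj.2 hi (lexKey_snd h1)
  · exact hp.eq_outside (Or.inr (by omega))

/-- A point of height 0 is collinear with `s` and `o`, so it is one of them, and disjointness of the
colour classes makes the elements equal as well. -/
theorem pairCtx (hdis : Disjoint (P .red) (P .blue))
    (hcol : NoThreeCollinear {p : Plane | p ∈ P .red ∨ p ∈ P .blue}) (hs : s.2 ∈ P s.1)
    (ho : o.2 ∈ P o.1) (hso : s.1 ≠ o.1) : PairCtx P s o := by
  have hP : ∀ e : Elem, e.2 ∈ P e.1 → e.2 ∈ P .red ∨ e.2 ∈ P .blue := by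
    rintro ⟨c, p⟩ h
    cases c
    · exact Or.inl h
    · exact Or.inr h
  have hpt : s.2 ≠ o.2 := fun h => hso (congrArg Prod.fst (elem_eq_of_point_eq hdis hs ho h))
  refine ⟨hs, hso, hpt, fun σ e he h0 => ?_⟩
  by_contra hc
  push Not at hc
  refine hcol s.2 (hP s hs) o.2 (hP o ho) e.2 (hP e he) hpt
    (fun h => hc.1 (elem_eq_of_point_eq hdis hs he h).symm)
    (fun h => hc.2 (elem_eq_of_point_eq hdis ho he h).symm) ?_
  have hn := normSq_pos (sub_ne_zero.mpr hpt.symm)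
  simp only [PiLp.sub_apply] at hn
  have h0' : (o.2 0 - s.2 0) * (e.2 1 - s.2 1) + (o.2 1 - s.2 1) * -(e.2 0 - s.2 0) = 0 := by
    cases σ <;> simp only [height, signed] at h0 <;> simp at h0 <;> linarith
  obtain ⟨l, hl0, hl1⟩ := exists_perpendicular hn h0'
  rw [collinear_iff_of_mem (p₀ := s.2) (by simp)]
  refine ⟨o.2 - s.2, ?_⟩
  simp only [Set.mem_insert_iff, Set.mem_singleton_iff, forall_eq_or_imp, forall_eq]
  refine ⟨⟨0, by simp⟩, ⟨1, by simp⟩, -l, ?_⟩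
  ext i
  fin_cases i
  · simp; linarith
  · simp; linarith

/-- Handle a pair in all four orientations, and restore the order of the array. -/
def processFrames : Program 16 :=
  .seq (processPair true true) <| .seq (processPair true false) <|
  .seq (processPair false true) <| .seq (processPair false false) (heapSort lexLT)

/-- Each frame only permutes the array, and `sorted_unique` turns the final lexicographic sort into
the exact original order. Four frames and one sort account for the constant, `4 * 160 + 40 = 680`.
-/
theorem runs_processFrames (pair : PairCtx P s o) (h0 : u.elem 0 = s) (h1 : u.elem 1 = o)
    (hL : Lists N P (cell u)) (hdis : Disjoint (P .red) (P .blue))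
    (hsort : ∀ i j, i < j → j < N → lexKey (cell u i) ≤ lexKey (cell u j)) (hW : N + 1 ≤ W)
    (hgood : u.word 1 = 0 ∨ Achieves P (u.word 1) u.out) :
    Runs W processFrames u fun t v => v.word 0 = u.word 0 ∧ cell v = cell u ∧
      u.word 1 ≤ v.word 1 ∧ Achieves P (v.word 1) v.out ∧
      (∀ τ σ T, IsConfig P s o τ σ T → T.card ≤ v.word 1) ∧
      t ≤ 680 * (N * (Nat.log 2 N + 1)) := by
  have hN : 0 < N := by
    obtain ⟨i, hi, -⟩ := (hL.mem s).mp pair.mem_s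
    omega
  refine runs_seq ((runs_processPair pair h0 h1 hL.mem hL.inj hW hgood).mono ?_)
  rintro t₁ a ⟨a0, a1, aw, pa, ab, ag, aT, ht₁⟩
  have La := hL.permOn pa
  refine runs_seq ((runs_processPair pair a0 a1 La.mem La.inj hW (Or.inr ag)).mono ?_)
  rintro t₂ b ⟨b0, b1, bw, pb, bb, bg, bT, ht₂⟩
  have Lb := La.permOn pb
  refine runs_seq ((runs_processPair pair b0 b1 Lb.mem Lb.inj hW (Or.inr bg)).mono ?_)
  rintro t₃ c ⟨c0, c1, cw, pc, cb, cg, cT, ht₃⟩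
  have Lc := Lb.permOn pc
  refine runs_seq ((runs_processPair pair c0 c1 Lc.mem Lc.inj hW (Or.inr cg)).mono ?_)
  rintro t₄ d ⟨d0, d1, dw, pd, db, dg, dT, ht₄⟩
  refine (runs_heapSort (compares_lexLT s o) d0 d1 hN (by omega)).mono ?_
  rintro t₅ v ⟨kv, pv, sv, ht₅⟩
  have hw1 : v.word 1 = d.word 1 := kv.word 1 (by decide)
  refine ⟨by rw [kv.word 0 (by decide), dw, cw, bw, aw],
    sorted_unique hL hdis ((((pa.trans pb).trans pc).trans pd).trans pv) hsort sv, by omega,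
    by rw [hw1, kv.out]; exact dg, fun τ σ T hT => ?_, by omega⟩
  cases τ <;> cases σ
  · exact (dT T hT).trans hw1.ge
  · exact (cT T hT).trans (by omega)
  · exact (bT T hT).trans (by omega)
  · exact (aT T hT).trans (by omega)

/-- Handle all pairs of points of different colours. -/
def mainLoop : Program 16 :=
  .loop (wordLT (.reg 0) (.mul .len .len)) <|
    .seq (.load 0 (.div (.reg 0) .len)) <|
    .seq (.load 1 (.sub (.reg 0) (.mul (.div (.reg 0) .len) .len))) <|
    .seq (.branch (sameColor 0 1) .skip processFrames) (.assign 0 (.add (.reg 0) (.const 1)))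

open Classical in
/-- A bound for the time in which the main loop processes the pair with number `q`. -/
noncomputable def pairCost (N : ℕ) (A : ℕ → Elem) (q : ℕ) : ℕ :=
  6 + if (A (q / N)).1 = (A (q % N)).1 then 0 else 680 * (N * (Nat.log 2 N + 1))

/-- The pair with number `q` has been processed. -/
def PairDone (N : ℕ) (P : Color → Finset Plane) (A : ℕ → Elem) (u : State N 16) (q : ℕ) : Prop :=
  (A (q / N)).1 ≠ (A (q % N)).1 → Achieves P (u.word 1) u.out ∧
    ∀ τ σ T, IsConfig P (A (q / N)) (A (q % N)) τ σ T → T.card ≤ u.word 1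

/-- The array is the same fixed sequence `A` before each round, so quotient and remainder of the
counter by `N` address every ordered pair exactly once. The best size never decreases, so pairs stay
done. -/
theorem runs_mainLoop (hA : Lists N P A) (hdis : Disjoint (P .red) (P .blue))
    (hcol : NoThreeCollinear {p : Plane | p ∈ P .red ∨ p ∈ P .blue})
    (hsort : ∀ i j, i < j → j < N → lexKey (A i) ≤ lexKey (A j)) (hW : N + 1 ≤ W)
    (hW' : N * N ≤ W) (hu : cell u = A) (h0 : u.word 0 = 0) (h1 : u.word 1 = 0) :
    Runs W mainLoop u fun t v => cell v = A ∧ (∀ q < N * N, PairDone N P A v q) ∧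
      t ≤ ∑ q ∈ Finset.range (N * N), pairCost N A q + 1 := by
  refine (runs_loop
    (I := fun v => cell v = A ∧ v.word 0 ≤ N * N ∧ (v.word 1 = 0 ∨ Achieves P (v.word 1) v.out) ∧
      ∀ q < v.word 0, PairDone N P A v q)
    (Φ := fun v => ∑ q ∈ Finset.Ico (v.word 0) (N * N), pairCost N A q) ?_
    ⟨hu, by omega, Or.inl h1, by omega⟩).mono ?_
  · rintro v ⟨hv, v0, hgood, hdone⟩ hT
    simp only [holds_wordLT, WordExpr.eval] at hT
    have hN : 0 < N := Nat.pos_of_ne_zero (by rintro rfl; simp at hT)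
    have hdiv : v.word 0 / N < N := Nat.div_lt_of_lt_mul hT
    have hmod : v.word 0 % N < N := Nat.mod_lt _ hN
    have hmod' : v.word 0 - v.word 0 / N * N = v.word 0 % N := Nat.mod_eq_sub_div_mul.symm
    refine runs_seq (runs_load (by simpa [WordExpr.eval] using hdiv) (runs_seq (runs_load
      (by simpa [WordExpr.eval, hmod'] using hmod) ?_)))
    set a : State N 16 := { arr := v.arr, word := _, elem := _, out := v.out } with ha
    have ca : cell a = A := hv
    have a0 : a.elem 0 = A (v.word 0 / N) := by
      rw [← hv, cell_of_lt v hdiv]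
      simp [ha, WordExpr.eval]
    have a1 : a.elem 1 = A (v.word 0 % N) := by
      rw [← hv, cell_of_lt v hmod]
      simp [ha, WordExpr.eval, hmod']
    have aw : a.word = v.word := rfl
    have ao : a.out = v.out := rfl
    clear_value a
    have hsum := Finset.sum_eq_sum_Ico_succ_bot hT (pairCost N A)
    rw [hsum]
    refine runs_seq (runs_branch (fun hc => runs_skip ?_) fun hc => ?_)
    · rw [holds_sameColor, a0, a1] at hc
      refine runs_assign (by simp [WordExpr.eval, aw]; omega) ⟨⟨ca, ?_, ?_, ?_⟩, ?_⟩
      · simp [WordExpr.eval, aw]; omega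
      · simpa [aw, ao] using hgood
      · intro q hq
        simp only [WordExpr.eval, aw, Function.update_self] at hq
        rcases (Nat.lt_succ_iff.mp hq).lt_or_eq with h | rfl
        · simpa [PairDone, aw, ao] using hdone q h
        · exact fun hne => absurd hc hne
      · simp only [WordExpr.eval, aw, Function.update_self, pairCost]
        omega
    · rw [holds_sameColor, a0, a1] at hc
      have hpair : PairCtx P (A (v.word 0 / N)) (A (v.word 0 % N)) :=
        pairCtx hdis hcol ((hA.mem _).mpr ⟨_, hdiv, rfl⟩) ((hA.mem _).mpr ⟨_, hmod, rfl⟩) hc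
      refine (runs_processFrames hpair a0 a1 (ca ▸ hA) hdis (ca ▸ hsort) hW
        (by rw [aw, ao]; exact hgood)).mono ?_
      rintro t b ⟨bw, cb, hb, gb, hT', ht⟩
      rw [aw] at bw hb
      refine runs_assign (by simp [WordExpr.eval, bw]; omega) ⟨⟨cb.trans ca, ?_, ?_, ?_⟩, ?_⟩
      · simp [WordExpr.eval, bw]; omega
      · simpa using Or.inr gb
      · intro q hq
        simp only [WordExpr.eval, bw, Function.update_self] at hq
        rcases (Nat.lt_succ_iff.mp hq).lt_or_eq with h | rfl
        · intro hne
          simpa using And.intro gb fun τ σ T hT => ((hdone q h hne).2 τ σ T hT).trans hb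
        · intro hne
          simpa using And.intro gb hT'
      · simp only [WordExpr.eval, bw, Function.update_self, pairCost, if_neg hc]
        omega
  · rintro t v ⟨⟨hv, v0, -, hdone⟩, hT, ht⟩
    simp only [holds_wordLT, WordExpr.eval, not_lt] at hT
    have hv0 : v.word 0 = N * N := le_antisymm v0 hT
    rw [hv0, h0] at ht
    refine ⟨hv, fun q hq => hdone q (by omega), ?_⟩
    simpa using ht

/-- The counter is determined by its quotient and remainder, so the expensive rounds embed into the
red-blue and the blue-red pairs, of which there are `2mn`. -/
theorem sum_pairCost_le {n m : ℕ} (hA : Lists N P A) (hn : (P .red).card = n)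
    (hm : (P .blue).card = m) :
    ∑ q ∈ Finset.range (N * N), pairCost N A q ≤
      6 * (N * N) + 2 * (m * n) * (680 * (N * (Nat.log 2 N + 1))) := by
  classical
  simp only [pairCost, Finset.sum_add_distrib, Finset.sum_const, Finset.card_range, smul_eq_mul]
  have hsplit : ∀ q, (if (A (q / N)).1 = (A (q % N)).1 then 0
      else 680 * (N * (Nat.log 2 N + 1))) =
      if (A (q / N)).1 ≠ (A (q % N)).1 then 680 * (N * (Nat.log 2 N + 1)) else 0 := by
    intro q; by_cases h : (A (q / N)).1 = (A (q % N)).1 <;> simp [h]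
  simp only [hsplit]
  rw [← Finset.sum_filter, Finset.sum_const, smul_eq_mul, mul_comm (N * N) 6]
  gcongr
  set R := (P .red).map ⟨Prod.mk Color.red, Prod.mk_right_injective _⟩ with hR
  set L := (P .blue).map ⟨Prod.mk Color.blue, Prod.mk_right_injective _⟩ with hL
  have hcard : (R ×ˢ L ∪ L ×ˢ R).card ≤ 2 * (m * n) := by
    refine (Finset.card_union_le _ _).trans ?_
    simp only [Finset.card_product, hR, hL, Finset.card_map, hn, hm]
    exact le_of_eq (by ring)
  refine le_trans (Finset.card_le_card_of_injOn (fun q => (A (q / N), A (q % N))) ?_ ?_) hcard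
  · intro q hq
    simp only [Finset.coe_filter, Finset.mem_range, Set.mem_ofPred_eq] at hq
    have hN : 0 < N := Nat.pos_of_ne_zero (by rintro rfl; simp at hq)
    have h1 := (hA.mem _).mpr ⟨_, Nat.div_lt_of_lt_mul hq.1, rfl⟩
    have h2 := (hA.mem _).mpr ⟨_, Nat.mod_lt q hN, rfl⟩
    have h3 := hq.2
    simp only [Finset.coe_union, Finset.coe_product, Set.mem_union, Set.mem_prod, Finset.mem_coe]
    generalize A (q / N) = x at h1 h3 ⊢
    generalize A (q % N) = y at h2 h3 ⊢
    obtain ⟨c, x⟩ := x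
    obtain ⟨d, y⟩ := y
    cases c <;> cases d <;> simp_all
  · intro q hq q' hq' h
    simp only [Finset.coe_filter, Finset.mem_range, Set.mem_ofPred_eq] at hq hq'
    have hN : 0 < N := Nat.pos_of_ne_zero (by rintro rfl; simp at hq)
    simp only [Prod.mk.injEq] at h
    have e1 := hA.inj (Nat.div_lt_of_lt_mul hq.1) (Nat.div_lt_of_lt_mul hq'.1) h.1
    have e2 := hA.inj (Nat.mod_lt q hN) (Nat.mod_lt q' hN) h.2
    rw [← Nat.div_add_mod q N, ← Nat.div_add_mod q' N, e1, e2]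

/-- A largest monochromatic rectangle, by a sweep for every pair of points of different colours. -/
def lmrProgram : Program 16 := .seq (heapSort lexLT) mainLoop

/-- Both colours occur, so every coloured rectangle of positive size reduces to a configuration of a
bichromatic pair by `exists_isConfig`, and at least one such pair has produced an output. Rectangles
of size 0 need no argument. -/
theorem runs_lmrProgram {n m : ℕ} {a : Fin N → Elem} (ha : IsListing a P)
    (hdis : Disjoint (P .red) (P .blue))
    (hcol : NoThreeCollinear {p : Plane | p ∈ P .red ∨ p ∈ P .blue})
    (hn : (P .red).card = n) (hm : (P .blue).card = m) (hn1 : 1 ≤ n) (hm1 : 1 ≤ m) (hN : 0 < N)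
    (hW : N + 1 ≤ W) (hW' : N * N ≤ W) :
    Runs W lmrProgram (State.init 16 a) fun t v =>
      (∃ σ : Equiv.Perm (Fin N), v.arr = a ∘ σ) ∧ Achieves P (v.word 1) v.out ∧
      (∀ col U, IsColoredRectangle P col U → rectangleSize P col U ≤ v.word 1) ∧
      t ≤ 40 * (N * (Nat.log 2 N + 1)) + 6 * (N * N) +
        2 * (m * n) * (680 * (N * (Nat.log 2 N + 1))) + 1 := by
  have hinit := lists_init (k := 16) ha
  refine runs_seq ((runs_heapSort (compares_lexLT _ _) rfl rfl hN (by omega)).mono ?_)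
  rintro t₁ b ⟨kb, pb, sb, ht₁⟩
  have hB := hinit.permOn pb
  refine (runs_mainLoop hB hdis hcol sb hW hW' rfl (kb.word 0 (by decide))
    (kb.word 1 (by decide))).mono ?_
  rintro t₂ v ⟨cv, hdone, ht₂⟩
  have hpairs : ∀ s o : Elem, s.2 ∈ P s.1 → o.2 ∈ P o.1 → s.1 ≠ o.1 →
      Achieves P (v.word 1) v.out ∧ ∀ τ σ T, IsConfig P s o τ σ T → T.card ≤ v.word 1 := by
    intro s o hs ho hso
    obtain ⟨i, hi, rfl⟩ := (hB.mem s).mp hs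
    obtain ⟨j, hj, rfl⟩ := (hB.mem o).mp ho
    have hq : i * N + j < N * N := by nlinarith
    have e1 : (i * N + j) / N = i := by
      rw [Nat.add_comm, Nat.add_mul_div_right _ _ hN, Nat.div_eq_of_lt hj, zero_add]
    have e2 : (i * N + j) % N = j := by
      rw [Nat.add_comm, Nat.add_mul_mod_self_right, Nat.mod_eq_of_lt hj]
    have := hdone _ hq
    rw [PairDone, e1, e2] at this
    exact this hso
  have hne : ∀ col, (P col).Nonempty := by
    rintro (_ | _) <;> rw [← Finset.card_pos] <;> omega
  obtain ⟨r, hr⟩ := hne .red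
  obtain ⟨b', hb'⟩ := hne .blue
  refine ⟨?_, (hpairs (.red, r) (.blue, b') hr hb' (by simp)).1, fun col U hU => ?_, ?_⟩
  -- The permutation of the natural numbers fixes all positions from `N` on, so it restricts to the
  -- array indices.
  · obtain ⟨π, hπ, hv⟩ := pb
    rw [← cv] at hv
    have hlt : ∀ i, i < N ↔ π i < N := by
      intro i
      constructor
      · intro hi
        by_contra hc
        have := hπ (π i) (by omega)
        rw [π.injective.eq_iff] at this
        omega
      · intro hi
        by_contra hc
        rw [hπ i (by omega)] at hi
        exact hc hi
    refine ⟨⟨fun i => ⟨π i, (hlt i).mp i.2⟩, fun i => ⟨π.symm i, (hlt _).mpr (by simp)⟩,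
      fun i => by simp, fun i => by simp⟩, ?_⟩
    funext i
    have := congrFun hv i
    rw [cell_of_lt v i.2, Function.comp, cell_of_lt _ ((hlt i).mp i.2)] at this
    exact this
  · by_cases hz : rectangleSize P col U = 0
    · omega
    have hdis' : Disjoint (P col) (P col.other) := by
      cases col
      · exact hdis
      · exact hdis.symm
    obtain ⟨s, hs, o, ho, τ, σ, T, hT, hc⟩ := exists_isConfig hU hdis' (hne _) hz
    rw [← hc]
    exact (hpairs (col, s) (col.other, o) hs ho (by cases col <;> simp [Color.other])).2 τ σ T hT
  · have := sum_pairCost_le hB hn hm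
    omega

/-- The running time in terms of the bound of the theorem. -/
theorem time_bound {n m t : ℕ} (hn : 1 ≤ n) (hm : 1 ≤ m)
    (ht : t ≤ 40 * ((n + m) * (Nat.log 2 (n + m) + 1)) + 6 * ((n + m) * (n + m)) +
      2 * (m * n) * (680 * ((n + m) * (Nat.log 2 (n + m) + 1))) + 1) :
    (t : ℝ) ≤ 10000 * ((m : ℝ) * ((m : ℝ) + n) *
      (m * Real.sqrt n + m * Real.log m + n * Real.log n)) := by
  set l : ℝ := (Nat.log 2 (n + m) : ℝ) + 1 with hl
  have hn' : (1 : ℝ) ≤ n := by exact_mod_cast hn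
  have hm' : (1 : ℝ) ≤ m := by exact_mod_cast hm
  have ht' : (t : ℝ) ≤ 40 * ((n + m) * l) + 6 * ((n + m) * (n + m)) +
      2 * (m * n) * (680 * ((n + m) * l)) + 1 := by
    rw [hl]; exact_mod_cast ht
  set Q : ℝ := m * Real.sqrt n + m * Real.log m + n * Real.log n with hQ
  have hln : 0 ≤ Real.log n := Real.log_nonneg hn'
  have hlm : 0 ≤ Real.log m := Real.log_nonneg hm'
  have hsq : 1 ≤ Real.sqrt n := by rwa [Real.one_le_sqrt]
  have hmQ : (m : ℝ) ≤ Q := by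
    have : 0 ≤ (n : ℝ) * Real.log n := by positivity
    have : 0 ≤ (m : ℝ) * Real.log m := by positivity
    nlinarith
  -- `n log n ≥ n - 1` follows from `log n ≥ 1 - 1/n`, and the missing 1 comes from `m√n`; this also
  -- covers `n = 1`.
  have hnQ : (n : ℝ) ≤ Q := by
    have h1 := Real.one_sub_inv_le_log_of_pos (show (0 : ℝ) < n by linarith)
    have h2 : (n : ℝ) - 1 ≤ n * Real.log n := by
      have := mul_le_mul_of_nonneg_left h1 (show (0 : ℝ) ≤ n by linarith)
      rwa [mul_sub, mul_one, mul_inv_cancel₀ (by positivity)] at this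
    have : 0 ≤ (m : ℝ) * Real.log m := by positivity
    nlinarith
  have hlog2 : Real.log 2 ≤ 1 := by linarith [Real.log_two_lt_d9]
  -- If `m ≤ n`, the logarithm is at most `log 2 + log n`; otherwise `n log m ≤ m log m`.
  have hlogN : (n : ℝ) * Real.log (n + m) ≤ n + Q := by
    have hms : 0 ≤ (m : ℝ) * Real.sqrt n := by positivity
    rcases le_total (m : ℝ) n with h | h
    · have h1 : Real.log (n + m) ≤ Real.log 2 + Real.log n := by
        rw [← Real.log_mul (by norm_num) (by positivity)]
        exact Real.log_le_log (by positivity) (by linarith)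
      have : 0 ≤ (m : ℝ) * Real.log m := by positivity
      nlinarith
    · have h1 : Real.log (n + m) ≤ Real.log 2 + Real.log m := by
        rw [← Real.log_mul (by norm_num) (by positivity)]
        exact Real.log_le_log (by positivity) (by linarith)
      have : 0 ≤ (n : ℝ) * Real.log n := by positivity
      nlinarith
  have hl2 : l ≤ 2 * Real.log (n + m) + 1 := by
    have h1 := Real.natLog_le_logb (n + m) 2
    push_cast at h1
    have h2 : Real.logb 2 (n + m) ≤ 2 * Real.log (n + m) := by
      rw [Real.logb, div_le_iff₀ (Real.log_pos (by norm_num))]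
      have : 0 ≤ Real.log (n + m : ℝ) := Real.log_nonneg (by linarith)
      nlinarith [Real.log_two_gt_d9]
    linarith
  -- The 5 arises from `l ≤ 2 log(n+m) + 1`, `n log(n+m) ≤ n + Q` and `n ≤ Q`.
  have hnl : (n : ℝ) * l ≤ 5 * Q := by
    have := mul_le_mul_of_nonneg_left hl2 (show (0 : ℝ) ≤ n by linarith)
    linarith
  have hl1 : 1 ≤ l := by
    have : (0 : ℝ) ≤ (Nat.log 2 (n + m) : ℝ) := Nat.cast_nonneg _
    linarith
  set M : ℝ := m * ((m : ℝ) + n) with hM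
  have hM2 : (m : ℝ) + n ≤ M := by nlinarith
  have hM1 : 1 ≤ M := by linarith
  have hQ1 : 1 ≤ Q := hm'.trans hmQ
  have hlQ : l ≤ 5 * Q := by nlinarith
  have t1 : ((n : ℝ) + m) * l ≤ M * (5 * Q) := by
    rw [add_comm]; exact mul_le_mul hM2 hlQ (by linarith) (by linarith)
  have t2 : ((n : ℝ) + m) * (n + m) ≤ M * (2 * Q) := by
    rw [add_comm (n : ℝ)]; exact mul_le_mul hM2 (by linarith) (by linarith) (by linarith)
  have t3 : 2 * ((m : ℝ) * n) * (680 * ((n + m) * l)) ≤ 1360 * (M * (5 * Q)) := by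
    have e : 2 * ((m : ℝ) * n) * (680 * ((n + m) * l)) = 1360 * (M * (n * l)) := by
      rw [hM]; ring
    rw [e]
    have := mul_le_mul_of_nonneg_left hnl (show 0 ≤ M by linarith)
    linarith
  have t4 : 1 ≤ M * Q := by nlinarith
  -- The coefficients add up to `200 + 12 + 6800 + 1`, which is less than 10000.
  calc (t : ℝ) ≤ 40 * (M * (5 * Q)) + 6 * (M * (2 * Q)) + 1360 * (M * (5 * Q)) + M * Q := by
        linarith
    _ ≤ 10000 * (M * Q) := by linarith

end Main

end LMR

theorem mainTheorem1 :
    ∃ (k : ℕ) (prog : Program k) (K : ℕ) (C : ℝ),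
      ∀ (n m : ℕ) (P : Color → Finset Plane),
        1 ≤ n → 1 ≤ m → (P .red).card = n → (P .blue).card = m →
        Disjoint (P .red) (P .blue) →
        NoThreeCollinear {p : Plane | p ∈ P .red ∨ p ∈ P .blue} →
        ∀ a : Fin (n + m) → Elem, IsListing a P →
          ∃ (t : ℕ) (s : State (n + m) k),
            Exec ((n + m) ^ K) prog (State.init k a) t s ∧
            (t : ℝ) ≤ C * ((m : ℝ) * ((m : ℝ) + n) *
              (m * Real.sqrt n + m * Real.log m + n * Real.log n)) ∧
            (∃ σ : Equiv.Perm (Fin (n + m)), s.arr = a ∘ σ) ∧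
            ∃ (col : Color) (c v w : Plane),
              s.out = some (col, c, v, w) ∧ v ≠ 0 ∧ w ≠ 0 ∧ inner ℝ v w = 0 ∧
                IsLMR P col (spanned c v w) := by
  -- The cube of the array length is a sufficient word bound: the largest stored number is the pair
  -- counter, which reaches the square, and the other stored numbers are at most the length plus
  -- one.
  refine ⟨16, LMR.lmrProgram, 3, 10000, fun n m P hn hm hr hb hdis hcol a ha => ?_⟩
  have hN : 2 ≤ n + m := by omega
  have hsq : (n + m) ^ 3 = (n + m) * ((n + m) * (n + m)) := by ring
  have hW : n + m + 1 ≤ (n + m) ^ 3 := by rw [hsq]; nlinarith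
  have hW' : (n + m) * (n + m) ≤ (n + m) ^ 3 := by
    rw [hsq]; exact Nat.le_mul_of_pos_left _ (by omega)
  obtain ⟨t, s, hexec, hperm, ⟨col, c, v, w, hout, hv, hw, hvw, hrect, hbest⟩, hmax, ht⟩ :=
    LMR.runs_lmrProgram ha hdis hcol hr hb hn hm (by omega) hW hW'
  exact ⟨t, s, hexec, LMR.time_bound hn hm ht, hperm, col, c, v, w, hout, hv, hw, hvw, hrect,
    fun col' U' hU' => (hmax col' U' hU').trans hbest⟩
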